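/- **Model.** Algorithms are programs for a randomized word RAM: registers and an addressable memory holding natural numbers, unit-cost instructions (constants, $+$, truncated $-$, $\times$, integer division, indirect load and store, and drawing a uniformly random element of $\{0,\dots,m-1\}$ for a computed $m$), sequencing, conditionals and loops. **Problem.** An instance $\mathcal I=(G,c,\rho,\zeta)$ of ConstrainedMinCut consists of a simple graph $G=(V,E)$ with $V=\{0,\dots,n-1\}$, integer vertex weights $0\le c_v\le n$, a rational $\rho$ with $1\le\rho\le c(V)/2$, and a rational $\zeta>0$. A set $S\subseteq V$ is feasible if $\rho(1-\zeta)\le c(S)\le\rho(1+\zeta)$, and $\mathrm{OPT}$ is the minimum of $|\mathrm E(S,\overline S)|$ over the feasible sets $S$. For $\delta,c_0>0$ the instance is $(\delta,c_0)$-dense if every vertex has degree at least $\delta n$ and weight at least $c_0n$. Let $\delta_G$ be the minimum degree of $G$ divided by $n$, let $c_G=\min_v c_v/n$, and for $\varepsilon>0$ put $$\alpha=\alpha(\mathcal I,\varepsilon)=\min\Big\{\tfrac{\varepsilon}{22}\big(\tfrac12-\tfrac3{10}\big)^2\delta_G^2,\ \tfrac{6}{35}\cdot\tfrac{\rho}{c(V)}\,\zeta\,c_G\,\delta_G\Big\}.$$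 **Theorem.** There is a randomized algorithm which takes as input $G$ (adjacency matrix), $c$, and the numerators and denominators of $\rho$, $\zeta$ and of a rational $\varepsilon>0$, such that for all $\delta,c_0>0$ there is a constant $C$, depending only on $\delta$ and $c_0$, for which the following holds for every $(\delta,c_0)$-dense instance and every rational $\varepsilon>0$. 1. The algorithm halts after at most $C n^{C}$ steps, whatever the random choices, and every number that it ever holds is at most $C M^{C}$, where $M$ is the sum of $n$ and of the numerators and denominators of $\rho,\zeta,\varepsilon$. 2. If the instance has a feasible set and $\mathrm{OPT}\le\alpha n^2$, then with probability at least $1-1/n$ the output is a set $L\subseteq V$ with $\rho(1-\zeta)\le c(L)\le\rho(1+\zeta)$ and $|\mathrm E(L,\overline L)|\le(1+\varepsilon)\,\mathrm{OPT}$. -/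

import Mathlib

open scoped ENNReal

/-! ### The problem -/

/-- An instance of `ConstrainedMinCut`: an unweighted (simple) graph on `n` vertices, integer vertex
weights with `0 ≤ c v ≤ n`, a parameter `1 ≤ ρ ≤ c(V) / 2` and an interval parameter `ζ > 0`.
Since `ρ` and `ζ` are inputs of an algorithm, they are rational. -/
structure CMCInstance where
  n : ℕ
  G : SimpleGraph (Fin n)
  c : Fin n → ℕ
  ρ : ℚ
  ζ : ℚ
  c_le : ∀ v, c v ≤ n
  one_le_ρ : 1 ≤ ρ
  ρ_le : ρ ≤ (∑ v, c v : ℕ) / 2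
  ζ_pos : 0 < ζ

namespace CMCInstance

/-- The cost `c(S)` of a vertex set. -/
def cost (I : CMCInstance) (S : Finset (Fin I.n)) : ℕ := ∑ v ∈ S, I.c v

/-- The cost constraint `ρ(1 - ζ) ≤ c(S) ≤ ρ(1 + ζ)`. -/
def Feasible (I : CMCInstance) (S : Finset (Fin I.n)) : Prop :=
  I.ρ * (1 - I.ζ) ≤ I.cost S ∧ (I.cost S : ℚ) ≤ I.ρ * (1 + I.ζ)

open Classical in
/-- The cut size: the number of edges with one end in `S` and the other one outside `S`. -/
noncomputable def cutSize (I : CMCInstance) (S : Finset (Fin I.n)) : ℕ :=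
  (I.G.interedges S Sᶜ).card

/-- The optimal cut size (meaningful only if the instance has a feasible cut). -/
noncomputable def opt (I : CMCInstance) : ℕ :=
  sInf {k | ∃ S, I.Feasible S ∧ I.cutSize S = k}

open Classical in
/-- `G` is everywhere-`δ`-dense and every weight is at least `c₀ n`. -/
def Dense (I : CMCInstance) (δ c₀ : ℝ) : Prop :=
  (∀ v, δ * I.n ≤ I.G.degree v) ∧ ∀ v, c₀ * I.n ≤ I.c v

open Classical in
/-- The density of the graph: its minimum degree divided by `n`. -/
noncomputable def minDensity (I : CMCInstance) : ℚ := I.G.minDegree / I.n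

/-- The smallest vertex weight divided by `n`. -/
noncomputable def minWeight (I : CMCInstance) : ℚ := (⨅ v, I.c v : ℕ) / I.n

/-- The threshold `α = min {(ε / 22) (1/2 - 3a)² δ², 6 ρ' ζ c₀ δ / 35}` with `a = 1/10`, where
`δ` and `c₀` are the minimum degree and the minimum weight divided by `n`, and `ρ' = ρ / c(V)`. -/
noncomputable def alpha (I : CMCInstance) (ε : ℚ) : ℚ :=
  min (ε / 22 * (1 / 2 - 3 * (1 / 10)) ^ 2 * I.minDensity ^ 2)
    (6 * (I.ρ / I.cost Finset.univ) * I.ζ * I.minWeight * I.minDensity / 35)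

end CMCInstance

/-! ### The machine model: a randomized word RAM with structured programs -/

/-- A memory state: registers and an addressable memory, all holding natural numbers. -/
structure RAMStore where
  reg : ℕ → ℕ
  mem : ℕ → ℕ

namespace RAMStore

def setReg (s : RAMStore) (d x : ℕ) : RAMStore := ⟨Function.update s.reg d x, s.mem⟩

def setMem (s : RAMStore) (a x : ℕ) : RAMStore := ⟨s.reg, Function.update s.mem a x⟩

end RAMStore

/-- Elementary instructions. The arguments are register names, except for the constant `k`. -/
inductive RAMInstr
  | const (d k : ℕ)
  | add (d a b : ℕ)
  | sub (d a b : ℕ)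
  | mul (d a b : ℕ)
  | div (d a b : ℕ)
  | load (d a : ℕ)
  | store (a b : ℕ)
  | rand (d a : ℕ)

/-- The effect of an instruction on the store. `rand d a` draws a fresh uniformly random element of
`{0, …, reg a - 1}` (and `0` if `reg a = 0`), all other instructions are deterministic;
`sub` is truncated at `0` and `div` is rounded down. -/
noncomputable def RAMInstr.exec (s : RAMStore) : RAMInstr → PMF RAMStore
  | .const d k => PMF.pure (s.setReg d k)
  | .add d a b => PMF.pure (s.setReg d (s.reg a + s.reg b))
  | .sub d a b => PMF.pure (s.setReg d (s.reg a - s.reg b))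
  | .mul d a b => PMF.pure (s.setReg d (s.reg a * s.reg b))
  | .div d a b => PMF.pure (s.setReg d (s.reg a / s.reg b))
  | .load d a => PMF.pure (s.setReg d (s.mem (s.reg a)))
  | .store a b => PMF.pure (s.setMem (s.reg a) (s.reg b))
  | .rand d a =>
    match s.reg a with
    | 0 => PMF.pure (s.setReg d 0)
    | m + 1 => (PMF.uniformOfFintype (Fin (m + 1))).map fun i : Fin (m + 1) => s.setReg d i.val

/-- Programs. The tests are `reg r ≠ 0`. -/
inductive RAMProg
  | instr (i : RAMInstr)
  | seq (p q : RAMProg)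
  | ite (r : ℕ) (p q : RAMProg)
  | loop (r : ℕ) (p : RAMProg)

/-- A configuration: the stack of programs that remain to be run, and the store. -/
structure RAMConfig where
  code : List RAMProg
  store : RAMStore

namespace RAMConfig

def Halted (x : RAMConfig) : Prop := x.code = []

/-- Every number that is held in a register or in a memory cell is at most `w`. -/
def WordsLE (x : RAMConfig) (w : ℕ) : Prop :=
  (∀ i, x.store.reg i ≤ w) ∧ ∀ i, x.store.mem i ≤ w

/-- One step of the machine; a halted configuration stays as it is. -/
noncomputable def step (x : RAMConfig) : PMF RAMConfig :=
  match x.code with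
  | [] => PMF.pure x
  | .instr i :: k => (i.exec x.store).map fun s => ⟨k, s⟩
  | .seq p q :: k => PMF.pure ⟨p :: q :: k, x.store⟩
  | .ite r p q :: k => PMF.pure ⟨(if x.store.reg r ≠ 0 then p else q) :: k, x.store⟩
  | .loop r p :: k =>
    PMF.pure ⟨if x.store.reg r ≠ 0 then p :: .loop r p :: k else k, x.store⟩

end RAMConfig

/-- The distribution of the configuration after `t` steps of `p`, started with the numbers of the
list `input` in the first memory cells and with `0` in all other cells and in all registers. -/
noncomputable def RAMProg.run (p : RAMProg) (input : List ℕ) : ℕ → PMF RAMConfig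
  | 0 => PMF.pure ⟨[p], ⟨fun _ => 0, fun i => input.getD i 0⟩⟩
  | t + 1 => (p.run input t).bind RAMConfig.step

/-! ### Input and output -/

namespace CMCInstance

/-- The numerical parameters of the input: `n`, and the numerators and denominators
of `ρ`, `ζ` and `ε`. -/
def params (I : CMCInstance) (ε : ℚ) : List ℕ :=
  [I.n, I.ρ.num.natAbs, I.ρ.den, I.ζ.num.natAbs, I.ζ.den, ε.num.natAbs, ε.den]

open Classical in
/-- The input: the parameters, the vertex weights, and the adjacency matrix row by row. -/
noncomputable def input (I : CMCInstance) (ε : ℚ) : List ℕ :=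
  I.params ε ++ List.ofFn I.c ++
    (List.ofFn fun u => List.ofFn fun v => if I.G.Adj u v then 1 else 0).flatten

/-- The output: the vertices `v` whose memory cell, cell number `v`, is nonzero. -/
def output (I : CMCInstance) (x : RAMConfig) : Finset (Fin I.n) :=
  Finset.univ.filter fun v => x.store.mem v ≠ 0

/-- `L` is feasible and its cut size is at most `(1 + ε) OPT`. -/
def IsApproxSolution (I : CMCInstance) (ε : ℚ) (L : Finset (Fin I.n)) : Prop :=
  I.Feasible L ∧ (I.cutSize L : ℚ) ≤ (1 + ε) * I.opt

end CMCInstance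

/-! ### Deterministic executions -/

/-! No random bits are needed: what a random sample would reveal is enumerated, so each run is a
point mass and success has probability one. Let `d` be the minimum degree and `x` the indicator of
an optimal set, with cut size `K`.

Linearisation. For a reference set `t`, charge each vertex `v` its number of neighbours that `t`
puts on the other side than `x` puts `v`. Polarising the quadratic cut function shows that the total
charge `lin t x` equals `cut x + cut t + ∑ A v u (x v - t v) (x u - t u)`, so it is `cut x + cut t`
up to `dist x t ^ 2` (`abs_lin_sub_le`). Hence, among the sets with the cost of `x` and its distance
from `t`, one of least charge has cut size at most `K + 2 * dist x t ^ 2`. Finding it is a knapsack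
problem, solved by a dynamic program over the combined weight `cost * (n + 1) + dist` (`back_spec`,
`back_good`).

Reference set. It remains to find `t` with `dist x t * d ≤ 16 * K`. Call a vertex rough if at least
`d / 4` of its neighbours are on the other side of `x`; there are at most `8 * K / d` of them. By a
second moment argument some sequence of `32 * (n / d + 1) ^ 3` vertices, labelled with their sides,
classifies all but `d / 8` of the other vertices correctly (`exists_sample`, `exists_samp`). If the
resulting set is within `d / 4` of `x`, one majority step repairs every vertex that is not rough
(`dist_maj_le`); otherwise the rough vertices already make up at least half of the distance
(`exists_stage`). Since `n / d ≤ 1 / δ`, the sample size is bounded, and all labelled samples, both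
stages and all combined weights can be tried in polynomial time.

Quality. The first term of `alpha` gives `550 * K ≤ ε * d ^ 2`, so the loss `2 * (16 * K / d) ^ 2 =
512 * K ^ 2 / d ^ 2` is at most `ε * K`.

Machine. The algorithm is an expression over tables of numbers in which every arithmetic result is
cut off at a bound `B`. Time and word bounds then follow from the shape of the expression alone
(`eval_le`, `cost_le`, `wp_comp`), and for large `B` the expression has the intended value
(`eval_outE`). -/

namespace RAMStore

/-- Every number that is held in a register or in a memory cell is at most `w`. -/
def AllLE (s : RAMStore) (w : ℕ) : Prop := (∀ i, s.reg i ≤ w) ∧ ∀ i, s.mem i ≤ w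

theorem AllLE.setReg {s : RAMStore} {w : ℕ} (h : s.AllLE w) (d : ℕ) {x : ℕ} (hx : x ≤ w) :
    (s.setReg d x).AllLE w := by
  refine ⟨fun i => ?_, h.2⟩
  by_cases hi : i = d
  · subst hi; simpa [RAMStore.setReg] using hx
  · simpa [RAMStore.setReg, hi] using h.1 i

theorem AllLE.setMem {s : RAMStore} {w : ℕ} (h : s.AllLE w) (a : ℕ) {x : ℕ} (hx : x ≤ w) :
    (s.setMem a x).AllLE w := by
  refine ⟨h.1, fun i => ?_⟩
  by_cases hi : i = a
  · subst hi; simpa [RAMStore.setMem] using hx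
  · simpa [RAMStore.setMem, hi] using h.2 i

@[simp] theorem setReg_reg (s : RAMStore) (d x i : ℕ) :
    (s.setReg d x).reg i = if i = d then x else s.reg i := by
  simp [setReg, Function.update_apply]

@[simp] theorem setReg_mem (s : RAMStore) (d x : ℕ) : (s.setReg d x).mem = s.mem := rfl

@[simp] theorem setMem_mem (s : RAMStore) (a x i : ℕ) :
    (s.setMem a x).mem i = if i = a then x else s.mem i := by
  simp [setMem, Function.update_apply]

@[simp] theorem setMem_reg (s : RAMStore) (a x : ℕ) : (s.setMem a x).reg = s.reg := rfl

end RAMStore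

/-- `Steps w x t y`: the machine goes from `x` to `y` in `t` deterministic steps, and all words on
the way are at most `w`. -/
inductive Steps (w : ℕ) : RAMConfig → ℕ → RAMConfig → Prop
  | refl (x : RAMConfig) : x.WordsLE w → Steps w x 0 x
  | head (x y z : RAMConfig) (t : ℕ) : x.WordsLE w → x.step = PMF.pure y → Steps w y t z →
      Steps w x (t + 1) z

theorem Steps.trans {w : ℕ} {x y z : RAMConfig} {t u : ℕ} (h : Steps w x t y)
    (h' : Steps w y u z) : Steps w x (t + u) z := by
  induction h with
  | refl x hx => simpa using h'
  | head x y _ t hx hs _ ih =>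
    have := Steps.head x y z (t + u) hx hs (ih h')
    rwa [show t + 1 + u = t + u + 1 by ring]

/-- Weakest precondition: started in `s`, the program `p` ends after at most `T` deterministic steps
in a store that satisfies `Q`; no word exceeds `w` if none does in `s`. -/
def WP (w T : ℕ) (p : RAMProg) (s : RAMStore) (Q : RAMStore → Prop) : Prop :=
  s.AllLE w → ∃ t s', t ≤ T ∧ (∀ k, Steps w ⟨p :: k, s⟩ t ⟨k, s'⟩) ∧ s'.AllLE w ∧ Q s'

namespace WP

variable {w T : ℕ} {s : RAMStore} {Q : RAMStore → Prop}

theorem mono {T' : ℕ} {p : RAMProg} {Q' : RAMStore → Prop} (h : WP w T p s Q) (hT : T ≤ T')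
    (hQ : ∀ s', s'.AllLE w → Q s' → Q' s') : WP w T' p s Q' := by
  intro hs
  obtain ⟨t, s', ht, hr, hs', hq⟩ := h hs
  exact ⟨t, s', ht.trans hT, hr, hs', hQ s' hs' hq⟩

theorem seq {T₁ T₂ : ℕ} {p q : RAMProg} (h : WP w T₁ p s fun s' => WP w T₂ q s' Q) :
    WP w (T₁ + T₂ + 1) (.seq p q) s Q := by
  intro hs
  obtain ⟨t₁, s₁, ht₁, hr₁, hs₁, h'⟩ := h hs
  obtain ⟨t₂, s₂, ht₂, hr₂, hs₂, hq⟩ := h' hs₁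
  refine ⟨t₁ + t₂ + 1, s₂, by omega, fun k => ?_, hs₂, hq⟩
  exact Steps.head _ _ _ _ hs rfl ((hr₁ (q :: k)).trans (hr₂ k))

theorem ite {r : ℕ} {p q : RAMProg} (h₁ : s.reg r ≠ 0 → WP w T p s Q)
    (h₂ : s.reg r = 0 → WP w T q s Q) : WP w (T + 1) (.ite r p q) s Q := by
  intro hs
  by_cases h : s.reg r = 0
  · obtain ⟨t, s', ht, hr, hs', hq⟩ := h₂ h hs
    refine ⟨t + 1, s', by omega, fun k => ?_, hs', hq⟩
    exact Steps.head _ _ _ _ hs (by simp [RAMConfig.step, h]) (hr k)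
  · obtain ⟨t, s', ht, hr, hs', hq⟩ := h₁ h hs
    refine ⟨t + 1, s', by omega, fun k => ?_, hs', hq⟩
    exact Steps.head _ _ _ _ hs (by simp [RAMConfig.step, h]) (hr k)

/-- The index of the invariant is the value of the test register, hence the number of rounds left. A
round costs `T` steps and one test; the last test costs one more step. -/
theorem loop {r : ℕ} {p : RAMProg} (Inv : ℕ → RAMStore → Prop)
    (hr : ∀ m s, Inv m s → s.reg r = m)
    (hb : ∀ m s, Inv (m + 1) s → WP w T p s (Inv m)) :
    ∀ m s, Inv m s → WP w (m * (T + 1) + 1) (.loop r p) s (Inv 0) := by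
  intro m
  induction m with
  | zero =>
    intro s hI hs
    refine ⟨1, s, by omega, fun k => ?_, hs, hI⟩
    exact Steps.head _ _ _ _ hs (by simp only [RAMConfig.step, hr 0 s hI]; rfl) (Steps.refl _ hs)
  | succ m ih =>
    intro s hI hs
    obtain ⟨t₁, s₁, ht₁, hr₁, hs₁, h₁⟩ := hb m s hI hs
    obtain ⟨t₂, s₂, ht₂, hr₂, hs₂, h₂⟩ := ih s₁ h₁ hs₁
    refine ⟨t₁ + t₂ + 1, s₂, by nlinarith, fun k => ?_, hs₂, h₂⟩
    refine Steps.head _ _ _ _ hs ?_ ((hr₁ _).trans (hr₂ k))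
    simp [RAMConfig.step, hr _ s hI]

theorem instr {i : RAMInstr} {s' : RAMStore} (he : i.exec s = PMF.pure s')
    (hs' : s.AllLE w → s'.AllLE w) (hQ : Q s') : WP w 1 (.instr i) s Q := by
  intro hs
  refine ⟨1, s', le_rfl, fun k => ?_, hs' hs, hQ⟩
  exact Steps.head _ ⟨k, s'⟩ _ _ hs (by simp [RAMConfig.step, he, PMF.pure_map])
    (Steps.refl _ (hs' hs))

theorem const {d k : ℕ} (hk : k ≤ w) (hQ : Q (s.setReg d k)) : WP w 1 (.instr (.const d k)) s Q :=
  instr rfl (fun h => h.setReg d hk) hQ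

theorem add {d a b : ℕ} (hk : s.reg a + s.reg b ≤ w) (hQ : Q (s.setReg d (s.reg a + s.reg b))) :
    WP w 1 (.instr (.add d a b)) s Q :=
  instr rfl (fun h => h.setReg d hk) hQ

theorem mul {d a b : ℕ} (hk : s.reg a * s.reg b ≤ w) (hQ : Q (s.setReg d (s.reg a * s.reg b))) :
    WP w 1 (.instr (.mul d a b)) s Q :=
  instr rfl (fun h => h.setReg d hk) hQ

theorem sub {d a b : ℕ} (hQ : Q (s.setReg d (s.reg a - s.reg b))) :
    WP w 1 (.instr (.sub d a b)) s Q :=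
  instr rfl (fun h => h.setReg d ((Nat.sub_le _ _).trans (h.1 a))) hQ

theorem div {d a b : ℕ} (hQ : Q (s.setReg d (s.reg a / s.reg b))) :
    WP w 1 (.instr (.div d a b)) s Q :=
  instr rfl (fun h => h.setReg d ((Nat.div_le_self _ _).trans (h.1 a))) hQ

theorem load {d a : ℕ} (hQ : Q (s.setReg d (s.mem (s.reg a)))) :
    WP w 1 (.instr (.load d a)) s Q :=
  instr rfl (fun h => h.setReg d (h.2 _)) hQ

theorem store {a b : ℕ} (hQ : Q (s.setMem (s.reg a) (s.reg b))) :
    WP w 1 (.instr (.store a b)) s Q :=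
  instr rfl (fun h => h.setMem _ (h.1 b)) hQ

end WP

/-- After a complete deterministic execution, the distribution is a point mass at all times. -/
theorem RAMProg.run_of_steps {p : RAMProg} {input : List ℕ} {w T : ℕ} {s : RAMStore}
    (h : Steps w ⟨[p], ⟨fun _ => 0, fun i => input.getD i 0⟩⟩ T ⟨[], s⟩) :
    (∀ t, T ≤ t → p.run input t = PMF.pure ⟨[], s⟩) ∧
      ∀ t, ∃ x : RAMConfig, p.run input t = PMF.pure x ∧ x.WordsLE w := by
  -- The start time is arbitrary because the induction on `Steps` advances it.
  have key : ∀ (x y : RAMConfig) (T : ℕ), Steps w x T y → ∀ t₀, p.run input t₀ = PMF.pure x →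
      p.run input (t₀ + T) = PMF.pure y ∧
        y.WordsLE w ∧ ∀ t, t₀ ≤ t → t ≤ t₀ + T → ∃ z, p.run input t = PMF.pure z ∧ z.WordsLE w := by
    intro x y T hst
    induction hst with
    | refl x hx =>
      intro t₀ h₀
      refine ⟨h₀, hx, fun t h1 h2 => ⟨x, ?_, hx⟩⟩
      rwa [show t = t₀ by omega]
    | head x y z t hx hs _ ih =>
      intro t₀ h₀
      have h₁ : p.run input (t₀ + 1) = PMF.pure y := by
        simp [RAMProg.run, h₀, PMF.pure_bind, hs]
      obtain ⟨a, b, c⟩ := ih (t₀ + 1) h₁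
      refine ⟨by rwa [show t₀ + (t + 1) = t₀ + 1 + t by ring], b, fun t' h1 h2 => ?_⟩
      rcases Nat.eq_or_lt_of_le h1 with h | h
      · exact ⟨x, by rwa [← h], hx⟩
      · exact c t' h (by omega)
  obtain ⟨hT, hw, hall⟩ := key _ _ _ h 0 rfl
  rw [zero_add] at hT
  have hlate : ∀ t, T ≤ t → p.run input t = PMF.pure ⟨[], s⟩ := by
    intro t ht
    induction t, ht using Nat.le_induction with
    | base => exact hT
    | succ t _ ih => simp [RAMProg.run, ih, PMF.pure_bind, RAMConfig.step]
  refine ⟨hlate, fun t => ?_⟩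
  rcases le_total t T with ht | ht
  · exact hall t (Nat.zero_le _) (by omega)
  · exact ⟨_, hlate t ht, hw⟩

/-! ### A language of expressions with tables -/

/-- Binary operations. -/
inductive BinOp
  | add | sub | mul | div

namespace BinOp

def fn : BinOp → ℕ → ℕ → ℕ
  | add, x, y => x + y
  | sub, x, y => x - y
  | mul, x, y => x * y
  | div, x, y => x / y

def toInstr : BinOp → ℕ → ℕ → ℕ → RAMInstr
  | add, d, a, b => .add d a b
  | sub, d, a, b => .sub d a b
  | mul, d, a, b => .mul d a b
  | div, d, a, b => .div d a b

/-- The operation with its result cut off at `B`. -/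
def clip (B : ℕ) : BinOp → ℕ → ℕ → ℕ
  | add, x, y => min (x + y) B
  | sub, x, y => x - y
  | mul, x, y => min (x * y) B
  | div, x, y => x / y

/-- Differences and quotients never exceed their first argument, so all four operations can be
compiled with the same cut-off. -/
theorem clip_eq (o : BinOp) {B x : ℕ} (y : ℕ) (hx : x ≤ B) :
    o.clip B x y = min (o.fn x y) B := by
  cases o with
  | add => rfl
  | sub => exact (min_eq_left ((Nat.sub_le _ _).trans hx)).symm
  | mul => rfl
  | div => exact (min_eq_left ((Nat.div_le_self _ _).trans hx)).symm

theorem fn_le (o : BinOp) {x y B : ℕ} (hx : x ≤ B) (hy : y ≤ B) : o.fn x y ≤ B * B + 2 * B := by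
  cases o with
  | add => simp only [fn]; nlinarith
  | sub => simp only [fn]; exact (Nat.sub_le _ _).trans (by nlinarith)
  | mul => simp only [fn]; nlinarith [Nat.mul_le_mul hx hy]
  | div => simp only [fn]; exact (Nat.div_le_self _ _).trans (by nlinarith)

theorem wp {w d a b : ℕ} {s : RAMStore} {Q : RAMStore → Prop} (o : BinOp)
    (hk : o.fn (s.reg a) (s.reg b) ≤ w) (hQ : Q (s.setReg d (o.fn (s.reg a) (s.reg b)))) :
    WP w 1 (.instr (o.toInstr d a b)) s Q := by
  cases o
  · exact WP.add hk hQ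
  · exact WP.sub hQ
  · exact WP.mul hk hQ
  · exact WP.div hQ

end BinOp

/-- Expressions over tables of natural numbers: `idx l` is the length of table `l`, `get l e` its
entry number `e`, and `arr d m e f` evaluates `f` after table `d` has been filled with `m` entries;
each of them is the value of `e` with the previous entries as table `d`. -/
inductive Ex
  | lit (k : ℕ)
  | idx (l : ℕ)
  | get (l : ℕ) (e : Ex)
  | op (o : BinOp) (x y : Ex)
  | ite (c x y : Ex)
  | arr (d : ℕ) (m e f : Ex)

/-- Iterated extension of a list by a value computed from it. -/
def fill (g : List ℕ → ℕ) : ℕ → List ℕ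
  | 0 => []
  | m + 1 => fill g m ++ [g (fill g m)]

@[simp] theorem length_fill (g : List ℕ → ℕ) (m : ℕ) : (fill g m).length = m := by
  induction m with
  | zero => rfl
  | succ m ih => simp [fill, ih]

namespace Ex

/-- The value of an expression; the results of operations are cut off at `B`. -/
def eval (B : ℕ) : Ex → (ℕ → List ℕ) → ℕ
  | lit k, _ => k
  | idx l, E => (E l).length
  | get l e, E => (E l).getD (eval B e E) 0
  | op o x y, E => o.clip B (eval B x E) (eval B y E)
  | ite c x y, E => if eval B c E ≠ 0 then eval B x E else eval B y E
  | arr d m e f, E =>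
    eval B f (Function.update E d (fill (fun L => eval B e (Function.update E d L)) (eval B m E)))

/-- Only the tables below `d` are used, tables are created in order, literals are small. -/
def wf : ℕ → Ex → Bool
  | _, lit k => k ≤ 100
  | d, idx l => l < d
  | d, get l e => l < d && wf d e
  | d, op _ x y => wf d x && wf d y
  | d, ite c x y => wf d c && wf d x && wf d y
  | d, arr d' m e f => d' == d && wf d m && wf (d + 1) e && wf (d + 1) f

/-- The number of table constructions. -/
def arrs : Ex → ℕ
  | lit _ => 0
  | idx _ => 0
  | get _ e => arrs e
  | op _ x y => arrs x + arrs y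
  | ite c x y => arrs c + arrs x + arrs y
  | arr _ m e f => arrs m + arrs e + arrs f + 1

/-- A bound for the number of steps. -/
def cost (B : ℕ) : Ex → ℕ
  | lit _ => 1
  | idx _ => 3
  | get _ e => cost B e + 7
  | op _ x y => cost B x + cost B y + 7
  | ite c x y => cost B c + cost B x + cost B y + 2
  | arr _ m e f => cost B m + (B * (cost B e + 11) + 5) + cost B f + 2

/-- The tables below `d` and their entries are bounded by `B`. -/
def EnvLE (B d : ℕ) (E : ℕ → List ℕ) : Prop := ∀ l < d, (E l).length ≤ B ∧ ∀ x ∈ E l, x ≤ B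

theorem EnvLE.getD_le {B d : ℕ} {E : ℕ → List ℕ} (h : EnvLE B d E) {l : ℕ} (hl : l < d) (i : ℕ) :
    (E l).getD i 0 ≤ B := by
  by_cases hi : i < (E l).length
  · rw [List.getD_eq_getElem _ _ hi]; exact (h l hl).2 _ (List.getElem_mem hi)
  · rw [List.getD_eq_default _ _ (by omega)]; exact Nat.zero_le _

theorem EnvLE.update {B d : ℕ} {E : ℕ → List ℕ} (h : EnvLE B d E) {L : List ℕ} (hL : L.length ≤ B)
    (hL' : ∀ x ∈ L, x ≤ B) : EnvLE B (d + 1) (Function.update E d L) := by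
  intro l hl
  by_cases h' : l = d
  · subst h'; simpa using ⟨hL, hL'⟩
  · simpa [h'] using h l (by omega)

theorem fill_le {B M : ℕ} {g : List ℕ → ℕ}
    (hg : ∀ L : List ℕ, L.length < M → (∀ x ∈ L, x ≤ B) → g L ≤ B) :
    ∀ m ≤ M, ∀ x ∈ fill g m, x ≤ B := by
  intro m
  induction m with
  | zero => simp [fill]
  | succ m ih =>
    intro hm x hx
    rcases List.mem_append.1 hx with hx | hx
    · exact ih (by omega) x hx
    · rw [List.mem_singleton.1 hx]
      exact hg _ (by simpa using hm) (ih (by omega))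

/-- The cut-off bounds all values without any analysis of what the expression computes; `100 ≤ B`
covers the literals. -/
theorem eval_le {B : ℕ} (hB : 100 ≤ B) : ∀ (e : Ex) (d : ℕ) (E : ℕ → List ℕ), wf d e → EnvLE B d E →
    eval B e E ≤ B := by
  intro e
  induction e with
  | lit k => intro d E hw hE; simp [wf] at hw; exact hw.trans hB
  | idx l => intro d E hw hE; simp [wf] at hw; exact (hE l hw).1
  | get l e ih => intro d E hw hE; simp [wf] at hw; exact hE.getD_le hw.1 _
  | op o x y ihx ihy =>
    intro d E hw hE
    simp [wf] at hw
    rw [eval, o.clip_eq _ (ihx d E hw.1 hE)]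
    exact min_le_right _ _
  | ite c x y _ ihx ihy =>
    intro d E hw hE
    simp [wf] at hw
    simp only [eval]
    split_ifs
    · exact ihx d E hw.1.2 hE
    · exact ihy d E hw.2 hE
  | arr d' m e f ihm ihe ihf =>
    intro d E hw hE
    simp [wf] at hw
    obtain ⟨⟨⟨rfl, hm⟩, he⟩, hf⟩ := hw
    have hmB := ihm _ E hm hE
    refine ihf _ _ hf (hE.update (by simpa using hmB) (fill_le (M := eval B m E) ?_ _ le_rfl))
    intro L hL hL'
    exact ihe _ _ he (hE.update (by omega) hL')

/-- For a fixed expression the cost is a polynomial in `B`: each table construction multiplies the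
cost of its body by `B`. -/
theorem cost_le (e : Ex) : ∃ C, ∀ B, cost B e ≤ C * (B + 1) ^ C := by
  have mono : ∀ {a C D B : ℕ}, a ≤ C * (B + 1) ^ C → C ≤ D → a ≤ D * (B + 1) ^ D := by
    intro a C D B h hCD
    exact h.trans (Nat.mul_le_mul hCD (Nat.pow_le_pow_right (by omega) hCD))
  have one : ∀ B D : ℕ, 1 ≤ (B + 1) ^ D := fun B D => Nat.one_le_pow _ _ (by omega)
  have up : ∀ {C D : ℕ} (B : ℕ), C ≤ D → C * (B + 1) ^ C ≤ C * (B + 1) ^ D := fun B h =>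
    Nat.mul_le_mul le_rfl (Nat.pow_le_pow_right (by omega) h)
  induction e with
  | lit k => exact ⟨1, fun B => by simp [cost]⟩
  | idx l => exact ⟨3, fun B => by simp only [cost]; have := one B 3; omega⟩
  | get l e ih =>
    obtain ⟨C, hC⟩ := ih
    refine ⟨C + 7, fun B => ?_⟩
    have h1 := (hC B).trans (up B (show C ≤ C + 7 by omega))
    have h2 := one B (C + 7)
    simp only [cost]; nlinarith
  | op o x y ihx ihy =>
    obtain ⟨C, hC⟩ := ihx
    obtain ⟨D, hD⟩ := ihy
    refine ⟨C + D + 7, fun B => ?_⟩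
    have h1 := (hC B).trans (up B (show C ≤ C + D + 7 by omega))
    have h2 := (hD B).trans (up B (show D ≤ C + D + 7 by omega))
    have h3 := one B (C + D + 7)
    simp only [cost]; nlinarith
  | ite c x y ihc ihx ihy =>
    obtain ⟨A, hA⟩ := ihc
    obtain ⟨C, hC⟩ := ihx
    obtain ⟨D, hD⟩ := ihy
    refine ⟨A + C + D + 7, fun B => ?_⟩
    have h0 := (hA B).trans (up B (show A ≤ A + C + D + 7 by omega))
    have h1 := (hC B).trans (up B (show C ≤ A + C + D + 7 by omega))
    have h2 := (hD B).trans (up B (show D ≤ A + C + D + 7 by omega))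
    have h3 := one B (A + C + D + 7)
    simp only [cost]; nlinarith
  | arr d m e f ihm ihe ihf =>
    obtain ⟨A, hA⟩ := ihm
    obtain ⟨C, hC⟩ := ihe
    obtain ⟨D, hD⟩ := ihf
    refine ⟨A + C + D + 20, fun B => ?_⟩
    have h0 := (hA B).trans (up B (show A ≤ A + C + D + 20 by omega))
    -- The exponent for the body is one lower than for the rest; the spare factor `B + 1` pays for
    -- its up to `B` repetitions.
    have h1 := (hC B).trans (up B (show C ≤ A + C + D + 19 by omega))
    have h2 := (hD B).trans (up B (show D ≤ A + C + D + 20 by omega))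
    have h3 := one B (A + C + D + 19)
    have h4 : (B + 1) ^ (A + C + D + 20) = (B + 1) ^ (A + C + D + 19) * (B + 1) := pow_succ _ _
    have h5 : B * cost B e ≤ C * (B + 1) ^ (A + C + D + 20) := by
      rw [h4]; calc B * cost B e ≤ (B + 1) * (C * (B + 1) ^ (A + C + D + 19)) :=
            Nat.mul_le_mul (by omega) h1
        _ = _ := by ring
    have h6 : B + 1 ≤ (B + 1) ^ (A + C + D + 20) := by rw [h4]; nlinarith
    simp only [cost]; nlinarith

/-! ### Compilation -/

/-- The register that holds the base address of table `l`. -/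
def rF (l : ℕ) : ℕ := 3 * l + 3
/-- The register that holds the length of table `l`. -/
def rJ (l : ℕ) : ℕ := 3 * l + 4
/-- The registers for intermediate results. -/
def rT (t : ℕ) : ℕ := 3 * t + 5

@[simp] theorem rF_inj {a b : ℕ} : rF a = rF b ↔ a = b := by simp [rF]
@[simp] theorem rJ_inj {a b : ℕ} : rJ a = rJ b ↔ a = b := by simp [rJ]
@[simp] theorem rT_inj {a b : ℕ} : rT a = rT b ↔ a = b := by simp [rT]
@[simp] theorem rF_ne_rJ {a b : ℕ} : rF a ≠ rJ b := by simp only [rF, rJ]; omega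
@[simp] theorem rJ_ne_rF {a b : ℕ} : rJ a ≠ rF b := by simp only [rF, rJ]; omega
@[simp] theorem rF_ne_rT {a b : ℕ} : rF a ≠ rT b := by simp only [rF, rT]; omega
@[simp] theorem rT_ne_rF {a b : ℕ} : rT a ≠ rF b := by simp only [rF, rT]; omega
@[simp] theorem rJ_ne_rT {a b : ℕ} : rJ a ≠ rT b := by simp only [rJ, rT]; omega
@[simp] theorem rT_ne_rJ {a b : ℕ} : rT a ≠ rJ b := by simp only [rJ, rT]; omega
@[simp] theorem zero_ne_rT {a : ℕ} : 0 ≠ rT a := by simp [rT]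
@[simp] theorem zero_ne_rF {a : ℕ} : 0 ≠ rF a := by simp [rF]
@[simp] theorem rF_ne_zero {a : ℕ} : rF a ≠ 0 := by simp [rF]
@[simp] theorem rJ_ne_zero {a : ℕ} : rJ a ≠ 0 := by simp [rJ]
@[simp] theorem zero_ne_rJ {a : ℕ} : 0 ≠ rJ a := by simp [rJ]

/-- Fill table `d` with `rT t` entries, each computed by `body` in register `rT (t + 1)`. -/
def fillCode (d t : ℕ) (body : RAMProg) : RAMProg :=
  .seq (.instr (.add (rF (d + 1)) (rF d) (rT t))) <| .seq (.instr (.const (rJ d) 0)) <|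
    .loop (rT t) <| .seq body <| .seq (.instr (.add (rT (t + 2)) (rF d) (rJ d))) <|
    .seq (.instr (.store (rT (t + 2)) (rT (t + 1)))) <| .seq (.instr (.const (rT (t + 2)) 1)) <|
    .seq (.instr (.add (rJ d) (rJ d) (rT (t + 2)))) (.instr (.sub (rT t) (rT t) (rT (t + 2))))

/-- A program that computes the value of an expression in register `rT t`. -/
def comp : Ex → ℕ → RAMProg
  | lit k, t => .instr (.const (rT t) k)
  | idx l, t => .seq (.instr (.const (rT t) 0)) (.instr (.add (rT t) (rT t) (rJ l)))
  | get l e, t => .seq (comp e t) <| .seq (.instr (.sub (rT (t + 1)) (rJ l) (rT t))) <|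
      .ite (rT (t + 1))
        (.seq (.instr (.add (rT t) (rF l) (rT t))) (.instr (.load (rT t) (rT t))))
        (.instr (.const (rT t) 0))
  -- Register `0` holds `B`, and `z - (z - B) = min z B` performs the cut-off.
  | op o x y, t => .seq (comp x t) <| .seq (comp y (t + 1)) <|
      .seq (.instr (o.toInstr (rT t) (rT t) (rT (t + 1)))) <|
      .seq (.instr (.sub (rT (t + 1)) (rT t) 0)) (.instr (.sub (rT t) (rT t) (rT (t + 1))))
  | ite c x y, t => .seq (comp c t) (.ite (rT t) (comp x t) (comp y t))
  | arr d m e f, t => .seq (comp m t) <| .seq (fillCode d t (comp e (t + 1))) (comp f t)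

/-- The store `s` represents the tables below `d`. -/
structure Rep (B d : ℕ) (E : ℕ → List ℕ) (s : RAMStore) : Prop where
  bound : s.reg 0 = B
  le : EnvLE B d E
  len : ∀ l < d, s.reg (rJ l) = (E l).length
  base : ∀ l < d, s.reg (rF l) + (E l).length ≤ s.reg (rF d)
  mem : ∀ l < d, ∀ i < (E l).length, s.mem (s.reg (rF l) + i) = (E l).getD i 0

/-- Everything that a computation at depth `d` with results from `rT t` on has to preserve. -/
structure Frame (d t : ℕ) (s s' : RAMStore) : Prop where
  bound : s'.reg 0 = s.reg 0
  base : ∀ l ≤ d, s'.reg (rF l) = s.reg (rF l)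
  len : ∀ l < d, s'.reg (rJ l) = s.reg (rJ l)
  tmp : ∀ u < t, s'.reg (rT u) = s.reg (rT u)
  mem : ∀ a < s.reg (rF d), s'.mem a = s.mem a

namespace Frame

variable {d t : ℕ} {s s' s'' : RAMStore}

theorem refl (d t : ℕ) (s : RAMStore) : Frame d t s s :=
  ⟨rfl, fun _ _ => rfl, fun _ _ => rfl, fun _ _ => rfl, fun _ _ => rfl⟩

theorem trans (h : Frame d t s s') (h' : Frame d t s' s'') : Frame d t s s'' where
  bound := h'.bound.trans h.bound
  base l hl := (h'.base l hl).trans (h.base l hl)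
  len l hl := (h'.len l hl).trans (h.len l hl)
  tmp l hl := (h'.tmp l hl).trans (h.tmp l hl)
  mem a ha := (h'.mem a (by rwa [h.base d le_rfl])).trans (h.mem a ha)

theorem weaken {u : ℕ} (h : Frame d u s s') (hu : t ≤ u) : Frame d t s s' :=
  ⟨h.bound, h.base, h.len, fun v hv => h.tmp v (by omega), h.mem⟩

theorem weaken_succ {u : ℕ} (h : Frame (d + 1) u s s') (hu : t ≤ u)
    (hF : s.reg (rF d) ≤ s.reg (rF (d + 1))) : Frame d t s s' :=
  ⟨h.bound, fun l hl => h.base l (by omega), fun l hl => h.len l (by omega),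
    fun v hv => h.tmp v (by omega), fun a ha => h.mem a (by omega)⟩

theorem setT (h : Frame d t s s') {u : ℕ} (hu : t ≤ u) (x : ℕ) :
    Frame d t s (s'.setReg (rT u) x) where
  bound := by simpa using h.bound
  base l hl := by simpa using h.base l hl
  len l hl := by simpa using h.len l hl
  tmp v hv := by simpa [show v ≠ u by omega] using h.tmp v hv
  mem a ha := by simpa using h.mem a ha

end Frame

theorem Rep.of_frame {B d t : ℕ} {E : ℕ → List ℕ} {s s' : RAMStore} (h : Rep B d E s)
    (hf : Frame d t s s') : Rep B d E s' where
  bound := hf.bound.trans h.bound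
  le := h.le
  len l hl := (hf.len l hl).trans (h.len l hl)
  base l hl := by rw [hf.base l hl.le, hf.base d le_rfl]; exact h.base l hl
  mem l hl i hi := by
    rw [hf.base l hl.le, hf.mem _ (by have := h.base l hl; omega)]; exact h.mem l hl i hi

/-- The tables form a stack in memory. The end of table `d` is fixed in `rF (d + 1)` before the
filling starts, so the body, working at depth `d + 1`, puts its own tables behind it. The length
register `rJ d` counts the entries already written, so the body sees exactly this prefix as table
`d`. The number `K` reserves address space for the body. -/
theorem wp_fillCode {B W d t c M K : ℕ} {E : ℕ → List ℕ} {s : RAMStore} {body : RAMProg}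
    {g : List ℕ → ℕ} (hB : 100 ≤ B) (hBW : B * B + 2 * B ≤ W) (hrep : Rep B d E s)
    (hF : s.reg (rF d) + B + K ≤ W) (hM : s.reg (rT t) = M) (hMB : M ≤ B)
    (hg : ∀ L : List ℕ, L.length < M → (∀ x ∈ L, x ≤ B) → g L ≤ B)
    (hbody : ∀ s₁ L, Rep B (d + 1) (Function.update E d L) s₁ → s₁.reg (rF (d + 1)) + K ≤ W →
      WP W c body s₁ fun s' => s'.reg (rT (t + 1)) = g L ∧ Frame (d + 1) (t + 1) s₁ s') :
    WP W (M * (c + 11) + 5) (fillCode d t body) s fun s' =>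
      Rep B (d + 1) (Function.update E d (fill g M)) s' ∧ Frame d t s s' ∧
        s'.reg (rF (d + 1)) = s.reg (rF d) + M := by
  -- Here `m` counts the entries that are still missing.
  set Inv : ℕ → RAMStore → Prop := fun m s' => m ≤ M ∧ s'.reg (rT t) = m ∧
    Rep B (d + 1) (Function.update E d (fill g (M - m))) s' ∧ Frame d t s s' ∧
      s'.reg (rF (d + 1)) = s.reg (rF d) + M with hInv
  have hloop := WP.loop (w := W) (T := c + 10) (r := rT t) (p := .seq body <|
    .seq (.instr (.add (rT (t + 2)) (rF d) (rJ d))) <|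
    .seq (.instr (.store (rT (t + 2)) (rT (t + 1)))) <| .seq (.instr (.const (rT (t + 2)) 1)) <|
    .seq (.instr (.add (rJ d) (rJ d) (rT (t + 2)))) (.instr (.sub (rT t) (rT t) (rT (t + 2)))))
    Inv (fun m s h => h.2.1) (by
      rintro m s₁ ⟨hmM, hmr, hr₁, hf₁, hF₁⟩
      have hlen : (fill g (M - (m + 1))).length = M - (m + 1) := length_fill _ _
      have hgle := fill_le hg (M - (m + 1)) (by omega)
      have hgB := hg _ (by rw [hlen]; omega) hgle
      refine WP.mono (WP.seq (T₁ := c) (T₂ := 9) ((hbody s₁ _ hr₁ (by omega)).mono le_rfl ?_))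
        (by omega) fun _ _ h => h
      rintro s₂ - ⟨hv₂, hf₂⟩
      have hr₂ := hr₁.of_frame hf₂
      have hFd : s₁.reg (rF d) = s.reg (rF d) := hf₁.base d le_rfl
      have hf₂' : Frame d t s s₂ := hf₁.trans (hf₂.weaken_succ (by omega) (by omega))
      have hFd2 : s₂.reg (rF d) = s.reg (rF d) := hf₂'.base d le_rfl
      have hFd3 : s₂.reg (rF (d + 1)) = s.reg (rF d) + M := by rw [hf₂.base _ le_rfl, hF₁]
      have hJ : s₂.reg (rJ d) = M - (m + 1) := by rw [hr₂.len d (by omega)]; simp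
      have hT : s₂.reg (rT t) = m + 1 := by rw [hf₂.tmp t (by omega), hmr]
      refine WP.seq (T₁ := 1) (T₂ := 7) (WP.add (by omega) ?_)
      refine WP.seq (T₁ := 1) (T₂ := 5) (WP.store ?_)
      refine WP.seq (T₁ := 1) (T₂ := 3) (WP.const (by nlinarith) ?_)
      refine WP.seq (T₁ := 1) (T₂ := 1) (WP.add (by simp [hJ]; nlinarith [Nat.sub_le M (m+1)]) ?_)
      refine WP.sub ?_
      have hfill : fill g (M - m) = fill g (M - (m + 1)) ++ [g (fill g (M - (m + 1)))] := by
        rw [show M - m = (M - (m + 1)) + 1 by omega]; rfl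
      refine ⟨by omega, by simp [hT], ?_, ?_, by simp [hFd3]⟩
      · refine ⟨by simpa using hr₂.bound, hrep.le.update (by simp; omega)
          (fill_le hg _ (by omega)), ?_, ?_, ?_⟩
        · intro l hl
          by_cases h : l = d
          · subst h; simp [hJ]; omega
          · have := hr₂.len l hl
            simp [h] at this ⊢; exact this
        · intro l hl
          by_cases h : l = d
          · subst h; simp [hFd2, hFd3]
          · have := hr₂.base l hl
            simp [h] at this ⊢; exact this
        · intro l hl i hi
          by_cases h : l = d
          · subst h
            simp only [Function.update_self, length_fill] at hi
            simp only [Function.update_self, hfill]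
            by_cases hi' : i < M - (m + 1)
            · have := hr₂.mem l hl i (by simpa using hi')
              simp [hJ, hi'.ne] at this ⊢
              rw [this, List.getElem?_append_left (by simpa using hi')]
            · have : i = M - (m + 1) := by omega
              subst this
              simp [hJ, hv₂]
          · have h1 := hr₂.mem l hl i (by simpa [h] using hi)
            have h2 := hrep.base l (by omega)
            have h3 : s₂.reg (rF l) = s.reg (rF l) := hf₂'.base l (by omega)
            simp only [ne_eq, h, not_false_eq_true, Function.update_of_ne] at hi h1 ⊢
            simp [hFd2, hJ, h3] at h1 ⊢
            rw [if_neg (by omega)]; exact h1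
      · refine ⟨by simpa using hf₂'.bound, fun l hl => by simpa using hf₂'.base l hl,
          fun l hl => by simpa [show l ≠ d by omega] using hf₂'.len l hl,
          fun u hu => ?_, fun a ha => ?_⟩
        · simpa [show u ≠ t by omega, show u ≠ t + 2 by omega] using hf₂'.tmp u hu
        · have := hf₂'.mem a ha
          simp [hFd2, hJ]
          rw [if_neg (by omega)]; exact this)
  refine WP.mono (WP.seq (T₁ := 1) (WP.add (by omega) <|
    WP.seq (T₁ := 1) (WP.const (Nat.zero_le _) <| hloop M _ ?_))) (by nlinarith) ?_
  · refine ⟨le_rfl, by simp [hM], ⟨by simpa using hrep.bound,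
      hrep.le.update (by simp) (by simp [fill]), ?_, ?_, ?_⟩,
      ⟨by simp, fun l hl => ?_, fun l hl => ?_, by simp, by simp⟩, by simp [hM]⟩
    · intro l hl
      by_cases h : l = d
      · subst h; simp
      · simpa [h] using hrep.len l (by omega)
    · intro l hl
      by_cases h : l = d
      · subst h; simp
      · have := hrep.base l (by omega)
        simp [h, show l ≠ d + 1 by omega]; omega
    · intro l hl i hi
      by_cases h : l = d
      · subst h; simp at hi
      · have := hrep.mem l (by omega) i (by simpa [h] using hi)
        simpa [h, show l ≠ d + 1 by omega] using this
    · simp [show l ≠ d + 1 by omega]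
    · simp [show l ≠ d by omega]
  · rintro s' - ⟨-, -, h1, h2, h3⟩
    exact ⟨by simpa using h1, h2, h3⟩

/-- Each table construction occupies at most `B` further cells, so `arrs e * B` bounds the growth of
the addresses, which are themselves words. -/
theorem wp_comp {B W : ℕ} (hB : 100 ≤ B) (hBW : B * B + 2 * B ≤ W) : ∀ (e : Ex) (d t : ℕ)
    (E : ℕ → List ℕ) (s : RAMStore), wf d e → Rep B d E s → s.reg (rF d) + arrs e * B ≤ W →
    WP W (cost B e) (comp e t) s fun s' => s'.reg (rT t) = eval B e E ∧ Frame d t s s' := by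
  intro e
  induction e with
  | lit k =>
    intro d t E s hw hr hF
    simp [wf] at hw
    exact WP.const (by nlinarith) ⟨by simp [eval], (Frame.refl d t s).setT le_rfl _⟩
  | idx l =>
    intro d t E s hw hr hF
    simp [wf] at hw
    have h1 := hr.len l hw
    have h2 := (hr.le l hw).1
    refine WP.seq (T₁ := 1) (T₂ := 1) (WP.const (Nat.zero_le _) (WP.add ?_ ⟨?_, ?_⟩))
    · simp; nlinarith
    · simp [eval, h1]
    · exact ((Frame.refl d t s).setT le_rfl _).setT le_rfl _
  | get l e ih =>
    intro d t E s hw hr hF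
    simp [wf] at hw
    refine WP.mono (WP.seq (T₂ := 6) ((ih d t E s hw.2 hr hF).mono le_rfl ?_)) (by simp [cost])
      fun _ _ h => h
    rintro s₁ - ⟨hv, hf⟩
    have hr₁ := hr.of_frame hf
    have h1 := hr₁.len l hw.1
    have h2 := hr₁.base l hw.1
    have h3 : s₁.reg (rF d) ≤ W := by rw [hf.base d le_rfl]; omega
    refine WP.seq (T₁ := 1) (T₂ := 4) (WP.sub (WP.ite (fun h => ?_) fun h => ?_))
    · simp [h1, hv] at h
      refine WP.seq (T₁ := 1) (T₂ := 1) (WP.add ?_ (WP.load ⟨?_, ?_⟩))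
      · simp [hv]; omega
      · have := hr₁.mem l hw.1 (eval B e E) (by omega)
        simpa [hv, eval] using this
      · exact ((hf.setT (by omega) _).setT le_rfl _).setT le_rfl _
    · simp [h1, hv] at h
      refine (WP.const (Nat.zero_le _) ⟨?_, ?_⟩).mono (show 1 ≤ 3 by omega) fun _ _ h => h
      · have : (E l)[eval B e E]? = none := List.getElem?_eq_none (by omega)
        simp [eval, this]
      · exact (hf.setT (by omega) _).setT le_rfl _
  | op o x y ihx ihy =>
    intro d t E s hw hr hF
    simp [wf] at hw
    have hxB := eval_le hB x d E hw.1 hr.le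
    have hyB := eval_le hB y d E hw.2 hr.le
    simp only [arrs, add_mul] at hF
    refine WP.mono (WP.seq ((ihx d t E s hw.1 hr (by omega)).mono le_rfl ?_))
      (show cost B x + (cost B y + 5 + 1) + 1 ≤ _ by simp [cost]; omega) fun _ _ h => h
    rintro s₁ - ⟨hv, hf⟩
    have hr₁ := hr.of_frame hf
    refine WP.seq (T₂ := 5) ((ihy d (t + 1) E s₁ hw.2 hr₁
      (by rw [hf.base d le_rfl]; omega)).mono le_rfl ?_)
    rintro s₂ - ⟨hv₂, hf₂⟩
    have hv' : s₂.reg (rT t) = eval B x E := by rw [hf₂.tmp t (by omega), hv]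
    have hr₂ := hr₁.of_frame hf₂
    refine WP.seq (T₁ := 1) (T₂ := 3) (o.wp ?_ (WP.seq (T₁ := 1) (T₂ := 1) (WP.sub (WP.sub ⟨?_, ?_⟩))))
    · rw [hv', hv₂]; exact (o.fn_le hxB hyB).trans hBW
    · simp [hv', hv₂, eval, hr₂.bound, o.clip_eq _ hxB]; omega
    · exact (((hf.trans (hf₂.weaken (by omega))).setT le_rfl _).setT (by omega) _).setT le_rfl _
  | ite c x y ihc ihx ihy =>
    intro d t E s hw hr hF
    simp [wf] at hw
    simp only [arrs, add_mul] at hF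
    refine WP.mono (WP.seq ((ihc d t E s hw.1.1 hr (by omega)).mono le_rfl ?_))
      (show cost B c + (cost B x + cost B y + 1) + 1 ≤ _ by simp [cost]; omega) fun _ _ h => h
    rintro s₁ - ⟨hv, hf⟩
    have hr₁ := hr.of_frame hf
    have hF₁ : s₁.reg (rF d) = s.reg (rF d) := hf.base d le_rfl
    refine WP.ite (fun h => ?_) fun h => ?_
    · refine (ihx d t E s₁ hw.1.2 hr₁ (by omega)).mono (by omega) ?_
      rintro s₂ - ⟨hv₂, hf₂⟩
      exact ⟨by rw [hv₂, eval, if_pos (by rwa [← hv])], hf.trans hf₂⟩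
    · refine (ihy d t E s₁ hw.2 hr₁ (by omega)).mono (by omega) ?_
      rintro s₂ - ⟨hv₂, hf₂⟩
      exact ⟨by rw [hv₂, eval, if_neg (by simpa [← hv] using h)], hf.trans hf₂⟩
  | arr d' m e f ihm ihe ihf =>
    intro d t E s hw hr hF
    simp [wf] at hw
    obtain ⟨⟨⟨rfl, hm⟩, he⟩, hf⟩ := hw
    simp only [arrs, add_mul, one_mul] at hF
    have hmB := eval_le hB m d' E hm hr.le
    refine WP.mono (WP.seq ((ihm d' t E s hm hr (by omega)).mono le_rfl ?_))
      (show cost B m + ((B * (cost B e + 11) + 5) + cost B f + 1) + 1 ≤ _ by simp [cost]; omega)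
      fun _ _ h => h
    rintro s₁ - ⟨hv, hf₁⟩
    have hr₁ := hr.of_frame hf₁
    have hF₁ : s₁.reg (rF d') = s.reg (rF d') := hf₁.base d' le_rfl
    refine WP.seq ((wp_fillCode (K := arrs e * B) hB hBW hr₁ (by omega) hv hmB
      (fun L hL hL' => eval_le hB e _ _ he (hr.le.update (by omega) hL'))
      (fun s₂ L hr₂ hF₂ => ihe (d' + 1) (t + 1) _ s₂ he hr₂ hF₂)).mono (by gcongr) ?_)
    rintro s₂ - ⟨hr₂, hf₂, hF₂⟩
    refine (ihf (d' + 1) t _ s₂ hf hr₂ (by omega)).mono le_rfl ?_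
    rintro s₃ - ⟨hv₃, hf₃⟩
    have hF₂' : s₂.reg (rF d') = s₁.reg (rF d') := hf₂.base d' le_rfl
    exact ⟨hv₃, hf₁.trans (hf₂.trans (hf₃.weaken_succ le_rfl (by omega)))⟩

end Ex

/-! ### Derived expressions: remainders, comparisons, sums, minimisation. -/

namespace Ex

instance : Add Ex := ⟨op .add⟩
instance : Sub Ex := ⟨op .sub⟩
instance : Mul Ex := ⟨op .mul⟩
instance : Div Ex := ⟨op .div⟩
instance (k : ℕ) : OfNat Ex k := ⟨lit k⟩

/-- The remainder of a division. -/
def md (x y : Ex) : Ex := x - x / y * y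

/-- `a` if `x < y`, and `b` otherwise. -/
def iflt (x y a b : Ex) : Ex := ite (y - x) a b

/-- The last entry of table `d`. -/
def last (d : ℕ) : Ex := get d (idx d - 1)

/-- The sum of the values of `f` for `idx d = 0, …, m - 1`. -/
def sum (d : ℕ) (m f : Ex) : Ex := arr d m (last d + f) (last d)

section Eval

variable {B : ℕ} {E : ℕ → List ℕ} {x y : Ex}

theorem eval_lit (k : ℕ) : eval B (OfNat.ofNat k) E = OfNat.ofNat k := rfl
theorem eval_idx (l : ℕ) : eval B (idx l) E = (E l).length := rfl
theorem eval_get (l : ℕ) (e : Ex) : eval B (get l e) E = (E l).getD (eval B e E) 0 := rfl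
theorem eval_sub : eval B (x - y) E = eval B x E - eval B y E := rfl
theorem eval_div : eval B (x / y) E = eval B x E / eval B y E := rfl
theorem eval_add' : eval B (x + y) E = min (eval B x E + eval B y E) B := rfl
theorem eval_add {a b : ℕ} (hx : eval B x E = a) (hy : eval B y E = b) (h : a + b ≤ B) :
    eval B (x + y) E = a + b := by
  subst hx hy; exact min_eq_left h
theorem eval_mul {a b : ℕ} (hx : eval B x E = a) (hy : eval B y E = b) (h : a * b ≤ B) :
    eval B (x * y) E = a * b := by
  subst hx hy; exact min_eq_left h
theorem eval_ite {c : Ex} : eval B (ite c x y) E = if eval B c E = 0 then eval B y E else eval B x E := by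
  rw [eval]; simp only [ne_eq, ite_not]

theorem eval_iflt {a b : Ex} :
    eval B (iflt x y a b) E = if eval B x E < eval B y E then eval B a E else eval B b E := by
  rw [iflt, eval, eval_sub]
  simp only [Nat.sub_ne_zero_iff_lt]

theorem eval_md {a b : ℕ} (hx : eval B x E = a) (hy : eval B y E = b) (h : a ≤ B) :
    eval B (md x y) E = a % b := by
  have h1 : a / b * b ≤ B := (Nat.div_mul_le_self a b).trans h
  rw [md, eval_sub, hx, eval_mul (by rw [eval_div, hx, hy]) hy h1]
  have := Nat.div_add_mod' a b
  omega

/-- Reduces a table to a closed form: only the next entry after a correct prefix has to be checked.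
-/
theorem fill_eq_map {g : List ℕ → ℕ} {F : ℕ → ℕ} (m : ℕ)
    (h : ∀ j < m, g ((List.range j).map F) = F j) : fill g m = (List.range m).map F := by
  induction m with
  | zero => rfl
  | succ m ih =>
    rw [fill, ih fun j hj => h j (by omega), h m (by omega), List.range_succ, List.map_append]
    rfl

theorem getD_map_range (F : ℕ → ℕ) {i m : ℕ} (h : i < m) :
    ((List.range m).map F).getD i 0 = F i := by
  simp [h]

theorem eval_arr {d M : ℕ} {m e f : Ex} (F : ℕ → ℕ) (hm : eval B m E = M)
    (h : ∀ j < M, eval B e (Function.update E d ((List.range j).map F)) = F j) :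
    eval B (arr d m e f) E = eval B f (Function.update E d ((List.range M).map F)) := by
  rw [eval, hm, fill_eq_map (F := F) M h]

theorem eval_last_map {d j : ℕ} (F : ℕ → ℕ) (h : E d = (List.range j).map F) (hj : j ≠ 0) :
    eval B (last d) E = F (j - 1) := by
  rw [last, eval_get, eval_sub, eval_idx, eval_lit, h]
  simp [Nat.pos_of_ne_zero hj]

/-- The default value `0` of an empty table starts both the prefix sums of `sum` and the search for
a minimum. -/
theorem eval_last_nil {d : ℕ} (h : E d = []) : eval B (last d) E = 0 := by
  rw [last, eval_get, h]; simp

theorem eval_sum {d M : ℕ} {m f : Ex} (F : ℕ → ℕ) (hm : eval B m E = M)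
    (h : ∀ j < M, ∀ L : List ℕ, L.length = j → eval B f (Function.update E d L) = F j)
    (hle : ∑ i ∈ Finset.range M, F i ≤ B) :
    eval B (sum d m f) E = ∑ i ∈ Finset.range M, F i := by
  have hle' : ∀ j ≤ M, ∑ i ∈ Finset.range j, F i ≤ B := fun j hj =>
    (Finset.sum_le_sum_of_subset (Finset.range_mono hj)).trans hle
  rw [sum, eval_arr (fun j => ∑ i ∈ Finset.range (j + 1), F i) hm]
  · rcases Nat.eq_zero_or_pos M with rfl | hM
    · rw [eval_last_nil (by simp)]; simp
    · rw [eval_last_map _ (Function.update_self ..) hM.ne']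
      simp only [Nat.sub_add_cancel hM]
  · intro j hj
    have hf := h j hj ((List.range j).map fun j => ∑ i ∈ Finset.range (j + 1), F i) (by simp)
    rw [Finset.sum_range_succ]
    refine eval_add ?_ hf (by rw [← Finset.sum_range_succ]; exact hle' _ hj)
    rcases Nat.eq_zero_or_pos j with rfl | hpos
    · rw [eval_last_nil (by simp)]; simp
    · rw [eval_last_map _ (Function.update_self ..) hpos.ne']
      simp only [Nat.sub_add_cancel hpos]

/-- The first place up to `m` where `F` is minimal. -/
def argFold (F : ℕ → ℕ) : ℕ → ℕ
  | 0 => 0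
  | m + 1 => if F (m + 1) < F (argFold F m) then m + 1 else argFold F m

theorem argFold_le (F : ℕ → ℕ) (m : ℕ) : argFold F m ≤ m := by
  induction m with
  | zero => rfl
  | succ m ih => rw [argFold]; split_ifs <;> omega

theorem argFold_min (F : ℕ → ℕ) (m : ℕ) : ∀ i ≤ m, F (argFold F m) ≤ F i := by
  induction m with
  | zero => intro i hi; rw [Nat.le_zero.1 hi]; rfl
  | succ m ih =>
    intro i hi
    rw [argFold]
    rcases Nat.eq_or_lt_of_le hi with rfl | h
    · split_ifs <;> omega
    · have := ih i (by omega)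
      split_ifs <;> omega

theorem eval_argFold {d M : ℕ} {m f : Ex} {s : Ex → Ex} (F : ℕ → ℕ) (hm : eval B m E = M)
    (hs : ∀ (L : List ℕ) (e : Ex), e = idx d ∨ e = last d → eval B e (Function.update E d L) < M →
      eval B (s e) (Function.update E d L) = F (eval B e (Function.update E d L))) :
    eval B (arr d m (iflt (s (idx d)) (s (last d)) (idx d) (last d)) f) E =
      eval B f (Function.update E d ((List.range M).map (argFold F))) := by
  refine eval_arr _ hm fun j hj => ?_
  set L := (List.range j).map (argFold F) with hL
  have hi : eval B (idx d) (Function.update E d L) = j := by rw [eval_idx]; simp [hL]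
  have hl : eval B (last d) (Function.update E d L) = argFold F (j - 1) := by
    rcases Nat.eq_zero_or_pos j with rfl | hj'
    · rw [eval_last_nil (by simp [hL])]; rfl
    · rw [eval_last_map _ (Function.update_self ..) hj'.ne']
  have hlt : argFold F (j - 1) < M := (argFold_le F _).trans_lt (by omega)
  rw [eval_iflt, hs L _ (Or.inl rfl) (by omega), hs L _ (Or.inr rfl) (by omega), hi, hl]
  -- At the first entry both `idx d` and `last d` have value `0`, the strict comparison fails, and
  -- the entry is `argFold F 0 = 0`.
  rcases j with _ | j
  · simp [argFold]
  · rfl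

end Eval

end Ex

/-! ### The algorithm -/

/-- The numbers that the algorithm works with: the size of the graph, integral bounds for the cost,
the size of the sample, the vertex weights and the adjacency matrix. -/
structure CutData where
  n : ℕ
  lo : ℕ
  hi : ℕ
  k : ℕ
  c : ℕ → ℕ
  A : ℕ → ℕ → ℕ

namespace CutData

open Finset

variable (D : CutData)

/-- A number larger than every cut size. -/
def big : ℕ := D.n * D.n + 1

/-- A bound for the combined weights of vertex sets. -/
def wmax : ℕ := (D.n + 1) * (D.n + 1) * (D.n + 1)

/-- The `i`-th labelled vertex of the sample with number `g`: `v` or `n + v`. -/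
def digit (g i : ℕ) : ℕ := g / (2 * D.n) ^ i % (2 * D.n)

/-- The number of neighbours of `v` in the first part of the sample. -/
def pos (g v : ℕ) : ℕ := ∑ i ∈ range D.k, if D.digit g i < D.n then D.A v (D.digit g i) else 0

/-- The number of neighbours of `v` in the second part of the sample. -/
def neg (g v : ℕ) : ℕ := ∑ i ∈ range D.k, if D.digit g i < D.n then 0 else D.A v (D.digit g i - D.n)

/-- The vertex set determined by a sample. -/
def samp (g v : ℕ) : ℕ := if D.neg g v < D.pos g v then 1 else 0

/-- The number of neighbours of `v` inside (`x = 0`) or outside (`x ≠ 0`) of the set `t`: the price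
of `v` on side `x`. -/
def price (t : ℕ → ℕ) (v x : ℕ) : ℕ :=
  if x = 0 then ∑ u ∈ range D.n, D.A v u * t u else ∑ u ∈ range D.n, D.A v u * (1 - t u)

/-- The set of the vertices with more neighbours inside than outside of `t`. -/
def maj (t : ℕ → ℕ) (v : ℕ) : ℕ := if D.price t v 1 < D.price t v 0 then 1 else 0

/-- The reference set: the set determined by the sample or the corresponding majority set. -/
def stage (g h : ℕ) : ℕ → ℕ := if h = 0 then D.samp g else D.maj (D.samp g)

/-- The combined weight of `v` on side `x`: the cost, and whether `x` differs from the side of `v`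
in the reference set. -/
def wt (t : ℕ → ℕ) (v x : ℕ) : ℕ := if x = 0 then t v else D.c v * (D.n + 1) + (1 - t v)

/-- The least price with `v` on side `x`, if the least prices for the vertices below `v` are `f`. -/
def opt (B : ℕ) (t f : ℕ → ℕ) (v W x : ℕ) : ℕ :=
  if W < D.wt t v x then D.big else min (f (W - D.wt t v x) + D.price t v x) B

/-- The better side of `v`. -/
def side (B : ℕ) (t f : ℕ → ℕ) (v W : ℕ) : ℕ := if D.opt B t f v W 1 < D.opt B t f v W 0 then 1 else 0

/-- The least price of sides for the vertices below `i` with combined weight `W`. -/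
def dp (B : ℕ) (t : ℕ → ℕ) : ℕ → ℕ → ℕ
  | 0, W => if W = 0 then 0 else D.big
  | i + 1, W => D.opt B t (dp B t i) i W (D.side B t (dp B t i) i W)

/-- The combined weight that remains after the sides of the `i` last vertices have been fixed. -/
def rest (B : ℕ) (t : ℕ → ℕ) (W : ℕ) : ℕ → ℕ
  | 0 => W
  | i + 1 => rest B t W i -
      D.wt t (D.n - (i + 1)) (D.side B t (D.dp B t (D.n - (i + 1))) (D.n - (i + 1)) (rest B t W i))

/-- The set found by backtracking. -/
def back (B : ℕ) (t : ℕ → ℕ) (W v : ℕ) : ℕ := D.side B t (D.dp B t v) v (D.rest B t W (D.n - 1 - v))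

/-- The candidate set with number `G`. -/
def cand (B G : ℕ) : ℕ → ℕ :=
  D.back B (D.stage (G / (2 * D.wmax)) (G / D.wmax % 2)) (G % D.wmax)

/-- The cost of a set. -/
def cost (x : ℕ → ℕ) : ℕ := ∑ v ∈ range D.n, D.c v * x v

/-- The cut size of a set. -/
def cut (x : ℕ → ℕ) : ℕ := ∑ u ∈ range D.n, ∑ v ∈ range D.n, D.A u v * (x u * (1 - x v))

/-- The cut size of a set, or a large number if the cost is out of bounds. -/
def score (x : ℕ → ℕ) : ℕ := if D.cost x < D.lo then D.big else if D.hi < D.cost x then D.big else D.cut x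

/-- The number of candidate sets. -/
def count : ℕ := (2 * D.n) ^ D.k * (2 * D.wmax)

/-- The output set. -/
def out (B : ℕ) : ℕ → ℕ := D.cand B (Ex.argFold (fun G => D.score (D.cand B G)) (D.count - 1))

/-- The degree of a vertex. -/
def deg (v : ℕ) : ℕ := ∑ u ∈ range D.n, D.A v u

/-- The size of the sample that the algorithm uses. -/
def sampleSize : ℕ :=
  32 * ((D.n / D.deg (Ex.argFold D.deg (D.n - 1)) + 1) * (D.n / D.deg (Ex.argFold D.deg (D.n - 1)) + 1) *
    (D.n / D.deg (Ex.argFold D.deg (D.n - 1)) + 1))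

/-- Weights are at most `n`, and adjacencies at most `1`. -/
structure Small : Prop where
  c_le : ∀ v < D.n, D.c v ≤ D.n
  A_le : ∀ u < D.n, ∀ v < D.n, D.A u v ≤ 1

end CutData

/-! ### The algorithm as an expression. -/

namespace Ex

def nE : Ex := get 0 0
def loE : Ex := get 0 1
def hiE : Ex := get 0 2
def kE : Ex := get 0 3
def countE : Ex := get 0 4
def bigE : Ex := nE * nE + 1
def wmaxE : Ex := (nE + 1) * (nE + 1) * (nE + 1)
def cE (v : Ex) : Ex := get 1 v
def aE (u v : Ex) : Ex := get 1 (nE + u * nE + v)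
-- Table `5` receives the quotients of the sample number by the powers of `2 * n`; each comes from
-- its predecessor by one division, so no power is formed.
def quotE : Ex := ite (idx 5) (get 5 (idx 5 - 1) / (2 * nE)) (get 4 0 / (2 * wmaxE))
def digitE (i : Ex) : Ex := md (get 5 i) (2 * nE)
def sampE : Ex :=
  iflt (sum 7 kE (iflt (digitE (idx 7)) nE 0 (aE (idx 6) (digitE (idx 7) - nE))))
    (sum 7 kE (iflt (digitE (idx 7)) nE (aE (idx 6) (digitE (idx 7))) 0)) 1 0
def stageE : Ex :=
  ite (md (get 4 0 / wmaxE) 2)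
    (iflt (sum 8 nE (aE (idx 7) (idx 8) * (1 - get 6 (idx 8))))
      (sum 8 nE (aE (idx 7) (idx 8) * get 6 (idx 8))) 1 0)
    (get 6 (idx 7))
def price1E : Ex := sum 9 nE (aE (idx 8) (idx 9) * (1 - get 7 (idx 9)))
def price0E : Ex := sum 10 nE (aE (idx 9) (idx 10) * get 7 (idx 10))
def wt1E (v : Ex) : Ex := cE v * (nE + 1) + (1 - get 7 v)
def wt0E (v : Ex) : Ex := get 7 v
def opt1E (v W : Ex) : Ex :=
  iflt W (wt1E v) bigE (get 10 (v * wmaxE + (W - wt1E v)) + get 8 v)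
def opt0E (v W : Ex) : Ex :=
  iflt W (wt0E v) bigE (get 10 (v * wmaxE + (W - wt0E v)) + get 9 v)
-- Table `10` is stored row by row, `wmax` entries each. Only the rows `0, …, n - 1` are needed: the
-- side of vertex `v` is decided from row `v`.
def dpE : Ex :=
  ite (idx 10 / wmaxE)
    (iflt (opt1E (idx 10 / wmaxE - 1) (md (idx 10) wmaxE)) (opt0E (idx 10 / wmaxE - 1) (md (idx 10) wmaxE))
      (opt1E (idx 10 / wmaxE - 1) (md (idx 10) wmaxE)) (opt0E (idx 10 / wmaxE - 1) (md (idx 10) wmaxE)))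
    (ite (md (idx 10) wmaxE) bigE 0)
def restE : Ex :=
  ite (idx 11)
    (get 11 (idx 11 - 1) -
      iflt (opt1E (nE - idx 11) (get 11 (idx 11 - 1))) (opt0E (nE - idx 11) (get 11 (idx 11 - 1)))
        (wt1E (nE - idx 11)) (wt0E (nE - idx 11)))
    (md (get 4 0) wmaxE)
def backE : Ex :=
  iflt (opt1E (idx 12) (get 11 (nE - 1 - idx 12))) (opt0E (idx 12) (get 11 (nE - 1 - idx 12))) 1 0

/-- The value of `f` with the candidate set number `G` in table `12`. -/
def withCand (f G : Ex) : Ex :=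
  arr 4 1 G <| arr 5 kE quotE <| arr 6 nE sampE <| arr 7 nE stageE <| arr 8 nE price1E <|
    arr 9 nE price0E <| arr 10 (nE * wmaxE) dpE <| arr 11 nE restE <| arr 12 nE backE f

def costE : Ex := sum 13 nE (cE (idx 13) * get 12 (idx 13))
def cutE : Ex :=
  sum 13 nE (sum 14 nE (aE (idx 13) (idx 14) * (get 12 (idx 13) * (1 - get 12 (idx 14)))))
def scoreE : Ex := iflt costE loE bigE (iflt hiE costE bigE cutE)

/-- Whether vertex `idx 2` belongs to the output. -/
def outE : Ex :=
  arr 3 countE (iflt (withCand scoreE (idx 3)) (withCand scoreE (last 3)) (idx 3) (last 3))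
    (withCand (get 12 (idx 2)) (last 3))

def degE (v : Ex) : Ex := sum 3 nE (aE v (idx 3))
def ratioE : Ex := nE / degE (last 2) + 1
def sampleSizeE : Ex :=
  arr 2 nE (iflt (degE (idx 2)) (degE (last 2)) (idx 2) (last 2)) (32 * (ratioE * ratioE * ratioE))

theorem wf_outE : wf 3 outE = true := rfl
theorem wf_sampleSizeE : wf 2 sampleSizeE = true := rfl

/-- The tables `0` and `1` hold the size of the graph, the weights and the adjacency matrix. -/
structure EnvG (D : CutData) (E : ℕ → List ℕ) : Prop where
  n : (E 0).getD 0 0 = D.n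
  c : ∀ v < D.n, (E 1).getD v 0 = D.c v
  A : ∀ u < D.n, ∀ v < D.n, (E 1).getD (D.n + u * D.n + v) 0 = D.A u v

/-- The tables `0` and `1` hold the data of the algorithm. -/
structure EnvD (D : CutData) (E : ℕ → List ℕ) : Prop extends EnvG D E where
  lo : (E 0).getD 1 0 = D.lo
  hi : (E 0).getD 2 0 = D.hi
  k : (E 0).getD 3 0 = D.k
  count : (E 0).getD 4 0 = D.count

theorem EnvG.update {D : CutData} {E : ℕ → List ℕ} (h : EnvG D E) {d : ℕ} (hd : 2 ≤ d) (L : List ℕ) :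
    EnvG D (Function.update E d L) := by
  have h0 : Function.update E d L 0 = E 0 := Function.update_of_ne (by omega) _ _
  have h1 : Function.update E d L 1 = E 1 := Function.update_of_ne (by omega) _ _
  exact ⟨by rw [h0]; exact h.n, by rw [h1]; exact h.c, by rw [h1]; exact h.A⟩

theorem EnvD.update {D : CutData} {E : ℕ → List ℕ} (h : EnvD D E) {d : ℕ} (hd : 2 ≤ d) (L : List ℕ) :
    EnvD D (Function.update E d L) := by
  have h0 : Function.update E d L 0 = E 0 := Function.update_of_ne (by omega) _ _
  exact ⟨h.toEnvG.update hd L, by rw [h0]; exact h.lo, by rw [h0]; exact h.hi,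
    by rw [h0]; exact h.k, by rw [h0]; exact h.count⟩

/-! ### Values of the expressions, for a large cut-off. -/

section Eval

open Finset

variable {D : CutData} {B : ℕ} {E : ℕ → List ℕ}

/-- The cut-off value is large enough for the algorithm. -/
structure Large (D : CutData) (B : ℕ) : Prop where
  poly : 2 * ((D.n + 1) * (D.n + 1) * (D.n + 1) * (D.n + 1)) ≤ B
  k : D.k ≤ B

theorem Large.sq (h : Large D B) : 2 * ((D.n + 1) * (D.n + 1)) ≤ B := by
  refine le_trans ?_ h.poly
  have : 0 < (D.n + 1) * (D.n + 1) := by positivity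
  nlinarith

theorem eval_nE (hE : EnvG D E) : eval B nE E = D.n := hE.n

theorem eval_aE (hE : EnvG D E) (hB : Large D B) {u v : Ex} {a b : ℕ} (hu : eval B u E = a)
    (hv : eval B v E = b) (ha : a < D.n) (hb : b < D.n) : eval B (aE u v) E = D.A a b := by
  have h2 := hB.sq
  have h3 : a * D.n ≤ D.n * D.n := Nat.mul_le_mul_right _ ha.le
  rw [aE, eval_get, eval_add (eval_add (eval_nE hE) (eval_mul hu (eval_nE hE) (by nlinarith))
    (by nlinarith)) hv (by nlinarith)]
  exact hE.A a ha b hb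

theorem eval_cE (hE : EnvG D E) {v : Ex} {a : ℕ} (hv : eval B v E = a) (ha : a < D.n) :
    eval B (cE v) E = D.c a := by
  rw [cE, eval_get, hv]; exact hE.c a ha

theorem eval_bigE (hE : EnvG D E) (hB : Large D B) : eval B bigE E = D.big := by
  have h2 := hB.sq
  exact eval_add (eval_mul (eval_nE hE) (eval_nE hE) (by nlinarith)) (eval_lit 1) (by nlinarith)

theorem eval_wmaxE (hE : EnvG D E) (hB : Large D B) : eval B wmaxE E = D.wmax := by
  have h2 := hB.sq
  have h3 := hB.poly
  have h1 : eval B (nE + 1) E = D.n + 1 := eval_add (eval_nE hE) (eval_lit 1) (by nlinarith)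
  have : 0 < (D.n + 1) * (D.n + 1) * (D.n + 1) := by positivity
  exact eval_mul (eval_mul h1 h1 (by omega)) h1 (by nlinarith)

theorem eval_two_nE (hE : EnvG D E) (hB : Large D B) : eval B (2 * nE) E = 2 * D.n := by
  have h2 := hB.sq
  exact eval_mul (eval_lit 2) (eval_nE hE) (by nlinarith)

theorem eval_quotE (hE : EnvD D E) (hB : Large D B) {G j : ℕ} (h4 : E 4 = [G])
    (h5 : E 5 = (List.range j).map fun i => G / (2 * D.wmax) / (2 * D.n) ^ i) :
    eval B quotE E = G / (2 * D.wmax) / (2 * D.n) ^ j := by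
  have h3 := hB.poly
  have h2w : eval B (2 * wmaxE) E = 2 * D.wmax := by
    refine eval_mul (eval_lit 2) (eval_wmaxE hE.toEnvG hB) (le_trans ?_ hB.poly)
    have : 0 < (D.n + 1) * (D.n + 1) * (D.n + 1) := by positivity
    rw [CutData.wmax]; nlinarith
  rw [quotE, eval_ite, eval_idx, eval_div, eval_div, h2w, eval_two_nE hE.toEnvG hB]
  have hl : eval B (get 5 (idx 5 - 1)) E = eval B (last 5) E := rfl
  rw [hl]
  rcases Nat.eq_zero_or_pos j with rfl | hj
  · rw [if_pos (by simp [h5]), eval_get, h4, eval_lit]; simp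
  · rw [if_neg (by simp [h5]; omega), eval_last_map _ h5 hj.ne', Nat.div_div_eq_div_mul _ (_ ^ _),
      ← pow_succ, Nat.sub_add_cancel hj]

theorem eval_digitE (hE : EnvG D E) (hB : Large D B) {g i : ℕ} {e : Ex} (hg : g ≤ B)
    (h5 : E 5 = (List.range D.k).map fun i => g / (2 * D.n) ^ i) (he : eval B e E = i)
    (hi : i < D.k) : eval B (digitE e) E = D.digit g i := by
  refine eval_md ?_ (eval_two_nE hE hB) ((Nat.div_le_self _ _).trans hg)
  rw [eval_get, he, h5, getD_map_range _ hi]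

theorem sum_le_of_le_one {n : ℕ} {F : ℕ → ℕ} (h : ∀ i < n, F i ≤ 1) : ∑ i ∈ range n, F i ≤ n := by
  calc _ ≤ ∑ i ∈ range n, 1 := sum_le_sum fun i hi => h i (mem_range.1 hi)
    _ = n := by simp

theorem digit_lt (hn : 0 < D.n) (g i : ℕ) : D.digit g i < 2 * D.n := Nat.mod_lt _ (by omega)

theorem eval_sampE (hE : EnvD D E) (hD : D.Small) (hB : Large D B) {g v : ℕ} (hg : g ≤ B)
    (h5 : E 5 = (List.range D.k).map fun i => g / (2 * D.n) ^ i) (h6 : (E 6).length = v)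
    (hv : v < D.n) : eval B sampE E = D.samp g v := by
  have hn : 0 < D.n := by omega
  have key : ∀ L : List ℕ, L.length < D.k →
      eval B (digitE (idx 7)) (Function.update E 7 L) = D.digit g L.length ∧
      eval B (idx 6) (Function.update E 7 L) = v := by
    intro L hL
    refine ⟨eval_digitE (hE.update (by omega) L).toEnvG hB hg (by simpa using h5)
      (by simp [eval_idx]) hL, by simpa [eval_idx] using h6⟩
  have hk : eval B kE E = D.k := hE.k
  have hneg := eval_sum (B := B) (d := 7) (m := kE) (E := E) (M := D.k)
    (f := iflt (digitE (idx 7)) nE 0 (aE (idx 6) (digitE (idx 7) - nE)))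
    (fun i => if D.digit g i < D.n then 0 else D.A v (D.digit g i - D.n)) hk
    (by
      rintro j hj L rfl
      obtain ⟨h1, h2⟩ := key L hj
      have hE' := (hE.update (show 2 ≤ 7 by omega) L).toEnvG
      rw [eval_iflt, h1, eval_nE hE']
      split_ifs with h
      · rfl
      · have := digit_lt hn g L.length
        exact eval_aE hE' hB h2 (by rw [eval_sub, h1, eval_nE hE']) hv (by omega))
    (le_trans (sum_le_of_le_one fun i _ => by
      have := digit_lt hn g i
      split_ifs
      · omega
      · exact hD.A_le _ hv _ (by omega)) hB.k)
  have hpos := eval_sum (B := B) (d := 7) (m := kE) (E := E) (M := D.k)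
    (f := iflt (digitE (idx 7)) nE (aE (idx 6) (digitE (idx 7))) 0)
    (fun i => if D.digit g i < D.n then D.A v (D.digit g i) else 0) hk
    (by
      rintro j hj L rfl
      obtain ⟨h1, h2⟩ := key L hj
      have hE' := (hE.update (show 2 ≤ 7 by omega) L).toEnvG
      rw [eval_iflt, h1, eval_nE hE']
      split_ifs with h
      · exact eval_aE hE' hB h2 h1 hv h
      · rfl)
    (le_trans (sum_le_of_le_one fun i _ => by
      split_ifs with h
      · exact hD.A_le _ hv _ h
      · omega) hB.k)
  rw [sampE, eval_iflt, hneg, hpos]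
  rfl

theorem price_le (hD : D.Small) {t : ℕ → ℕ} (ht : ∀ v, t v ≤ 1) {v : ℕ} (hv : v < D.n) (x : ℕ) :
    D.price t v x ≤ D.n := by
  rw [CutData.price]
  split_ifs
  · exact sum_le_of_le_one fun i hi => by
      have := Nat.mul_le_mul (hD.A_le v hv i hi) (ht i); omega
  · exact sum_le_of_le_one fun i hi => by
      have := Nat.mul_le_mul (hD.A_le v hv i hi) (Nat.sub_le 1 (t i)); omega

/-- The sum that computes the price of the vertex `idx (d - 1)` on side `0`. -/
theorem eval_sum_price0 (hE : EnvG D E) (hD : D.Small) (hB : Large D B) {t : ℕ → ℕ}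
    (ht : ∀ v, t v ≤ 1) {d l v : ℕ} {e : Ex} (hd : 2 ≤ d) (hl : l ≠ d)
    (he : ∀ L, eval B e (Function.update E d L) = v) (hv : v < D.n)
    (hl' : E l = (List.range D.n).map t) :
    eval B (sum d nE (aE e (idx d) * get l (idx d))) E = D.price t v 0 := by
  have h2 := hB.sq
  refine eval_sum (fun u => D.A v u * t u) (eval_nE hE) ?_ ((price_le hD ht hv 0).trans (by nlinarith))
  rintro j hj L rfl
  refine eval_mul (eval_aE (hE.update hd L) hB (he L) (by simp [eval_idx]) hv hj) ?_ ?_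
  · rw [eval_get, Function.update_of_ne hl, hl', eval_idx, Function.update_self, getD_map_range _ hj]
  · have := Nat.mul_le_mul (hD.A_le v hv _ hj) (ht L.length)
    nlinarith

theorem eval_sum_price1 (hE : EnvG D E) (hD : D.Small) (hB : Large D B) {t : ℕ → ℕ}
    (ht : ∀ v, t v ≤ 1) {d l v : ℕ} {e : Ex} (hd : 2 ≤ d) (hl : l ≠ d)
    (he : ∀ L, eval B e (Function.update E d L) = v) (hv : v < D.n)
    (hl' : E l = (List.range D.n).map t) :
    eval B (sum d nE (aE e (idx d) * (1 - get l (idx d)))) E = D.price t v 1 := by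
  have h2 := hB.sq
  refine eval_sum (fun u => D.A v u * (1 - t u)) (eval_nE hE) ?_
    ((price_le hD ht hv 1).trans (by nlinarith))
  rintro j hj L rfl
  refine eval_mul (eval_aE (hE.update hd L) hB (he L) (by simp [eval_idx]) hv hj) ?_ ?_
  · rw [eval_sub, eval_get, Function.update_of_ne hl, hl', eval_idx, Function.update_self,
      getD_map_range _ hj]; rfl
  · have := Nat.mul_le_mul (hD.A_le v hv _ hj) (Nat.sub_le 1 (t L.length))
    nlinarith

theorem samp_le (g v : ℕ) : D.samp g v ≤ 1 := by rw [CutData.samp]; split_ifs <;> omega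

theorem maj_le (t : ℕ → ℕ) (v : ℕ) : D.maj t v ≤ 1 := by rw [CutData.maj]; split_ifs <;> omega

theorem stage_le (g h v : ℕ) : D.stage g h v ≤ 1 := by
  rw [CutData.stage]; split_ifs
  · exact samp_le g v
  · exact maj_le _ v

theorem eval_stageE (hE : EnvD D E) (hD : D.Small) (hB : Large D B) {G g v : ℕ} (hG : G ≤ B)
    (h4 : E 4 = [G]) (h6 : E 6 = (List.range D.n).map (D.samp g)) (h7 : (E 7).length = v)
    (hv : v < D.n) : eval B stageE E = D.stage g (G / D.wmax % 2) v := by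
  have hG : eval B (md (get 4 0 / wmaxE) 2) E = G / D.wmax % 2 := by
    refine eval_md ?_ (eval_lit 2) ((Nat.div_le_self _ _).trans hG)
    rw [eval_div, eval_wmaxE hE.toEnvG hB, eval_get, h4]; rfl
  have h7' : ∀ L, eval B (idx 7) (Function.update E 8 L) = v := by intro L; simpa [eval_idx] using h7
  rw [stageE, eval_ite, hG, eval_iflt,
    eval_sum_price1 hE.toEnvG hD hB (samp_le g) (by omega) (by omega) h7' hv h6,
    eval_sum_price0 hE.toEnvG hD hB (samp_le g) (by omega) (by omega) h7' hv h6]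
  rw [CutData.stage]
  split_ifs with h
  · rw [eval_get, h6, eval_idx, h7, getD_map_range _ hv]
  · rw [CutData.maj, if_pos ‹_›]; rfl
  · rw [CutData.maj, if_neg ‹_›]; rfl

/-- Table `7` holds a reference set, and tables `8` and `9` the prices. -/
structure EnvT (D : CutData) (t : ℕ → ℕ) (E : ℕ → List ℕ) : Prop extends EnvD D E where
  le_one : ∀ v, t v ≤ 1
  set : E 7 = (List.range D.n).map t
  price1 : E 8 = (List.range D.n).map fun v => D.price t v 1
  price0 : E 9 = (List.range D.n).map fun v => D.price t v 0

theorem EnvT.update {t : ℕ → ℕ} (h : EnvT D t E) {d : ℕ} (hd : 10 ≤ d) (L : List ℕ) :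
    EnvT D t (Function.update E d L) := by
  refine ⟨h.toEnvD.update (by omega) L, h.le_one, ?_, ?_, ?_⟩
  · rw [Function.update_of_ne (by omega)]; exact h.set
  · rw [Function.update_of_ne (by omega)]; exact h.price1
  · rw [Function.update_of_ne (by omega)]; exact h.price0

variable {t : ℕ → ℕ}

theorem eval_wt1E (hE : EnvT D t E) (hD : D.Small) (hB : Large D B) {e : Ex} {v : ℕ}
    (he : eval B e E = v) (hv : v < D.n) : eval B (wt1E e) E = D.wt t v 1 := by
  have h2 := hB.sq
  have hc := hD.c_le v hv
  have h3 : D.c v * (D.n + 1) ≤ D.n * (D.n + 1) := Nat.mul_le_mul_right _ hc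
  refine eval_add (eval_mul (eval_cE hE.toEnvG he hv) (eval_add (eval_nE hE.toEnvG) (eval_lit 1)
    (by nlinarith)) (by nlinarith)) (b := 1 - t v) ?_ (by have := Nat.sub_le 1 (t v); nlinarith)
  rw [eval_sub, eval_get, hE.set, he, getD_map_range _ hv]; rfl

theorem eval_wt0E (hE : EnvT D t E) {e : Ex} {v : ℕ}
    (he : eval B e E = v) (hv : v < D.n) : eval B (wt0E e) E = D.wt t v 0 := by
  rw [wt0E, eval_get, hE.set, he, getD_map_range _ hv]; rfl

theorem index_lt {v W : ℕ} (hv : v < D.n) (hW : W < D.wmax) : v * D.wmax + W < D.n * D.wmax := by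
  calc v * D.wmax + W < (v + 1) * D.wmax := by linarith
    _ ≤ D.n * D.wmax := Nat.mul_le_mul_right _ hv

theorem Large.table (h : Large D B) : D.n * D.wmax ≤ B := by
  refine le_trans ?_ h.poly
  have : 0 < (D.n + 1) * (D.n + 1) * (D.n + 1) := by positivity
  rw [CutData.wmax]; nlinarith

/-- The entries of row `v` of the table of least prices are present. -/
def Row (D : CutData) (B : ℕ) (t : ℕ → ℕ) (v : ℕ) (E : ℕ → List ℕ) : Prop :=
  ∀ W < D.wmax, (E 10).getD (v * D.wmax + W) 0 = D.dp B t v W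

theorem eval_opt1E (hE : EnvT D t E) (hD : D.Small) (hB : Large D B) {e w : Ex} {v W : ℕ}
    (he : eval B e E = v) (hw : eval B w E = W) (hv : v < D.n) (hW : W < D.wmax)
    (hr : Row D B t v E) : eval B (opt1E e w) E = D.opt B t (D.dp B t v) v W 1 := by
  have h1 := index_lt hv hW
  have h2 := hB.table
  rw [opt1E, eval_iflt, hw, eval_wt1E hE hD hB he hv, eval_bigE hE.toEnvG hB, CutData.opt, eval_add',
    eval_get, eval_add (eval_mul he (eval_wmaxE hE.toEnvG hB) (by omega))
      (by rw [eval_sub, hw, eval_wt1E hE hD hB he hv]) (by omega), hr _ (by omega), eval_get,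
    hE.price1, he, getD_map_range _ hv]

theorem eval_opt0E (hE : EnvT D t E) (hB : Large D B) {e w : Ex} {v W : ℕ}
    (he : eval B e E = v) (hw : eval B w E = W) (hv : v < D.n) (hW : W < D.wmax)
    (hr : Row D B t v E) : eval B (opt0E e w) E = D.opt B t (D.dp B t v) v W 0 := by
  have h1 := index_lt hv hW
  have h2 := hB.table
  rw [opt0E, eval_iflt, hw, eval_wt0E hE he hv, eval_bigE hE.toEnvG hB, CutData.opt, eval_add',
    eval_get, eval_add (eval_mul he (eval_wmaxE hE.toEnvG hB) (by omega))
      (by rw [eval_sub, hw, eval_wt0E hE he hv]) (by omega), hr _ (by omega), eval_get,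
    hE.price0, he, getD_map_range _ hv]

theorem wmax_pos : 0 < D.wmax := by rw [CutData.wmax]; positivity

theorem eval_dpE (hE : EnvT D t E) (hD : D.Small) (hB : Large D B) {j : ℕ} (hj : j < D.n * D.wmax)
    (h10 : E 10 = (List.range j).map fun j => D.dp B t (j / D.wmax) (j % D.wmax)) :
    eval B dpE E = D.dp B t (j / D.wmax) (j % D.wmax) := by
  have hw := eval_wmaxE hE.toEnvG hB
  have hpos := wmax_pos (D := D)
  have hi : eval B (idx 10) E = j := by rw [eval_idx, h10]; simp
  have hq : eval B (idx 10 / wmaxE) E = j / D.wmax := by rw [eval_div, hi, hw]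
  have hm : eval B (md (idx 10) wmaxE) E = j % D.wmax := eval_md hi hw (by have := hB.table; omega)
  have hlt : j / D.wmax < D.n := Nat.div_lt_of_lt_mul (by rwa [mul_comm])
  rw [dpE, eval_ite, hq]
  split_ifs with h
  · rw [eval_ite, hm, eval_bigE hE.toEnvG hB, h]; rfl
  · obtain ⟨i, hi⟩ := Nat.exists_eq_succ_of_ne_zero h
    have hq' : eval B (idx 10 / wmaxE - 1) E = i := by rw [eval_sub, hq, hi]; rfl
    have hmod := Nat.mod_lt j hpos
    -- Row `i` is complete by the time an entry of row `i + 1` is computed.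
    have hrow : Row D B t i E := by
      intro W hW
      have h1 : j = D.wmax * (j / D.wmax) + j % D.wmax := (Nat.div_add_mod _ _).symm
      have h2 : D.wmax * (i + 1) = i * D.wmax + D.wmax := by ring
      rw [hi, Nat.succ_eq_add_one, h2] at h1
      rw [h10, getD_map_range _ (by omega), add_comm, Nat.add_mul_div_right _ _ hpos,
        Nat.div_eq_of_lt hW, Nat.add_mul_mod_self_right, Nat.mod_eq_of_lt hW, zero_add]
    rw [eval_iflt, eval_opt1E hE hD hB hq' hm (by omega) hmod hrow,
      eval_opt0E hE hB hq' hm (by omega) hmod hrow, hi]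
    rw [CutData.dp, CutData.side]
    split_ifs <;> rfl

/-- In addition, table `10` holds the least prices. -/
structure EnvP (D : CutData) (B : ℕ) (t : ℕ → ℕ) (E : ℕ → List ℕ) : Prop extends EnvT D t E where
  row : ∀ v < D.n, Row D B t v E

theorem EnvP.update (h : EnvP D B t E) {d : ℕ} (hd : 11 ≤ d) (L : List ℕ) :
    EnvP D B t (Function.update E d L) := by
  refine ⟨h.toEnvT.update (by omega) L, fun v hv W hW => ?_⟩
  rw [Function.update_of_ne (by omega)]; exact h.row v hv W hW

theorem rest_le (W i : ℕ) : D.rest B t W i ≤ W := by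
  induction i with
  | zero => rfl
  | succ i ih => exact (Nat.sub_le _ _).trans ih

theorem eval_restE (hE : EnvP D B t E) (hD : D.Small) (hB : Large D B) {G j : ℕ} (hG : G ≤ B)
    (h4 : E 4 = [G]) (hj : j < D.n)
    (h11 : E 11 = (List.range j).map (D.rest B t (G % D.wmax))) :
    eval B restE E = D.rest B t (G % D.wmax) j := by
  have hi : eval B (idx 11) E = j := by rw [eval_idx, h11]; simp
  have hmod := Nat.mod_lt G (wmax_pos (D := D))
  rw [restE, eval_ite, hi]
  split_ifs with h
  · rw [h]
    exact eval_md (by rw [eval_get, h4]; rfl) (eval_wmaxE hE.toEnvG hB) hG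
  · obtain ⟨i, rfl⟩ := Nat.exists_eq_succ_of_ne_zero h
    have hW : eval B (get 11 (idx 11 - 1)) E = D.rest B t (G % D.wmax) i :=
      eval_last_map _ h11 (by omega)
    have hv : eval B (nE - idx 11) E = D.n - (i + 1) := by rw [eval_sub, hi, eval_nE hE.toEnvG]
    have hlt : D.n - (i + 1) < D.n := by omega
    have hle := (rest_le (D := D) (B := B) (t := t) (G % D.wmax) i).trans_lt hmod
    rw [eval_sub, hW, eval_iflt, eval_opt1E hE.toEnvT hD hB hv hW hlt hle (hE.row _ hlt),
      eval_opt0E hE.toEnvT hB hv hW hlt hle (hE.row _ hlt), eval_wt1E hE.toEnvT hD hB hv hlt,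
      eval_wt0E hE.toEnvT hv hlt, Nat.succ_eq_add_one, CutData.rest, CutData.side]
    split_ifs <;> rfl

theorem eval_backE (hE : EnvP D B t E) (hD : D.Small) (hB : Large D B) {W v : ℕ} (hW : W < D.wmax)
    (h11 : E 11 = (List.range D.n).map (D.rest B t W)) (h12 : (E 12).length = v) (hv : v < D.n) :
    eval B backE E = D.back B t W v := by
  have hi : eval B (idx 12) E = v := by rw [eval_idx, h12]
  have hw : eval B (get 11 (nE - 1 - idx 12)) E = D.rest B t W (D.n - 1 - v) := by
    rw [eval_get, h11, eval_sub, eval_sub, hi, eval_nE hE.toEnvG, eval_lit,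
      getD_map_range _ (by omega)]
  have hle := (rest_le (D := D) (B := B) (t := t) W (D.n - 1 - v)).trans_lt hW
  rw [backE, eval_iflt, eval_opt1E hE.toEnvT hD hB hi hw hv hle (hE.row _ hv),
      eval_opt0E hE.toEnvT hB hi hw hv hle (hE.row _ hv)]
  rfl

/-- Table `12` holds the set `x`. -/
structure EnvX (D : CutData) (x : ℕ → ℕ) (E : ℕ → List ℕ) : Prop extends EnvD D E where
  set : E 12 = (List.range D.n).map x

/-- The index `e` is evaluated with table `4` empty, since table `4` is the one being created to
hold it. Table `2` is unchanged because its length names the vertex whose membership is being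
computed. -/
theorem eval_withCand (hE : EnvD D E) (hD : D.Small) (hB : Large D B) {G : ℕ} {f e : Ex} (hG : G ≤ B)
    (he : eval B e (Function.update E 4 []) = G) :
    ∃ E', EnvX D (D.cand B G) E' ∧ E' 2 = E 2 ∧ eval B (withCand f e) E = eval B f E' := by
  have hg : G / (2 * D.wmax) ≤ B := (Nat.div_le_self _ _).trans hG
  set g := G / (2 * D.wmax) with hgdef
  set t := D.stage g (G / D.wmax % 2) with ht
  have hn : ∀ {E}, EnvD D E → eval B nE E = D.n := fun h => eval_nE h.toEnvG
  rw [withCand, eval_arr (M := 1) (fun _ => G) (eval_lit 1) (by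
    intro j hj; obtain rfl : j = 0 := by omega
    exact he)]
  have hE4 := hE.update (show 2 ≤ 4 by omega) ((List.range 1).map fun _ => G)
  have h44 : Function.update E 4 ((List.range 1).map fun _ => G) 4 = [G] := by simp
  have h42 : Function.update E 4 ((List.range 1).map fun _ => G) 2 = E 2 := by simp
  generalize Function.update E 4 ((List.range 1).map fun _ => G) = E4 at *
  rw [eval_arr (fun i => g / (2 * D.n) ^ i) (show eval B kE E4 = D.k from hE4.k) (by
    intro j hj
    exact eval_quotE (hE4.update (by omega) _) hB (by simpa using h44) (by simp [hgdef]))]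
  have hE5 := hE4.update (show 2 ≤ 5 by omega) ((List.range D.k).map fun i => g / (2 * D.n) ^ i)
  set E5 := Function.update E4 5 ((List.range D.k).map fun i => g / (2 * D.n) ^ i) with hE5'
  have h55 : E5 5 = (List.range D.k).map fun i => g / (2 * D.n) ^ i := by simp [hE5']
  have h54 : E5 4 = [G] := by simpa [hE5'] using h44
  have h52 : E5 2 = E 2 := by simpa [hE5'] using h42
  clear_value E5
  rw [eval_arr (D.samp g) (hn hE5) (by
    intro j hj
    exact eval_sampE (hE5.update (by omega) _) hD hB hg (by simpa using h55) (by simp) hj)]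
  have hE6 := hE5.update (show 2 ≤ 6 by omega) ((List.range D.n).map (D.samp g))
  set E6 := Function.update E5 6 ((List.range D.n).map (D.samp g)) with hE6'
  have h66 : E6 6 = (List.range D.n).map (D.samp g) := by simp [hE6']
  have h64 : E6 4 = [G] := by simpa [hE6'] using h54
  have h62 : E6 2 = E 2 := by simpa [hE6'] using h52
  clear_value E6
  rw [eval_arr t (hn hE6) (by
    intro j hj
    exact eval_stageE (hE6.update (by omega) _) hD hB hG (by simpa using h64) (by simpa using h66)
      (by simp) hj)]
  have hE7 := hE6.update (show 2 ≤ 7 by omega) ((List.range D.n).map t)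
  set E7 := Function.update E6 7 ((List.range D.n).map t) with hE7'
  have h77 : E7 7 = (List.range D.n).map t := by simp [hE7']
  have h74 : E7 4 = [G] := by simpa [hE7'] using h64
  have h72 : E7 2 = E 2 := by simpa [hE7'] using h62
  clear_value E7
  have ht1 : ∀ v, t v ≤ 1 := fun v => stage_le _ _ _
  rw [eval_arr (fun v => D.price t v 1) (hn hE7) (by
    intro j hj
    exact eval_sum_price1 (hE7.update (by omega) _).toEnvG hD hB ht1 (by omega) (by omega)
      (fun L => by simp [eval_idx]) hj (by simpa using h77))]
  have hE8 := hE7.update (show 2 ≤ 8 by omega) ((List.range D.n).map fun v => D.price t v 1)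
  set E8 := Function.update E7 8 ((List.range D.n).map fun v => D.price t v 1) with hE8'
  have h88 : E8 8 = (List.range D.n).map fun v => D.price t v 1 := by simp [hE8']
  have h87 : E8 7 = (List.range D.n).map t := by simpa [hE8'] using h77
  have h84 : E8 4 = [G] := by simpa [hE8'] using h74
  have h82 : E8 2 = E 2 := by simpa [hE8'] using h72
  clear_value E8
  rw [eval_arr (fun v => D.price t v 0) (hn hE8) (by
    intro j hj
    exact eval_sum_price0 (hE8.update (by omega) _).toEnvG hD hB ht1 (by omega) (by omega)
      (fun L => by simp [eval_idx]) hj (by simpa using h87))]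
  have hE9 : EnvT D t (Function.update E8 9 ((List.range D.n).map fun v => D.price t v 0)) :=
    ⟨hE8.update (by omega) _, ht1, by simpa using h87, by simpa using h88, by simp⟩
  set E9 := Function.update E8 9 ((List.range D.n).map fun v => D.price t v 0) with hE9'
  have h94 : E9 4 = [G] := by simpa [hE9'] using h84
  have h92 : E9 2 = E 2 := by simpa [hE9'] using h82
  clear_value E9
  have htab : eval B (nE * wmaxE) E9 = D.n * D.wmax :=
    eval_mul (hn hE9.toEnvD) (eval_wmaxE hE9.toEnvG hB) hB.table
  rw [eval_arr (fun j => D.dp B t (j / D.wmax) (j % D.wmax)) htab (by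
    intro j hj
    exact eval_dpE (hE9.update (by omega) _) hD hB hj (by simp))]
  have hpos := wmax_pos (D := D)
  have hE10 : EnvP D B t (Function.update E9 10
      ((List.range (D.n * D.wmax)).map fun j => D.dp B t (j / D.wmax) (j % D.wmax))) := by
    refine ⟨hE9.update le_rfl _, fun v hv W hW => ?_⟩
    rw [Function.update_self, getD_map_range _ (index_lt hv hW), add_comm,
      Nat.add_mul_div_right _ _ hpos, Nat.div_eq_of_lt hW, Nat.add_mul_mod_self_right,
      Nat.mod_eq_of_lt hW, zero_add]
  set E10 := Function.update E9 10
      ((List.range (D.n * D.wmax)).map fun j => D.dp B t (j / D.wmax) (j % D.wmax)) with hE10'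
  have h104 : E10 4 = [G] := by simpa [hE10'] using h94
  have h102 : E10 2 = E 2 := by simpa [hE10'] using h92
  clear_value E10
  rw [eval_arr (D.rest B t (G % D.wmax)) (hn hE10.toEnvD) (by
    intro j hj
    exact eval_restE (hE10.update (by omega) _) hD hB hG (by simpa using h104) hj (by simp))]
  have hE11 := hE10.update (show 11 ≤ 11 by omega) ((List.range D.n).map (D.rest B t (G % D.wmax)))
  set E11 := Function.update E10 11 ((List.range D.n).map (D.rest B t (G % D.wmax))) with hE11'
  have h1111 : E11 11 = (List.range D.n).map (D.rest B t (G % D.wmax)) := by simp [hE11']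
  have h112 : E11 2 = E 2 := by simpa [hE11'] using h102
  clear_value E11
  rw [eval_arr (D.cand B G) (hn hE11.toEnvD) (by
    intro j hj
    exact eval_backE (hE11.update (by omega) _) hD hB (Nat.mod_lt _ hpos) (by simpa using h1111)
      (by simp) hj)]
  exact ⟨_, ⟨hE11.toEnvD.update (by omega) _, by simp⟩, by simpa using h112, rfl⟩

theorem cost_le_of_small (hD : D.Small) {x : ℕ → ℕ} (hx : ∀ v, x v ≤ 1) : D.cost x ≤ D.n * D.n := by
  calc D.cost x ≤ ∑ _v ∈ range D.n, D.n := sum_le_sum fun v hv => by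
        have := Nat.mul_le_mul (hD.c_le v (mem_range.1 hv)) (hx v); omega
    _ = _ := by simp

theorem cut_term_le (hD : D.Small) {x : ℕ → ℕ} (hx : ∀ v, x v ≤ 1) {u v : ℕ} (hu : u < D.n)
    (hv : v < D.n) : D.A u v * (x u * (1 - x v)) ≤ 1 := by
  have := Nat.mul_le_mul (hD.A_le u hu v hv) (Nat.mul_le_mul (hx u) (Nat.sub_le 1 (x v)))
  omega

theorem cut_le (hD : D.Small) {x : ℕ → ℕ} (hx : ∀ v, x v ≤ 1) : D.cut x ≤ D.n * D.n := by
  calc D.cut x ≤ ∑ _u ∈ range D.n, D.n := sum_le_sum fun u hu =>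
        sum_le_of_le_one fun v hv => cut_term_le hD hx (mem_range.1 hu) hv
    _ = _ := by simp

theorem eval_scoreE {x : ℕ → ℕ} (hE : EnvX D x E) (hD : D.Small) (hB : Large D B)
    (hx : ∀ v, x v ≤ 1) : eval B scoreE E = D.score x := by
  have h2 := hB.sq
  have hget : ∀ {E'} {e : Ex} {v : ℕ}, E' 12 = E 12 → eval B e E' = v → v < D.n →
      eval B (get 12 e) E' = x v := by
    intro E' e v h he hv
    rw [eval_get, h, hE.set, he, getD_map_range _ hv]
  have hcost : eval B costE E = D.cost x := by
    refine eval_sum (fun v => D.c v * x v) (eval_nE hE.toEnvG) ?_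
      ((cost_le_of_small hD hx).trans (by nlinarith))
    rintro j hj L rfl
    refine eval_mul (eval_cE (hE.toEnvG.update (by omega) L) (by simp [eval_idx]) hj)
      (hget (by simp) (by simp [eval_idx]) hj) ?_
    have := Nat.mul_le_mul (hD.c_le _ hj) (hx L.length); nlinarith
  have hcut : eval B cutE E = D.cut x := by
    refine eval_sum (fun u => ∑ v ∈ range D.n, D.A u v * (x u * (1 - x v))) (eval_nE hE.toEnvG) ?_
      ((cut_le hD hx).trans (by nlinarith))
    rintro j hj L rfl
    have hE' := hE.toEnvG.update (show 2 ≤ 13 by omega) L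
    refine eval_sum (fun v => D.A L.length v * (x L.length * (1 - x v))) (eval_nE hE') ?_
      ((sum_le_of_le_one fun v hv => cut_term_le hD hx hj hv).trans (by nlinarith))
    rintro i hi L' rfl
    refine eval_mul (eval_aE (hE'.update (by omega) L') hB (by simp [eval_idx]) (by simp [eval_idx])
      hj hi) (eval_mul (hget (by simp) (by simp [eval_idx]) hj)
        (b := 1 - x L'.length) ?_ ?_) ((cut_term_le hD hx hj hi).trans (by nlinarith))
    · rw [eval_sub, hget (by simp) (v := L'.length) (by simp [eval_idx]) hi]; rfl
    · have := Nat.mul_le_mul (hx L.length) (Nat.sub_le 1 (x L'.length)); nlinarith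
  have hlo : eval B loE E = D.lo := hE.lo
  have hhi : eval B hiE E = D.hi := hE.hi
  rw [scoreE, eval_iflt, eval_iflt, hcost, hcut, hlo, hhi, eval_bigE hE.toEnvG hB]
  rfl

theorem cand_le (G v : ℕ) : D.cand B G v ≤ 1 := by
  rw [CutData.cand, CutData.back, CutData.side]; split_ifs <;> omega

/-- Table `2` is the output under construction, so its length is the current vertex; the search for
the best candidate is repeated for every vertex. -/
theorem eval_outE (hE : EnvD D E) (hD : D.Small) (hB : Large D B) (hcount : 0 < D.count)
    (hN : D.count ≤ B) {v : ℕ} (h2 : (E 2).length = v) (hv : v < D.n) :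
    eval B outE E = D.out B v := by
  rw [outE, eval_argFold (s := withCand scoreE) (fun G => D.score (D.cand B G)) 
    (show eval B countE E = D.count from hE.count)]
  · set L := (List.range D.count).map (argFold fun G => D.score (D.cand B G)) with hL
    have hl : eval B (last 3) (Function.update E 3 L) =
        argFold (fun G => D.score (D.cand B G)) (D.count - 1) :=
      eval_last_map _ (Function.update_self ..) hcount.ne'
    obtain ⟨E', hE', hE2, he⟩ := eval_withCand (f := get 12 (idx 2)) (e := last 3)
      (hE.update (show 2 ≤ 3 by omega) L) hD hB
      (show argFold (fun G => D.score (D.cand B G)) (D.count - 1) ≤ B from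
        (argFold_le _ _).trans (by omega)) (by
        rw [← hl, last, eval_get, eval_get, eval_sub, eval_sub, eval_idx, eval_idx]; rfl)
    rw [he, eval_get, hE'.set, eval_idx, hE2, Function.update_of_ne (by omega), h2,
      getD_map_range _ hv]
    rfl
  · intro L e hecase hlt
    -- The index only reads table `3`, so emptying table `4` does not affect it.
    have hcongr : eval B e (Function.update (Function.update E 3 L) 4 []) =
        eval B e (Function.update E 3 L) := by
      rcases hecase with rfl | rfl
      · rw [eval_idx, eval_idx]; rfl
      · rw [last, eval_get, eval_get, eval_sub, eval_sub, eval_idx, eval_idx]; rfl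
    obtain ⟨E', hE', hE2, he⟩ := eval_withCand (f := scoreE) (e := e)
      (hE.update (show 2 ≤ 3 by omega) L) hD hB (hlt.le.trans hN) hcongr
    rw [he, eval_scoreE hE' hD hB (cand_le _)]

theorem deg_le (hD : D.Small) {v : ℕ} (hv : v < D.n) : D.deg v ≤ D.n :=
  sum_le_of_le_one fun u hu => hD.A_le v hv u hu

theorem eval_sampleSizeE (hE : EnvG D E) (hD : D.Small) (hn : 0 < D.n)
    (hB : Large D B) (hB' : 32 * ((D.n + 1) * (D.n + 1) * (D.n + 1)) ≤ B) :
    eval B sampleSizeE E = D.sampleSize := by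
  have hsq := hB.sq
  have hdeg : ∀ (L : List ℕ) (e : Ex), e = idx 2 ∨ e = last 2 →
      eval B e (Function.update E 2 L) < D.n →
      eval B (degE e) (Function.update E 2 L) = D.deg (eval B e (Function.update E 2 L)) := by
    intro L e hecase hlt
    have hE' := hE.update (show 2 ≤ 2 by omega) L
    refine eval_sum (fun u => D.A _ u) (eval_nE hE') ?_ ((deg_le hD hlt).trans (by nlinarith))
    rintro j hj L' rfl
    refine eval_aE (hE'.update (by omega) L') hB ?_ (by simp [eval_idx]) hlt hj
    rcases hecase with rfl | rfl
    · rw [eval_idx, eval_idx]; rfl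
    · rw [last, eval_get, eval_get, eval_sub, eval_sub, eval_idx, eval_idx]; rfl
  rw [sampleSizeE, eval_argFold (s := degE) D.deg (eval_nE hE) hdeg]
  set L := (List.range D.n).map (argFold D.deg) with hL
  have hl : eval B (last 2) (Function.update E 2 L) = argFold D.deg (D.n - 1) :=
    eval_last_map _ (Function.update_self ..) hn.ne'
  have hlt : argFold D.deg (D.n - 1) < D.n := (argFold_le _ _).trans_lt (by omega)
  have hd := hdeg L _ (Or.inr rfl) (by rw [hl]; exact hlt)
  rw [hl] at hd
  have hle := Nat.div_le_self D.n (D.deg (argFold D.deg (D.n - 1)))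
  set r := D.n / D.deg (argFold D.deg (D.n - 1)) with hr
  have hratio : eval B ratioE (Function.update E 2 L) = r + 1 := by
    refine eval_add ?_ (eval_lit 1) (by nlinarith)
    rw [eval_div, hd, eval_nE (hE.update (by omega) L)]
  have h1 : (r + 1) * (r + 1) ≤ (D.n + 1) * (D.n + 1) := Nat.mul_le_mul (by omega) (by omega)
  have h3 : (r + 1) * (r + 1) * (r + 1) ≤ (D.n + 1) * (D.n + 1) * (D.n + 1) :=
    Nat.mul_le_mul h1 (by omega)
  change _ = 32 * ((r + 1) * (r + 1) * (r + 1))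
  exact eval_mul (eval_lit 32) (eval_mul (eval_mul hratio hratio (by omega)) hratio (by omega))
    (by omega)

end Eval

end Ex

/-! ### Correctness of the algorithm -/

namespace CutData

open Finset

variable {D : CutData}

/-- The number of vertices where two sets differ. -/
def dist (D : CutData) (x t : ℕ → ℕ) : ℕ := ∑ v ∈ range D.n, if x v = t v then 0 else 1

/-- The total price of a set. -/
def lin (D : CutData) (t x : ℕ → ℕ) : ℕ := ∑ v ∈ range D.n, D.price t v (x v)

/-- The adjacency matrix is symmetric. -/
def Symm (D : CutData) : Prop := ∀ u < D.n, ∀ v < D.n, D.A u v = D.A v u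

theorem dist_le (x t : ℕ → ℕ) : D.dist x t ≤ D.n :=
  Ex.sum_le_of_le_one fun i _ => by split_ifs <;> omega

/-- For bits, `a + t u - 2 * a * t u` is `1` exactly when `a ≠ t u`; the polynomial form makes the
cut identities ring identities. -/
theorem price_cast {t : ℕ → ℕ} (ht : ∀ v, t v ≤ 1) (v : ℕ) {a : ℕ} (ha : a ≤ 1) :
    (D.price t v a : ℤ) = ∑ u ∈ range D.n, (D.A v u : ℤ) * (a + t u - 2 * a * t u) := by
  have h : a = 0 ∨ a = 1 := by omega
  rcases h with rfl | rfl
  · simp [price]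
  · rw [price, if_neg (by omega)]
    push_cast
    refine sum_congr rfl fun u _ => ?_
    rw [Nat.cast_sub (ht u)]
    push_cast; ring

theorem lin_cast {t x : ℕ → ℕ} (ht : ∀ v, t v ≤ 1) (hx : ∀ v, x v ≤ 1) :
    (D.lin t x : ℤ) = ∑ v ∈ range D.n, ∑ u ∈ range D.n,
      (D.A v u : ℤ) * (x v + t u - 2 * x v * t u) := by
  rw [lin]; push_cast
  exact sum_congr rfl fun v _ => price_cast ht v (hx v)

theorem sum_swap (hs : D.Symm) (F : ℕ → ℕ → ℤ) :
    ∑ v ∈ range D.n, ∑ u ∈ range D.n, (D.A v u : ℤ) * F v u =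
      ∑ v ∈ range D.n, ∑ u ∈ range D.n, (D.A v u : ℤ) * F u v := by
  rw [sum_comm]
  refine sum_congr rfl fun v hv => sum_congr rfl fun u hu => ?_
  rw [hs u (mem_range.1 hu) v (mem_range.1 hv)]

theorem cut_cast {x : ℕ → ℕ} (hx : ∀ v, x v ≤ 1) :
    (D.cut x : ℤ) = ∑ v ∈ range D.n, ∑ u ∈ range D.n, (D.A v u : ℤ) * (x v * (1 - x u)) := by
  rw [cut]; push_cast
  refine sum_congr rfl fun v _ => sum_congr rfl fun u _ => ?_
  rw [Nat.cast_sub (hx u)]; push_cast; ring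

/-- Pricing a set against itself counts every cut edge from both ends. -/
theorem two_mul_cut_cast (hs : D.Symm) {x : ℕ → ℕ} (hx : ∀ v, x v ≤ 1) :
    2 * (D.cut x : ℤ) = D.lin x x := by
  rw [lin_cast hx hx, two_mul]
  nth_rewrite 2 [cut_cast hx]
  rw [sum_swap hs fun v u => (x v * (1 - x u) : ℤ), cut_cast hx, ← sum_add_distrib]
  refine sum_congr rfl fun v _ => ?_
  rw [← sum_add_distrib]
  exact sum_congr rfl fun u _ => by ring

/-- The cut sizes of two sets add up to the total price, up to the square of their distance. -/
theorem abs_lin_sub_le (hD : D.Small) (hs : D.Symm) {t x : ℕ → ℕ} (ht : ∀ v, t v ≤ 1)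
    (hx : ∀ v, x v ≤ 1) : |(D.lin t x : ℤ) - D.cut x - D.cut t| ≤ (D.dist x t : ℤ) ^ 2 := by
  -- Polarisation: `lin t x` is written twice, once with the two summation indices exchanged;
  -- together with `lin x x = 2 * cut x` and `lin t t = 2 * cut t`, only the product of the
  -- differences survives.
  have h1 : 2 * ((D.lin t x : ℤ) - D.cut x - D.cut t) =
      2 * ∑ v ∈ range D.n, ∑ u ∈ range D.n, (D.A v u : ℤ) * ((x v - t v) * (x u - t u)) := by
    have e1 : (D.lin t x : ℤ) = ∑ v ∈ range D.n, ∑ u ∈ range D.n,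
        (D.A v u : ℤ) * (x u + t v - 2 * x u * t v) := by
      rw [lin_cast ht hx, sum_swap hs fun v u => (x v + t u - 2 * x v * t u : ℤ)]
    have e2 : 2 * ((D.lin t x : ℤ) - D.cut x - D.cut t) =
        D.lin t x + D.lin t x - 2 * D.cut x - 2 * D.cut t := by ring
    rw [e2, two_mul_cut_cast hs hx, two_mul_cut_cast hs ht, lin_cast hx hx, lin_cast ht ht]
    nth_rewrite 1 [e1]
    rw [lin_cast ht hx, mul_sum, ← sum_add_distrib, ← sum_sub_distrib, ← sum_sub_distrib]
    refine sum_congr rfl fun v _ => ?_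
    rw [mul_sum, ← sum_add_distrib, ← sum_sub_distrib, ← sum_sub_distrib]
    exact sum_congr rfl fun u _ => by ring
  have h2 : (D.lin t x : ℤ) - D.cut x - D.cut t =
      ∑ v ∈ range D.n, ∑ u ∈ range D.n, (D.A v u : ℤ) * ((x v - t v) * (x u - t u)) := by
    linarith
  have h3 : (D.dist x t : ℤ) = ∑ v ∈ range D.n, |(x v : ℤ) - t v| := by
    rw [dist]; push_cast
    refine sum_congr rfl fun v _ => ?_
    have hx' := hx v
    have ht' := ht v
    interval_cases x v <;> interval_cases t v <;> simp
  rw [h2, h3, sq, sum_mul_sum]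
  refine (abs_sum_le_sum_abs _ _).trans (sum_le_sum fun v hv => (abs_sum_le_sum_abs _ _).trans
    (sum_le_sum fun u hu => ?_))
  rw [abs_mul, abs_mul]
  have hA : |(D.A v u : ℤ)| ≤ 1 := by
    rw [abs_of_nonneg (by positivity)]
    exact_mod_cast hD.A_le v (mem_range.1 hv) u (mem_range.1 hu)
  have : 0 ≤ |(x v : ℤ) - t v| * |(x u : ℤ) - t u| := by positivity
  nlinarith

/-! ### The dynamic program over combined weights. -/

theorem wt_eq {t : ℕ → ℕ} (ht : ∀ v, t v ≤ 1) {v a : ℕ} (ha : a ≤ 1) :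
    D.wt t v a = D.c v * a * (D.n + 1) + if a = t v then 0 else 1 := by
  have htv := ht v
  rw [wt]
  have h : a = 0 ∨ a = 1 := by omega
  rcases h with rfl | rfl
  · interval_cases t v <;> simp
  · interval_cases t v <;> simp

/-- Since the distance is at most `n`, the combined weight encodes cost and distance as its quotient
and remainder modulo `n + 1`. -/
theorem sum_wt {t x : ℕ → ℕ} (ht : ∀ v, t v ≤ 1) (hx : ∀ v, x v ≤ 1) :
    ∑ v ∈ range D.n, D.wt t v (x v) = D.cost x * (D.n + 1) + D.dist x t := by
  rw [cost, dist, sum_mul, ← sum_add_distrib]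
  exact sum_congr rfl fun v _ => wt_eq ht (hx v)

theorem dp_succ_le (B : ℕ) (t : ℕ → ℕ) (i W : ℕ) {a : ℕ} (ha : a ≤ 1) :
    D.dp B t (i + 1) W ≤ D.opt B t (D.dp B t i) i W a := by
  rw [dp, side]
  have h : a = 0 ∨ a = 1 := by omega
  rcases h with rfl | rfl <;> split_ifs <;> omega

/-- The sides of `x` are one of the choices over which the program minimises, and the cut-off at `B`
only lowers values. -/
theorem dp_le (B : ℕ) (t : ℕ → ℕ) {x : ℕ → ℕ} (hx : ∀ v, x v ≤ 1) (i : ℕ) :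
    D.dp B t i (∑ v ∈ range i, D.wt t v (x v)) ≤ ∑ v ∈ range i, D.price t v (x v) := by
  induction i with
  | zero => simp [dp]
  | succ i ih =>
    refine (dp_succ_le B t i _ (hx i)).trans ?_
    rw [opt, sum_range_succ, sum_range_succ, if_neg (by omega), Nat.add_sub_cancel]
    exact (min_le_left _ _).trans (by omega)

/-- A value below `big` rules out both the branch of value `big` for an exceeded weight and, as `big
≤ B`, an effective cut-off. So the recursion holds with equality along the whole path, and no
subtraction of weights is truncated. -/
theorem back_spec {B W : ℕ} {t : ℕ → ℕ} (hB : D.big ≤ B) (h : D.dp B t D.n W < D.big) :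
    ∀ j ≤ D.n, D.dp B t D.n W = D.dp B t (D.n - j) (D.rest B t W j) +
        ∑ v ∈ Ico (D.n - j) D.n, D.price t v (D.back B t W v) ∧
      W = D.rest B t W j + ∑ v ∈ Ico (D.n - j) D.n, D.wt t v (D.back B t W v) := by
  intro j
  induction j with
  | zero => simp [rest]
  | succ j ih =>
    intro hj
    obtain ⟨h1, h2⟩ := ih (by omega)
    set i := D.n - (j + 1) with hi
    have hi1 : D.n - j = i + 1 := by omega
    have hback : D.back B t W i = D.side B t (D.dp B t i) i (D.rest B t W j) := by
      rw [back, show D.n - 1 - i = j by omega]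
    have hrest : D.rest B t W (j + 1) = D.rest B t W j - D.wt t i (D.back B t W i) := by
      rw [rest, hback]
    have hlt : D.dp B t (i + 1) (D.rest B t W j) < D.big := by rw [← hi1]; omega
    have hdp : D.dp B t (i + 1) (D.rest B t W j) =
        D.opt B t (D.dp B t i) i (D.rest B t W j) (D.back B t W i) := by rw [hback]; rfl
    rw [hdp, opt] at hlt
    have hw : ¬ D.rest B t W j < D.wt t i (D.back B t W i) := by
      intro hw; rw [if_pos hw] at hlt; omega
    rw [hi1, hdp, opt, if_neg hw, min_eq_left (by rw [if_neg hw] at hlt; omega), ← hrest] at h1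
    rw [hi1] at h2
    have hin : i < D.n := by omega
    rw [sum_eq_sum_Ico_succ_bot hin, sum_eq_sum_Ico_succ_bot hin]
    constructor <;> omega

theorem back_le (B : ℕ) (t : ℕ → ℕ) (W v : ℕ) : D.back B t W v ≤ 1 := by
  rw [back, side]; split_ifs <;> omega

/-- Backtracking finds a set with the cost of `x`, and not much worse if `x` is near the reference
set. -/
theorem back_good {B : ℕ} {t x : ℕ → ℕ} (hD : D.Small) (hs : D.Symm) (hB : D.big ≤ B)
    (ht : ∀ v, t v ≤ 1) (hx : ∀ v, x v ≤ 1) :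
    let y := D.back B t (D.cost x * (D.n + 1) + D.dist x t)
    D.cost y = D.cost x ∧ D.cut y ≤ D.cut x + 2 * D.dist x t ^ 2 := by
  intro y
  set W := D.cost x * (D.n + 1) + D.dist x t with hW
  have hy : ∀ v, y v ≤ 1 := back_le B t W
  have hle : D.dp B t D.n W ≤ D.lin t x := by
    have := dp_le (D := D) B t hx D.n
    rwa [sum_wt ht hx] at this
  have hlin : D.lin t x ≤ D.n * D.n := by
    calc D.lin t x ≤ ∑ _v ∈ range D.n, D.n :=
          sum_le_sum fun v hv => Ex.price_le hD ht (mem_range.1 hv) _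
      _ = _ := by simp
  have hbig : D.dp B t D.n W < D.big := by rw [big]; omega
  obtain ⟨h1, h2⟩ := back_spec hB hbig D.n le_rfl
  rw [Nat.sub_self, ← range_eq_Ico] at h1 h2
  -- Weight left over at row `0` would make the value at least `big`.
  have h0 : D.rest B t W D.n = 0 := by
    by_contra h0
    rw [dp, if_neg h0] at h1; omega
  rw [h0, sum_wt ht hy, zero_add] at h2
  rw [h0, dp, if_pos rfl, zero_add] at h1
  have hd1 := D.dist_le x t
  have hd2 := D.dist_le y t
  have hcost : D.cost y = D.cost x := by
    have e1 : W / (D.n + 1) = D.cost x := by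
      rw [hW, mul_comm, Nat.mul_add_div (by omega), Nat.div_eq_of_lt (by omega), add_zero]
    have e2 : W / (D.n + 1) = D.cost y := by
      rw [h2, mul_comm, Nat.mul_add_div (by omega), Nat.div_eq_of_lt (by omega), add_zero]
    omega
  have hdist : D.dist y t = D.dist x t := by rw [hcost] at h2; omega
  refine ⟨hcost, ?_⟩
  -- Both `x` and `y` are compared with their prices; each comparison loses the square of the common
  -- distance, hence the factor `2`.
  have a1 := abs_le.1 (abs_lin_sub_le hD hs ht hx)
  have a2 := abs_le.1 (abs_lin_sub_le hD hs ht hy)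
  have a3 : D.lin t y ≤ D.lin t x := by rw [lin, ← h1]; exact hle
  rw [hdist] at a2
  zify at a3 ⊢
  linarith [a1.2, a2.1]

/-! ### Sampling -/

/-- The number of neighbours inside minus the number of neighbours outside of `x`. -/
def bias (D : CutData) (x : ℕ → ℕ) (v : ℕ) : ℤ := ∑ u ∈ range D.n, (D.A v u : ℤ) * (2 * x u - 1)

/-- A sequence of vertices whose neighbourhoods approximate the bias in quadratic mean. -/
theorem exists_sample (hD : D.Small) (hn : 0 < D.n) {x : ℕ → ℕ} (hx : ∀ v, x v ≤ 1) (k : ℕ) :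
    ∃ e : ℕ → ℕ, (∀ i, e i < D.n) ∧
      ∑ v ∈ range D.n, (∑ i ∈ range k, (D.n * ((D.A v (e i) : ℤ) * (2 * x (e i) - 1)) - D.bias x v)) ^ 2
        ≤ (k : ℤ) * D.n ^ 3 := by
  induction k with
  | zero => exact ⟨fun _ => 0, fun _ => hn, by simp⟩
  | succ k ih =>
    obtain ⟨e, he, hsum⟩ := ih
    set P : ℕ → ℤ := fun v =>
      ∑ i ∈ range k, (D.n * ((D.A v (e i) : ℤ) * (2 * x (e i) - 1)) - D.bias x v) with hP
    set z : ℕ → ℕ → ℤ := fun u v => D.n * ((D.A v u : ℤ) * (2 * x u - 1)) - D.bias x v with hz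
    have hz0 : ∀ v, ∑ u ∈ range D.n, z u v = 0 := by
      intro v
      simp only [hz]
      rw [sum_sub_distrib, ← mul_sum, ← bias]; simp
    -- A variance is at most the second moment: expand `(z u v + bias) ^ 2 ≤ n ^ 2` and sum over
    -- `u`, using that `z` has mean zero.
    have hz2 : ∀ v < D.n, ∑ u ∈ range D.n, z u v ^ 2 ≤ (D.n : ℤ) ^ 3 := by
      intro v hv
      have e1 : ∀ u ∈ range D.n, z u v ^ 2 ≤
          (D.n : ℤ) ^ 2 - 2 * D.bias x v * z u v - D.bias x v ^ 2 := by
        intro u hu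
        have hA := hD.A_le v hv u (mem_range.1 hu)
        have hxu := hx u
        have h1 : ((D.A v u : ℤ) * (2 * x u - 1)) ^ 2 ≤ 1 := by
          interval_cases D.A v u <;> interval_cases x u <;> norm_num
        have h2 : (z u v + D.bias x v) ^ 2 = (D.n : ℤ) ^ 2 * ((D.A v u : ℤ) * (2 * x u - 1)) ^ 2 := by
          simp only [hz]; ring
        nlinarith [sq_nonneg (D.n : ℤ)]
      refine (sum_le_sum e1).trans ?_
      rw [sum_sub_distrib, sum_sub_distrib, ← mul_sum, hz0]
      simp only [sum_const, card_range, nsmul_eq_mul]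
      nlinarith [sq_nonneg (D.bias x v), mul_nonneg (Int.natCast_nonneg D.n) (sq_nonneg (D.bias x v))]
    -- The next vertex is chosen by averaging over `u`: the cross terms vanish, so some choice adds
    -- at most `n ^ 3` to the sum of squares.
    have hex : ∃ u ∈ range D.n, ∑ v ∈ range D.n, (P v + z u v) ^ 2 ≤ ((k + 1 : ℕ) : ℤ) * D.n ^ 3 := by
      refine exists_le_of_sum_le ⟨0, mem_range.2 hn⟩ ?_
      rw [sum_comm]
      have e1 : ∀ v ∈ range D.n, ∑ u ∈ range D.n, (P v + z u v) ^ 2 ≤ D.n * P v ^ 2 + (D.n : ℤ) ^ 3 := by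
        intro v hv
        have : ∑ u ∈ range D.n, (P v + z u v) ^ 2 =
            ∑ u ∈ range D.n, (P v ^ 2 + 2 * P v * z u v + z u v ^ 2) :=
          sum_congr rfl fun u _ => by ring
        rw [this, sum_add_distrib, sum_add_distrib, ← mul_sum, hz0]
        have := hz2 v (mem_range.1 hv)
        simp only [sum_const, card_range, nsmul_eq_mul]
        linarith
      refine (sum_le_sum e1).trans ?_
      rw [sum_add_distrib, ← mul_sum]
      simp only [sum_const, card_range, nsmul_eq_mul]
      push_cast
      nlinarith [Int.natCast_nonneg D.n]
    obtain ⟨u, hu, hle⟩ := hex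
    refine ⟨Function.update e k u, fun i => ?_, ?_⟩
    · by_cases h : i = k
      · subst h; simpa using hu
      · simpa [h] using he i
    · refine le_of_eq_of_le (sum_congr rfl fun v _ => ?_) hle
      rw [sum_range_succ, Function.update_self]
      congr 2
      refine sum_congr rfl fun i hi => ?_
      rw [Function.update_of_ne (mem_range.1 hi).ne]

theorem exists_digits (hn : 0 < D.n) (e : ℕ → ℕ) (he : ∀ i, e i < 2 * D.n) (k : ℕ) :
    ∃ g < (2 * D.n) ^ k, ∀ i < k, D.digit g i = e i := by
  induction k generalizing e with
  | zero => exact ⟨0, by simp, by omega⟩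
  | succ k ih =>
    obtain ⟨g, hg, hd⟩ := ih (fun i => e (i + 1)) fun i => he _
    refine ⟨e 0 + 2 * D.n * g, ?_, fun i hi => ?_⟩
    · have := he 0
      rw [pow_succ]
      nlinarith
    · rcases i with _ | i
      · simp [digit, Nat.mod_eq_of_lt (he 0)]
      · rw [← hd i (by omega), digit, digit, pow_succ', ← Nat.div_div_eq_div_mul,
          Nat.add_mul_div_left _ _ (by omega), Nat.div_eq_of_lt (he 0), zero_add]

theorem price_add (t : ℕ → ℕ) (ht : ∀ v, t v ≤ 1) (v : ℕ) :
    D.price t v 0 + D.price t v 1 = D.deg v := by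
  rw [price, price, if_pos rfl, if_neg (by omega), ← sum_add_distrib, deg]
  refine sum_congr rfl fun u _ => ?_
  have := ht u
  interval_cases t u <;> simp

theorem bias_eq {x : ℕ → ℕ} (hx : ∀ v, x v ≤ 1) (v : ℕ) :
    D.bias x v = D.price x v 0 - D.price x v 1 := by
  rw [price_cast hx v (by omega), price_cast hx v le_rfl, bias, ← sum_sub_distrib]
  exact sum_congr rfl fun u _ => by push_cast; ring

theorem price_le_add_dist (hD : D.Small) {t x : ℕ → ℕ} (ht : ∀ v, t v ≤ 1) (hx : ∀ v, x v ≤ 1)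
    {v : ℕ} (hv : v < D.n) (a : ℕ) : D.price t v a ≤ D.price x v a + D.dist x t := by
  have key : ∀ u ∈ range D.n, D.A v u ≤ 1 := fun u hu => hD.A_le v hv u (mem_range.1 hu)
  rw [price, price, dist]
  split_ifs
  · rw [← sum_add_distrib]
    refine sum_le_sum fun u hu => ?_
    have h1 := key u hu
    have h2 := ht u
    have h3 := hx u
    interval_cases D.A v u <;> interval_cases t u <;> interval_cases x u <;> simp
  · rw [← sum_add_distrib]
    refine sum_le_sum fun u hu => ?_
    have h1 := key u hu
    have h2 := ht u
    have h3 := hx u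
    interval_cases D.A v u <;> interval_cases t u <;> interval_cases x u <;> simp

/-- The number of vertices with at least `d / 4` neighbours on the other side. -/
def rough (D : CutData) (d : ℕ) (x : ℕ → ℕ) : ℕ :=
  ∑ v ∈ range D.n, if d ≤ 4 * D.price x v (x v) then 1 else 0

/-- Every rough vertex carries a price of at least `d / 4`, and the prices sum to twice the cut
size. -/
theorem rough_mul_le (hs : D.Symm) {x : ℕ → ℕ} (hx : ∀ v, x v ≤ 1) (d : ℕ) :
    D.rough d x * d ≤ 8 * D.cut x := by
  have h1 : 2 * D.cut x = D.lin x x := by exact_mod_cast two_mul_cut_cast hs hx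
  calc D.rough d x * d = ∑ v ∈ range D.n, if d ≤ 4 * D.price x v (x v) then d else 0 := by
        rw [rough, sum_mul]; exact sum_congr rfl fun v _ => by split_ifs <;> simp
    _ ≤ ∑ v ∈ range D.n, 4 * D.price x v (x v) := sum_le_sum fun v _ => by split_ifs <;> omega
    _ = 4 * D.lin x x := by rw [lin, mul_sum]
    _ = _ := by omega

/-- At a vertex that is not rough, fewer than `d / 4` neighbours lie across `x`. Passing to `t` adds
at most `dist x t ≤ d / 4`, so fewer than half of the neighbours lie across and the majority decides
correctly. -/
theorem dist_maj_le (hD : D.Small) {x t : ℕ → ℕ} {d : ℕ} (hd : ∀ v < D.n, d ≤ D.deg v)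
    (hx : ∀ v, x v ≤ 1) (ht : ∀ v, t v ≤ 1) (h : 4 * D.dist x t ≤ d) :
    D.dist x (D.maj t) ≤ D.rough d x := by
  refine sum_le_sum fun v hv => ?_
  have hv' := mem_range.1 hv
  have h0 := price_le_add_dist hD ht hx hv' 0
  have h1 := price_le_add_dist hD ht hx hv' 1
  have h2 := price_add (D := D) t ht v
  have h3 := hd v hv'
  have h4 := hx v
  rw [maj]
  have h5 : x v = 0 ∨ x v = 1 := by omega
  rcases h5 with h5 | h5 <;> rw [h5] <;> split_ifs <;> omega

/-- A vertex that is not rough has bias at least `d / 2` in absolute value, so a misclassification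
forces a large deviation of its sample sum; the quadratic mean bound leaves room for few of these.
-/
theorem exists_samp (hD : D.Small) {x : ℕ → ℕ} {d : ℕ} (hd0 : 0 < d)
    (hn : 0 < D.n) (hd : ∀ v < D.n, d ≤ D.deg v) (hx : ∀ v, x v ≤ 1) (hk0 : 0 < D.k)
    (hk : 32 * D.n ^ 3 ≤ D.k * d ^ 3) :
    ∃ g < (2 * D.n) ^ D.k, ∃ N, 8 * N ≤ d ∧ D.dist x (D.samp g) ≤ D.rough d x + N := by
  obtain ⟨e, he, hsum⟩ := exists_sample hD hn hx D.k
  -- The sampled vertices are labelled by their side in `x`: `v` inside, `n + v` outside. All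
  -- labellings are enumerated, so this one occurs.
  obtain ⟨g, hg, hdig⟩ := exists_digits hn (fun i => if x (e i) = 1 then e i else e i + D.n)
    (fun i => by have := he i; split_ifs <;> omega) D.k
  -- `N` counts the misclassified vertices that are not rough.
  refine ⟨g, hg, ∑ v ∈ range D.n,
    if x v ≠ D.samp g v ∧ ¬ d ≤ 4 * D.price x v (x v) then 1 else 0, ?_, ?_⟩
  · set P : ℕ → ℤ := fun v =>
      ∑ i ∈ range D.k, (D.n * ((D.A v (e i) : ℤ) * (2 * x (e i) - 1)) - D.bias x v) with hP
    have hPv : ∀ v, P v = D.n * ((D.pos g v : ℤ) - D.neg g v) - D.k * D.bias x v := by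
      intro v
      simp only [hP]
      rw [sum_sub_distrib, ← mul_sum, pos, neg]
      push_cast
      rw [← sum_sub_distrib]
      simp only [sum_const, card_range, nsmul_eq_mul]
      congr 2
      refine sum_congr rfl fun i hi => ?_
      rw [hdig i (mem_range.1 hi)]
      have h1 := he i
      have h2 := hx (e i)
      have h3 : x (e i) = 0 ∨ x (e i) = 1 := by omega
      rcases h3 with h3 | h3
      · simp [h3]
      · simp [h3, h1]
    have hterm : ∀ v ∈ range D.n,
        (if x v ≠ D.samp g v ∧ ¬ d ≤ 4 * D.price x v (x v) then (D.k * d : ℤ) ^ 2 else 0) ≤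
          4 * P v ^ 2 := by
      intro v hv
      split_ifs with h
      · obtain ⟨h1, h2⟩ := h
        have h3 := price_add (D := D) x hx v
        have h4 := hd v (mem_range.1 hv)
        have h5 := hx v
        have h6 := bias_eq (D := D) hx v
        have h7 : x v = 0 ∨ x v = 1 := by omega
        rw [samp] at h1
        have hn' : (0 : ℤ) ≤ D.n := by positivity
        have hk' : (0 : ℤ) ≤ D.k := by positivity
        -- The sample difference and the bias favour opposite sides, the former possibly by zero, so
        -- `P v` is at least `k` times the bias in absolute value.
        have habs : (D.k * d : ℤ) ≤ 2 * |P v| := by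
          rcases h7 with h7 | h7
          · rw [h7] at h1 h2
            have hlt : D.neg g v < D.pos g v := by
              by_contra hc; rw [if_neg hc] at h1; exact h1 rfl
            have hb : (d : ℤ) ≤ 2 * -D.bias x v := by rw [h6]; omega
            have hpn : (0 : ℤ) ≤ (D.pos g v : ℤ) - D.neg g v := by omega
            have := le_abs_self (P v)
            rw [hPv] at this ⊢
            nlinarith [mul_nonneg hn' hpn, mul_le_mul_of_nonneg_left hb hk']
          · rw [h7] at h1 h2
            have hlt : ¬ D.neg g v < D.pos g v := by
              intro hc; rw [if_pos hc] at h1; exact h1 rfl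
            have hb : (d : ℤ) ≤ 2 * D.bias x v := by rw [h6]; omega
            have hpn : (0 : ℤ) ≤ (D.neg g v : ℤ) - D.pos g v := by omega
            have := neg_le_abs (P v)
            rw [hPv] at this ⊢
            nlinarith [mul_nonneg hn' hpn, mul_le_mul_of_nonneg_left hb hk']
        have h8 : (D.k * d : ℤ) ^ 2 ≤ (2 * |P v|) ^ 2 := pow_le_pow_left₀ (by positivity) habs 2
        calc _ ≤ _ := h8
          _ = _ := by rw [mul_pow, sq_abs]; norm_num
      · positivity
    set N := ∑ v ∈ range D.n, if x v ≠ D.samp g v ∧ ¬ d ≤ 4 * D.price x v (x v) then 1 else 0 with hN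
    have h1 : (N : ℤ) * (D.k * d : ℤ) ^ 2 ≤ 4 * (D.k * D.n ^ 3) := by
      calc (N : ℤ) * (D.k * d : ℤ) ^ 2 = ∑ v ∈ range D.n,
            (if x v ≠ D.samp g v ∧ ¬ d ≤ 4 * D.price x v (x v) then (D.k * d : ℤ) ^ 2 else 0) := by
            rw [hN]; push_cast; rw [sum_mul]
            exact sum_congr rfl fun v _ => by split_ifs <;> simp
        _ ≤ ∑ v ∈ range D.n, 4 * P v ^ 2 := sum_le_sum hterm
        _ = 4 * ∑ v ∈ range D.n, P v ^ 2 := by rw [mul_sum]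
        _ ≤ _ := by linarith
    have h1' : N * (D.k * d) ^ 2 ≤ 4 * (D.k * D.n ^ 3) := by exact_mod_cast h1
    -- From `N * (k * d) ^ 2 ≤ 4 * k * n ^ 3` and `32 * n ^ 3 ≤ k * d ^ 3` it follows that `N ≤ d /
    -- 8`.
    have h2 : (D.k * d ^ 2 * D.k) * (8 * N) ≤ (D.k * d ^ 2 * D.k) * d := by
      calc (D.k * d ^ 2 * D.k) * (8 * N) = 8 * (N * (D.k * d) ^ 2) := by ring
        _ ≤ D.k * (32 * D.n ^ 3) := by linarith
        _ ≤ D.k * (D.k * d ^ 3) := Nat.mul_le_mul_left _ hk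
        _ = _ := by ring
    exact Nat.le_of_mul_le_mul_left h2 (by positivity)
  · rw [dist, rough, ← sum_add_distrib]
    refine sum_le_sum fun v _ => ?_
    by_cases h1 : x v = D.samp g v
    · simp [h1]
    · by_cases h2 : d ≤ 4 * D.price x v (x v)
      · rw [if_neg h1, if_pos h2]; omega
      · rw [if_neg h1, if_neg h2, if_pos ⟨h1, h2⟩]

/-- If the sampled set is within `d / 4` of `x`, the majority step leaves only rough vertices wrong.
Otherwise `N ≤ d / 8` is less than half of the distance, so the distance is at most `2 * rough`.
Both cases end with `rough * d ≤ 8 * cut`. -/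
theorem exists_stage (hD : D.Small) (hs : D.Symm) {x : ℕ → ℕ} {d : ℕ} (hd0 : 0 < d)
    (hn : 0 < D.n) (hd : ∀ v < D.n, d ≤ D.deg v) (hx : ∀ v, x v ≤ 1) (hk0 : 0 < D.k)
    (hk : 32 * D.n ^ 3 ≤ D.k * d ^ 3) :
    ∃ g < (2 * D.n) ^ D.k, ∃ h < 2, D.dist x (D.stage g h) * d ≤ 16 * D.cut x := by
  obtain ⟨g, hg, N, hN, hdist⟩ := exists_samp hD hd0 hn hd hx hk0 hk
  have hr := rough_mul_le hs hx d
  refine ⟨g, hg, ?_⟩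
  by_cases h : 4 * D.dist x (D.samp g) ≤ d
  · refine ⟨1, by omega, ?_⟩
    have := dist_maj_le hD hd hx (Ex.samp_le g) h
    rw [stage, if_neg (by omega)]
    calc _ ≤ D.rough d x * d := Nat.mul_le_mul_right _ this
      _ ≤ _ := by omega
  · refine ⟨0, by omega, ?_⟩
    rw [stage, if_pos rfl]
    have h1 : D.dist x (D.samp g) ≤ 2 * D.rough d x := by omega
    calc _ ≤ 2 * D.rough d x * d := Nat.mul_le_mul_right _ h1
      _ ≤ _ := by linarith

/-! ### Candidates and the quality of the output. -/

theorem cost_bound_lt_wmax (hD : D.Small) {x : ℕ → ℕ} (hx : ∀ v, x v ≤ 1) (t : ℕ → ℕ) :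
    D.cost x * (D.n + 1) + D.dist x t < D.wmax := by
  have h1 := Ex.cost_le_of_small hD hx
  have h2 := D.dist_le x t
  have h3 : D.cost x * (D.n + 1) ≤ D.n * D.n * (D.n + 1) := Nat.mul_le_mul_right _ h1
  rw [wmax]
  nlinarith

/-- Some candidate is nearly as good as `x`. -/
theorem exists_cand {B : ℕ} (hD : D.Small) (hs : D.Symm) (hB : D.big ≤ B) {x : ℕ → ℕ} {d : ℕ}
    (hd0 : 0 < d) (hn : 0 < D.n) (hd : ∀ v < D.n, d ≤ D.deg v) (hx : ∀ v, x v ≤ 1) (hk0 : 0 < D.k)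
    (hk : 32 * D.n ^ 3 ≤ D.k * d ^ 3) :
    ∃ G < D.count, D.cost (D.cand B G) = D.cost x ∧
      ∃ s, s * d ≤ 16 * D.cut x ∧ D.cut (D.cand B G) ≤ D.cut x + 2 * s ^ 2 := by
  obtain ⟨g, hg, h, hh, hle⟩ := exists_stage hD hs hd0 hn hd hx hk0 hk
  have hW := cost_bound_lt_wmax hD hx (D.stage g h)
  have hgood := back_good (B := B) (t := D.stage g h) hD hs hB (Ex.stage_le g h) hx
  set W := D.cost x * (D.n + 1) + D.dist x (D.stage g h)
  -- Sample `g`, stage `h` and weight `W` are packed into the number `(2 * g + h) * wmax + W`; the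
  -- next equations unpack it.
  have hlt : h * D.wmax + W < 2 * D.wmax := by nlinarith
  have e1 : (g * (2 * D.wmax) + (h * D.wmax + W)) / (2 * D.wmax) = g := by
    rw [mul_comm g, Nat.mul_add_div (by omega), Nat.div_eq_of_lt hlt, add_zero]
  have e2 : (g * (2 * D.wmax) + (h * D.wmax + W)) = (2 * g + h) * D.wmax + W := by ring
  have e3 : (g * (2 * D.wmax) + (h * D.wmax + W)) / D.wmax % 2 = h := by
    rw [e2, mul_comm (2 * g + h), Nat.mul_add_div (by omega), Nat.div_eq_of_lt hW]
    omega
  have e4 : (g * (2 * D.wmax) + (h * D.wmax + W)) % D.wmax = W := by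
    rw [e2, mul_comm (2 * g + h), Nat.mul_add_mod, Nat.mod_eq_of_lt hW]
  have hc : D.cand B (g * (2 * D.wmax) + (h * D.wmax + W)) = D.back B (D.stage g h) W := by
    rw [cand, e1, e3, e4]
  refine ⟨g * (2 * D.wmax) + (h * D.wmax + W), ?_, ?_⟩
  · rw [count]
    calc g * (2 * D.wmax) + (h * D.wmax + W) < (g + 1) * (2 * D.wmax) := by linarith
      _ ≤ _ := Nat.mul_le_mul_right _ hg
  · rw [hc]
    exact ⟨hgood.1, _, hle, hgood.2⟩

/-- The output is nearly as good as every set with admissible cost. -/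
theorem out_good {B : ℕ} (hD : D.Small) (hs : D.Symm) (hB : D.big ≤ B) {x : ℕ → ℕ} {d : ℕ}
    (hd0 : 0 < d) (hn : 0 < D.n) (hd : ∀ v < D.n, d ≤ D.deg v) (hx : ∀ v, x v ≤ 1) (hk0 : 0 < D.k)
    (hk : 32 * D.n ^ 3 ≤ D.k * d ^ 3) (hlo : D.lo ≤ D.cost x) (hhi : D.cost x ≤ D.hi) :
    D.lo ≤ D.cost (D.out B) ∧ D.cost (D.out B) ≤ D.hi ∧
      ∃ s, s * d ≤ 16 * D.cut x ∧ D.cut (D.out B) ≤ D.cut x + 2 * s ^ 2 := by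
  obtain ⟨G, hG, hcost, s, hsd, hcut⟩ := exists_cand (B := B) hD hs hB hd0 hn hd hx hk0 hk
  have hmin := Ex.argFold_min (fun G => D.score (D.cand B G)) (D.count - 1) G (by omega)
  change D.score (D.out B) ≤ D.score (D.cand B G) at hmin
  have h1 : D.score (D.cand B G) = D.cut (D.cand B G) := by
    rw [score, if_neg (by omega), if_neg (by omega)]
  have h2 : D.cut (D.cand B G) < D.big := by
    rw [big]; exact Nat.lt_succ_of_le (Ex.cut_le hD (Ex.cand_le G))
  rw [h1, score] at hmin
  -- An inadmissible cost would give the output the score `big`, above the score of the good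
  -- candidate.
  split_ifs at hmin with h3 h4
  · omega
  · omega
  · exact ⟨by omega, by omega, s, hsd, by omega⟩

/-- Cube `n ≤ (n / d + 1) * d`. -/
theorem sampleSize_spec (hn : 0 < D.n) {d : ℕ} (hd0 : 0 < d) (hd : ∀ v < D.n, d ≤ D.deg v)
    (hd' : ∃ v < D.n, D.deg v = d) :
    D.sampleSize = 32 * ((D.n / d + 1) * (D.n / d + 1) * (D.n / d + 1)) ∧
      32 * D.n ^ 3 ≤ D.sampleSize * d ^ 3 := by
  have h : D.deg (Ex.argFold D.deg (D.n - 1)) = d := by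
    obtain ⟨v, hv, rfl⟩ := hd'
    refine le_antisymm (Ex.argFold_min D.deg _ v (by omega)) (hd _ ?_)
    exact (Ex.argFold_le _ _).trans_lt (by omega)
  have h2 : D.n ≤ (D.n / d + 1) * d := (Nat.lt_div_mul_add hd0).le.trans (by rw [add_mul, one_mul])
  refine ⟨by rw [sampleSize, h], ?_⟩
  rw [sampleSize, h]
  calc 32 * D.n ^ 3 ≤ 32 * ((D.n / d + 1) * d) ^ 3 := by gcongr
    _ = _ := by ring

end CutData

/-! ### The program -/

/-- A sequence of instructions. -/
def block : RAMInstr → List RAMInstr → RAMProg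
  | i, [] => .instr i
  | i, j :: l => .seq (.instr i) (block j l)

/-- The condition for a deterministic instruction to establish `Q` with words up to `w`. -/
def instrPre (w : ℕ) (Q : RAMStore → Prop) (s : RAMStore) : RAMInstr → Prop
  | .const d k => k ≤ w ∧ Q (s.setReg d k)
  | .add d a b => s.reg a + s.reg b ≤ w ∧ Q (s.setReg d (s.reg a + s.reg b))
  | .sub d a b => Q (s.setReg d (s.reg a - s.reg b))
  | .mul d a b => s.reg a * s.reg b ≤ w ∧ Q (s.setReg d (s.reg a * s.reg b))
  | .div d a b => Q (s.setReg d (s.reg a / s.reg b))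
  | .load d a => Q (s.setReg d (s.mem (s.reg a)))
  | .store a b => Q (s.setMem (s.reg a) (s.reg b))
  | .rand _ _ => False

/-- The condition for a sequence of instructions to establish `Q` with words up to `w`. -/
def blockPre (w : ℕ) (Q : RAMStore → Prop) : List RAMInstr → RAMStore → Prop
  | [], s => Q s
  | i :: l, s => instrPre w (blockPre w Q l) s i

theorem wp_of_instrPre {w : ℕ} {Q : RAMStore → Prop} {s : RAMStore} {i : RAMInstr}
    (h : instrPre w Q s i) : WP w 1 (.instr i) s Q := by
  cases i with
  | const d k => exact WP.const h.1 h.2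
  | add d a b => exact WP.add h.1 h.2
  | sub d a b => exact WP.sub h
  | mul d a b => exact WP.mul h.1 h.2
  | div d a b => exact WP.div h
  | load d a => exact WP.load h
  | store a b => exact WP.store h
  | rand d a => exact h.elim

theorem wp_block {w : ℕ} {Q : RAMStore → Prop} {s : RAMStore} {i : RAMInstr} {l : List RAMInstr}
    (h : blockPre w Q (i :: l) s) : WP w (2 * l.length + 1) (block i l) s Q := by
  induction l generalizing i s with
  | nil => exact wp_of_instrPre h
  | cons j l ih =>
    refine (WP.seq (T₁ := 1) (T₂ := 2 * l.length + 1) ((wp_of_instrPre h).mono le_rfl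
      fun s' _ h' => ih h')).mono (by simp; omega) fun _ _ h => h

namespace Ex

/-- Compute the bounds for the cost in `rT 8` and `rT 5`. -/
def boundsCode : RAMProg :=
  block (.const (rT 9) 0) [.load (rT 0) (rT 9), .const (rT 9) 1, .load (rT 1) (rT 9),
    .const (rT 9) 2, .load (rT 2) (rT 9), .const (rT 9) 3, .load (rT 3) (rT 9),
    .const (rT 9) 4, .load (rT 4) (rT 9),
    .add (rT 5) (rT 4) (rT 3), .mul (rT 5) (rT 1) (rT 5), .mul (rT 6) (rT 2) (rT 4),
    .div (rT 5) (rT 5) (rT 6), .mul (rT 7) (rT 0) (rT 0), .sub (rT 8) (rT 5) (rT 7),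
    .sub (rT 5) (rT 5) (rT 8),
    .sub (rT 8) (rT 4) (rT 3), .mul (rT 8) (rT 1) (rT 8), .add (rT 8) (rT 8) (rT 6),
    .const (rT 9) 1, .sub (rT 8) (rT 8) (rT 9), .div (rT 8) (rT 8) (rT 6),
    .add (rT 7) (rT 7) (rT 9), .sub (rT 9) (rT 8) (rT 7), .sub (rT 8) (rT 8) (rT 9)]

/-- The upper bound for the cost. -/
def upper (n a b p q : ℕ) : ℕ := min (a * (q + p) / (b * q)) (n * n)

/-- The lower bound for the cost. -/
def lower (n a b p q : ℕ) : ℕ := min ((a * (q - p) + b * q - 1) / (b * q)) (n * n + 1)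

/-- Minima are computed as `y - (y - c)`. The caps `n * n` and `n * n + 1` keep the bounds
polynomial in `n` however large the input fractions are. -/
theorem wp_boundsCode {W M n a b p q : ℕ} {s : RAMStore} (h0 : s.mem 0 = n) (h1 : s.mem 1 = a)
    (h2 : s.mem 2 = b) (h3 : s.mem 3 = p) (h4 : s.mem 4 = q) (hn : n ≤ M) (ha : a ≤ M) (hb : b ≤ M)
    (hp : p ≤ M) (hq : q ≤ M) (hW : 100 * ((M + 1) * (M + 1)) ≤ W) :
    WP W 51 boundsCode s fun s' => s'.reg (rT 0) = n ∧ s'.reg (rT 5) = upper n a b p q ∧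
      s'.reg (rT 8) = lower n a b p q ∧ s'.mem = s.mem := by
  refine (wp_block ?_).mono (by simp) fun _ _ h => h
  have e1 : a * (q + p) ≤ M * (2 * M) := Nat.mul_le_mul ha (by omega)
  have e2 : b * q ≤ M * M := Nat.mul_le_mul hb hq
  have e3 : n * n ≤ M * M := Nat.mul_le_mul hn hn
  have e4 : a * (q - p) ≤ M * M := Nat.mul_le_mul ha (by omega)
  have e5 : M * (2 * M) = 2 * (M * M) := by ring
  have e6 : 100 * ((M + 1) * (M + 1)) = 100 * (M * M) + 200 * M + 100 := by ring
  simp only [blockPre, instrPre, RAMStore.setReg_reg, RAMStore.setReg_mem, rT_inj, h0, h1, h2, h3, h4,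
    Nat.reduceEqDiff, if_true, if_false, OfNat.ofNat_ne_zero,
    OfNat.ofNat_ne_one, OfNat.zero_ne_ofNat, OfNat.one_ne_ofNat, zero_ne_one, one_ne_zero, and_true]
  simp only [upper, lower]
  generalize a * (q + p) / (b * q) = y
  generalize (a * (q - p) + b * q - 1) / (b * q) = z
  exact ⟨by omega, by omega, by omega, by omega, by omega, by omega, by omega, by omega, by omega,
    by omega, by omega, by omega, by omega, trivial, by omega, by omega⟩

/-- Store the bounds, and prepare the representation of the tables `0` and `1`. -/
def setupCode : RAMProg :=
  block (.const (rT 9) 1) [.store (rT 9) (rT 8), .const (rT 9) 2, .store (rT 9) (rT 5),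
    .const (rT 1) 0, .const (rT 9) 3, .store (rT 9) (rT 1), .const (rT 9) 4, .store (rT 9) (rT 1),
    .const (rT 9) 5, .store (rT 9) (rT 1), .const (rT 9) 6, .store (rT 9) (rT 1),
    .const (rF 0) 0, .const (rJ 0) 7, .const (rF 1) 7, .mul (rT 2) (rT 0) (rT 0),
    .add (rJ 1) (rT 0) (rT 2), .add (rF 2) (rF 1) (rJ 1),
    .const (rT 2) 1, .add (rT 2) (rT 0) (rT 2), .mul (rT 3) (rT 2) (rT 2), .mul (rT 3) (rT 3) (rT 2),
    .mul (rT 3) (rT 3) (rT 2), .const (rT 2) 100, .mul 0 (rT 2) (rT 3)]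

/-- The cut-off value for the computation of the sample size. -/
def bound₁ (n : ℕ) : ℕ := 100 * ((n + 1) * (n + 1) * (n + 1) * (n + 1))

/-- The first seven cells become table `0`. The fractions in them are not bounded in terms of `n`,
as entries of a table must be, so these cells are overwritten by the cost bounds and zeros. -/
theorem wp_setupCode {W n lo hi : ℕ} {s : RAMStore} (h0 : s.reg (rT 0) = n)
    (h5 : s.reg (rT 5) = hi) (h8 : s.reg (rT 8) = lo) (hW : bound₁ n ≤ W) :
    WP W 51 setupCode s fun s' => s'.reg 0 = bound₁ n ∧ s'.reg (rF 0) = 0 ∧ s'.reg (rJ 0) = 7 ∧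
      s'.reg (rF 1) = 7 ∧ s'.reg (rJ 1) = n + n * n ∧ s'.reg (rF 2) = 7 + (n + n * n) ∧
      ∀ i, s'.mem i = if i = 0 then s.mem 0 else if i = 1 then lo else if i = 2 then hi else
        if i < 7 then 0 else s.mem i := by
  refine (wp_block ?_).mono (by simp) fun _ _ h => h
  rw [bound₁] at *
  have e1 : 1 ≤ (n + 1) * (n + 1) := Nat.mul_pos (by omega) (by omega)
  have e2 : (n + 1) * (n + 1) ≤ (n + 1) * (n + 1) * (n + 1) := Nat.le_mul_of_pos_right _ (by omega)
  have e3 : (n + 1) * (n + 1) * (n + 1) ≤ (n + 1) * (n + 1) * (n + 1) * (n + 1) :=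
    Nat.le_mul_of_pos_right _ (by omega)
  have e4 : (n + 1) * (n + 1) = n * n + 2 * n + 1 := by ring
  simp only [blockPre, instrPre, RAMStore.setReg_reg, RAMStore.setReg_mem, RAMStore.setMem_mem,
    RAMStore.setMem_reg, rT_inj, rF_inj, rJ_inj, rF_ne_rJ, rJ_ne_rF, rF_ne_rT, rT_ne_rF, rJ_ne_rT,
    rT_ne_rJ, zero_ne_rT, zero_ne_rF, zero_ne_rJ, rF_ne_zero, rJ_ne_zero, h0, h5, h8,
    Nat.reduceEqDiff, if_true, if_false, OfNat.ofNat_ne_zero,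
    OfNat.ofNat_ne_one, OfNat.zero_ne_ofNat, OfNat.one_ne_ofNat, zero_ne_one, one_ne_zero,
    true_and]
  refine ⟨by omega, by omega, by omega, by omega, by omega, by omega, by omega, by omega, by omega,
    by omega, by omega, by omega, by omega, by omega, by omega, by omega, by omega, by omega, by omega,
    by omega, fun i => ?_⟩
  split_ifs <;> first | rfl | omega | (subst_vars; rfl)

/-- Store the size of the sample, and prepare the computation of a power. -/
def powInitCode : RAMProg :=
  block (.const (rT 3) 3) [.store (rT 3) (rT 0), .const (rT 1) 1, .const (rT 3) 0,
    .load (rT 2) (rT 3), .add (rT 2) (rT 2) (rT 2)]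

/-- Multiply `rT 1` by the power of `rT 2` with exponent `rT 0`. -/
def powCode : RAMProg :=
  .loop (rT 0) <| block (.mul (rT 1) (rT 1) (rT 2)) [.const (rT 3) 1, .sub (rT 0) (rT 0) (rT 3)]

/-- Compute and store the number of candidates, and compute the new cut-off value. -/
def countCode : RAMProg :=
  block (.const (rT 3) 0) [.load (rT 2) (rT 3), .const (rT 3) 1, .add (rT 3) (rT 2) (rT 3),
    .mul (rT 4) (rT 3) (rT 3), .mul (rT 4) (rT 4) (rT 3), .add (rT 4) (rT 4) (rT 4),
    .mul (rT 1) (rT 1) (rT 4), .const (rT 3) 4, .store (rT 3) (rT 1), .mul 0 (rT 1) 0,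
    .const (rT 3) 0, .load (rT 0) (rT 3)]

/-- The stores agree except for temporary registers. -/
def SameTables (s s' : RAMStore) : Prop :=
  s'.reg 0 = s.reg 0 ∧ (∀ l, s'.reg (rF l) = s.reg (rF l)) ∧ (∀ l, s'.reg (rJ l) = s.reg (rJ l)) ∧
    s'.mem = s.mem

theorem wp_powCode {W k b : ℕ} {s : RAMStore} (h0 : s.reg (rT 0) = k) (h1 : s.reg (rT 1) = 1)
    (h2 : s.reg (rT 2) = b) (hb : 0 < b) (hW : b ^ k ≤ W) :
    WP W (k * 6 + 1) powCode s fun s' => s'.reg (rT 1) = b ^ k ∧ SameTables s s' := by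
  have := WP.loop (w := W) (T := 5) (r := rT 0)
    (p := block (.mul (rT 1) (rT 1) (rT 2)) [.const (rT 3) 1, .sub (rT 0) (rT 0) (rT 3)])
    (fun m s' => m ≤ k ∧ s'.reg (rT 0) = m ∧ s'.reg (rT 1) = b ^ (k - m) ∧ s'.reg (rT 2) = b ∧
      SameTables s s') (fun m s h => h.2.1) (by
      rintro m s' ⟨hm, e0, e1, e2, e3, e4, e5, e6⟩
      refine (wp_block ?_).mono (by simp) fun _ _ h => h
      have hpow : b ^ (k - (m + 1)) * b = b ^ (k - m) := by
        rw [← pow_succ]; congr 1; omega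
      have hle : b ^ (k - m) ≤ b ^ k := Nat.pow_le_pow_right hb (by omega)
      have hpos : 0 < b ^ k := Nat.pow_pos hb
      simp [blockPre, instrPre, e0, e1, e2, hpow, SameTables, e3, e4, e5, e6]
      omega) k s ⟨le_rfl, h0, by simp [h1], h2, rfl, fun _ => rfl, fun _ => rfl, rfl⟩
  exact this.mono le_rfl fun s' _ h => ⟨by simpa using h.2.2.1, h.2.2.2.2⟩

theorem wp_powInitCode {W k n : ℕ} {s : RAMStore} (h0 : s.reg (rT 0) = k) (hm : s.mem 0 = n)
    (hW : 3 ≤ W) (hW' : 2 * n ≤ W) :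
    WP W 11 powInitCode s fun s' => s'.reg (rT 0) = k ∧ s'.reg (rT 1) = 1 ∧ s'.reg (rT 2) = 2 * n ∧
      s'.reg 0 = s.reg 0 ∧ (∀ l, s'.reg (rF l) = s.reg (rF l)) ∧
      (∀ l, s'.reg (rJ l) = s.reg (rJ l)) ∧ ∀ i, s'.mem i = if i = 3 then k else s.mem i := by
  refine (wp_block ?_).mono (by simp) fun _ _ h => h
  simp [blockPre, instrPre, h0, hm]
  omega

/-- The final product, the new cut-off, dominates all intermediate words. -/
theorem wp_countCode {W n P B : ℕ} {s : RAMStore} (h0 : s.reg 0 = B) (h1 : s.reg (rT 1) = P)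
    (hm : s.mem 0 = n) (hP : 0 < P) (hB : 4 ≤ B)
    (hW : P * (2 * ((n + 1) * (n + 1) * (n + 1))) * B ≤ W) :
    WP W 25 countCode s fun s' => s'.reg (rT 0) = n ∧
      s'.reg 0 = P * (2 * ((n + 1) * (n + 1) * (n + 1))) * B ∧
      (∀ l, s'.reg (rF l) = s.reg (rF l)) ∧ (∀ l, s'.reg (rJ l) = s.reg (rJ l)) ∧
      ∀ i, s'.mem i = if i = 4 then P * (2 * ((n + 1) * (n + 1) * (n + 1))) else s.mem i := by
  refine (wp_block ?_).mono (by simp) fun _ _ h => h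
  have e1 : 1 ≤ (n + 1) * (n + 1) := Nat.mul_pos (by omega) (by omega)
  have e2 : (n + 1) * (n + 1) ≤ (n + 1) * (n + 1) * (n + 1) := Nat.le_mul_of_pos_right _ (by omega)
  have e3 : n + 1 ≤ (n + 1) * (n + 1) := Nat.le_mul_of_pos_right _ (by omega)
  set w := (n + 1) * (n + 1) * (n + 1) with hw
  have e4 : 2 * w ≤ P * (2 * w) := Nat.le_mul_of_pos_left _ hP
  have e5 : P * (2 * w) * 4 ≤ P * (2 * w) * B := Nat.mul_le_mul_left _ hB
  simp [blockPre, instrPre, h0, h1, hm, ← two_mul, ← hw]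
  exact ⟨by omega, by omega, by omega, by omega, by omega, by omega, by omega, by omega⟩

/-- Copy the entries of table `2` to the beginning of the memory. -/
def copyCode : RAMProg :=
  .seq (block (.const (rT 3) 0) [.load (rT 0) (rT 3), .const (rT 1) 0]) <|
    .loop (rT 0) <| block (.add (rT 2) (rF 2) (rT 1)) [.load (rT 2) (rT 2), .store (rT 1) (rT 2),
      .const (rT 3) 1, .add (rT 1) (rT 1) (rT 3), .sub (rT 0) (rT 0) (rT 3)]

/-- Since `n ≤ F`, the copied cells do not overlap the source. -/
theorem wp_copyCode {W n F : ℕ} {s : RAMStore} (hm : s.mem 0 = n) (hF : s.reg (rF 2) = F)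
    (hn : n ≤ F) (hW : F + n + 1 ≤ W) :
    WP W (n * 12 + 7) copyCode s fun s' => ∀ i < n, s'.mem i = s.mem (F + i) := by
  have hloop := WP.loop (w := W) (T := 11) (r := rT 0)
    (p := block (.add (rT 2) (rF 2) (rT 1)) [.load (rT 2) (rT 2), .store (rT 1) (rT 2),
      .const (rT 3) 1, .add (rT 1) (rT 1) (rT 3), .sub (rT 0) (rT 0) (rT 3)])
    (fun m s' => m ≤ n ∧ s'.reg (rT 0) = m ∧ s'.reg (rT 1) = n - m ∧ s'.reg (rF 2) = F ∧
      (∀ i < n - m, s'.mem i = s.mem (F + i)) ∧ ∀ i ≥ F, s'.mem i = s.mem i)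
    (fun m s h => h.2.1) (by
      rintro m s' ⟨hm, e0, e1, e2, e3, e4⟩
      refine (wp_block ?_).mono (by simp) fun _ _ h => h
      simp [blockPre, instrPre, e0, e1, e2]
      refine ⟨by omega, by omega, by omega, by omega, by omega, fun i hi => ?_, fun i hi => ?_⟩
      · split_ifs with h
        · rw [h]; exact e4 _ (by omega)
        · exact e3 i (by omega)
      · rw [if_neg (by omega)]; exact e4 i hi)
  refine WP.mono (WP.seq (T₁ := 5) (T₂ := n * (11 + 1) + 1) ((wp_block ?_).mono (by simp) fun s' _ h => hloop n s' h))
    (by omega) fun s' _ h => by simpa using h.2.2.2.2.1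
  simp [blockPre, instrPre, hm, hF]

/-- The whole algorithm. -/
def cutProg : RAMProg :=
  .seq boundsCode <| .seq setupCode <| .seq (comp sampleSizeE 0) <| .seq powInitCode <|
    .seq powCode <| .seq countCode <| .seq (fillCode 2 0 (comp outE 1)) copyCode

/-- The data of the algorithm, apart from the size of the sample. -/
def protoData (n a b p q : ℕ) (data : List ℕ) : CutData where
  n := n
  lo := lower n a b p q
  hi := upper n a b p q
  k := 0
  c v := data.getD v 0
  A u v := data.getD (n + u * n + v) 0

/-- The data of the algorithm. -/
def mkData (n a b p q : ℕ) (data : List ℕ) : CutData :=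
  { protoData n a b p q data with k := (protoData n a b p q data).sampleSize }

/-- The cut-off value for the main part of the computation. -/
def bound₂ (D : CutData) : ℕ := D.count * bound₁ D.n

theorem count_pos {D : CutData} (hn : 0 < D.n) : 0 < D.count := by
  have := wmax_pos (D := D)
  rw [CutData.count]
  exact Nat.mul_pos (Nat.pow_pos (by omega)) (by omega)

theorem sampleSize_le {D : CutData} : D.sampleSize ≤ 32 * ((D.n + 1) * (D.n + 1) * (D.n + 1)) := by
  rw [CutData.sampleSize]
  have := Nat.div_le_self D.n (D.deg (argFold D.deg (D.n - 1)))
  gcongr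

theorem bound₁_ge (n : ℕ) : 100 * ((n + 1) * (n + 1) * (n + 1)) ≤ bound₁ n ∧
    100 * ((n + 1) * (n + 1)) ≤ bound₁ n ∧ 100 ≤ bound₁ n := by
  rw [bound₁]
  have e1 : 1 ≤ (n + 1) * (n + 1) := Nat.mul_pos (by omega) (by omega)
  have e2 : (n + 1) * (n + 1) ≤ (n + 1) * (n + 1) * (n + 1) := Nat.le_mul_of_pos_right _ (by omega)
  have e3 : (n + 1) * (n + 1) * (n + 1) ≤ (n + 1) * (n + 1) * (n + 1) * (n + 1) :=
    Nat.le_mul_of_pos_right _ (by omega)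
  omega

/-- A bound for all numbers that occur, if the parameters are at most `M`. -/
def wordBound (M B : ℕ) : ℕ :=
  100 * ((M + 1) * (M + 1)) + B * B + (arrs outE + arrs sampleSizeE + 10) * B

/-- A bound for the number of steps. -/
def timeBound (B : ℕ) : ℕ := 200 + cost B sampleSizeE + 30 * B + B * (cost B outE + 11)

theorem cost_mono {B B' : ℕ} (h : B ≤ B') (e : Ex) : cost B e ≤ cost B' e := by
  induction e with
  | lit => exact le_rfl
  | idx => exact le_rfl
  | get l e ih => simp only [cost]; omega
  | op o x y ihx ihy => simp only [cost]; omega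
  | ite c x y ihc ihx ihy => simp only [cost]; omega
  | arr d m e f ihm ihe ihf =>
    simp only [cost]
    have : B * (cost B e + 11) ≤ B' * (cost B' e + 11) := Nat.mul_le_mul h (by omega)
    omega

/-- There are two phases with different cut-offs. The sample size is computed below `bound₁`,
polynomial in `n` with fixed degree; only then are the number of candidates and the cut-off `bound₂`
for the search known. -/
theorem wp_cutProg {M n a b p q : ℕ} {data : List ℕ} {s : RAMStore} (hn0 : 0 < n) (h0 : s.mem 0 = n)
    (h1 : s.mem 1 = a) (h2 : s.mem 2 = b) (h3 : s.mem 3 = p) (h4 : s.mem 4 = q) (hn : n ≤ M)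
    (ha : a ≤ M) (hb : b ≤ M) (hp : p ≤ M) (hq : q ≤ M) (hlen : data.length = n + n * n)
    (hdata : ∀ i < n + n * n, s.mem (7 + i) = data.getD i 0) (hle : ∀ x ∈ data, x ≤ n)
    (hD : (mkData n a b p q data).Small) :
    WP (wordBound M (bound₂ (mkData n a b p q data))) (timeBound (bound₂ (mkData n a b p q data)))
      cutProg s fun s' => ∀ v < n, s'.mem v =
        (mkData n a b p q data).out (bound₂ (mkData n a b p q data)) v := by
  set D := mkData n a b p q data with hDdef
  set B := bound₂ D with hBdef
  set W := wordBound M B with hWdef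
  have hDn : D.n = n := rfl
  -- Definitional, since `sampleSize` does not read the field `k`.
  have hDk : D.k = D.sampleSize := rfl
  have hcount : 0 < D.count := count_pos hn0
  obtain ⟨g1, g2, g3⟩ := bound₁_ge n
  have hBB : bound₁ n ≤ B := Nat.le_mul_of_pos_left _ hcount
  have hkle : D.k ≤ bound₁ n := by
    have := sampleSize_le (D := D); rw [hDk]; rw [hDn] at this; omega
  have hcB : D.count ≤ B := Nat.le_mul_of_pos_right _ (show 0 < bound₁ n by omega)
  have hsq : (n + 1) * (n + 1) = n * n + 2 * n + 1 := by ring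
  have hpoly : 2 * ((D.n + 1) * (D.n + 1) * (D.n + 1) * (D.n + 1)) ≤ bound₁ n :=
    Nat.mul_le_mul_right _ (by omega)
  have hL1 : Large D (bound₁ n) := ⟨hpoly, hkle⟩
  have hL2 : Large D B := ⟨hL1.poly.trans hBB, hkle.trans hBB⟩
  have hWW : W = 100 * ((M + 1) * (M + 1)) + B * B +
      (arrs outE * B + arrs sampleSizeE * B + 10 * B) := by
    rw [hWdef, wordBound]; ring
  have hB1sq : bound₁ n * bound₁ n ≤ B * B := Nat.mul_le_mul hBB hBB
  have hBarr : arrs sampleSizeE * bound₁ n ≤ arrs sampleSizeE * B := Nat.mul_le_mul_left _ hBB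
  have hcostB := cost_mono hBB sampleSizeE
  have hloeq : D.lo ≤ n * n + 1 := min_le_right _ _
  have hhieq : D.hi ≤ n * n := min_le_right _ _
  have hnB : n * (cost B outE + 11) ≤ B * (cost B outE + 11) := Nat.mul_le_mul_right _ (by omega)
  refine WP.mono (WP.seq ((wp_boundsCode h0 h1 h2 h3 h4 hn ha hb hp hq (by omega)).mono le_rfl ?_))
    (T := 51 + (51 + (cost B sampleSizeE + (11 + ((D.k * 6 + 1) + (25 +
      ((n * (cost B outE + 11) + 5) + (n * 12 + 7) + 1) + 1) + 1) + 1) + 1) + 1) + 1)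
    (by rw [timeBound]; omega) fun _ _ h => h
  rintro s₁ - ⟨a1, a2, a3, a4⟩
  refine WP.seq ((wp_setupCode a1 a2 a3 (by omega)).mono le_rfl ?_)
  rintro s₂ - ⟨b1, b2, b3, b4, b5, b6, b7⟩
  set E : ℕ → List ℕ := fun l =>
    if l = 0 then [n, D.lo, D.hi, 0, 0, 0, 0] else if l = 1 then data else [] with hE
  have hdat : ∀ i < n + n * n, s₂.mem (7 + i) = data.getD i 0 := by
    intro i hi
    rw [b7, if_neg (by omega), if_neg (by omega), if_neg (by omega), if_neg (by omega), a4]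
    exact hdata i hi
  have hrep : Rep (bound₁ n) 2 E s₂ := by
    refine ⟨b1, ?_, ?_, ?_, ?_⟩
    · intro l hl
      interval_cases l
      · simp [hE]; omega
      · simp only [hE, one_ne_zero, if_false, if_true, hlen]
        exact ⟨by omega, fun x hx => (hle x hx).trans (by omega)⟩
    · intro l hl
      interval_cases l
      · simp [hE, b3]
      · simp [hE, b5, hlen]
    · intro l hl
      interval_cases l
      · simp [hE, b2, b6]
      · simp [hE, b4, b6, hlen]
    · intro l hl i hi
      interval_cases l
      · simp [hE] at hi
        interval_cases i <;> simp [hE, b2, b7, a4, h0] <;> rfl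
      · simp only [hE, one_ne_zero, if_false, if_true, hlen] at hi ⊢
        rw [b4]; exact hdat i hi
  have hEG : EnvG D E := ⟨rfl, fun _ _ => rfl, fun _ _ _ _ => rfl⟩
  refine WP.seq ((wp_comp (W := W) g3 (by omega) sampleSizeE 2 0 E s₂ wf_sampleSizeE hrep
    (by rw [b6]; omega)).mono hcostB ?_)
  rw [eval_sampleSizeE hEG hD hn0 hL1 (by rw [hDn]; omega)]
  rintro s₃ - ⟨c1, c2⟩
  have hrep₃ := hrep.of_frame c2
  have c3 : s₃.mem 0 = n := by
    have := hrep₃.mem 0 (by omega) 0 (by simp [hE])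
    rw [c2.base 0 (by omega), b2] at this
    simpa [hE] using this
  refine WP.seq ((wp_powInitCode (W := W) c1 c3 (by omega) (by omega)).mono le_rfl ?_)
  rintro s₄ - ⟨d1, d2, d3, d4, d5, d6, d7⟩
  rw [← hDk] at d1 d7
  have hpowpos : 0 < (2 * n) ^ D.k := Nat.pow_pos (by omega)
  have hpow : (2 * n) ^ D.k ≤ D.count := by
    rw [CutData.count, hDn]
    exact Nat.le_mul_of_pos_right _ (by have := wmax_pos (D := D); omega)
  refine WP.seq ((wp_powCode (W := W) d1 d2 d3 (by omega) (by omega)).mono le_rfl ?_)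
  rintro s₅ - ⟨e1, e2, e3, e4, e5⟩
  have hcnt : (2 * n) ^ D.k * (2 * ((n + 1) * (n + 1) * (n + 1))) = D.count := rfl
  refine WP.seq ((wp_countCode (W := W) (n := n) (P := (2 * n) ^ D.k) (B := bound₁ n)
    (by rw [e2, d4, hrep₃.bound]) e1 (by rw [e5, d7]; simpa using c3) hpowpos (by omega)
    (by rw [hcnt]; change B ≤ W; omega)).mono le_rfl ?_)
  rw [hcnt]
  rintro s₆ - ⟨f1, f2, f3, f4, f5⟩
  change _ = B at f2
  -- The tables of the second phase differ only in the entries for `k` and the number of candidates.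
  set E' : ℕ → List ℕ := fun l =>
    if l = 0 then [n, D.lo, D.hi, D.k, D.count, 0, 0] else if l = 1 then data else [] with hE'
  have hF : ∀ l ≤ 2, s₆.reg (rF l) = s₂.reg (rF l) := by
    intro l hl; rw [f3, e3, d5, c2.base l hl]
  have hJ : ∀ l < 2, s₆.reg (rJ l) = s₂.reg (rJ l) := by
    intro l hl; rw [f4, e4, d6, c2.len l hl]
  have hmem : ∀ i < 7 + (n + n * n), s₆.mem i =
      if i = 4 then D.count else if i = 3 then D.k else s₂.mem i := by
    intro i hi
    rw [f5, e5, d7, c2.mem i (by rw [b6]; exact hi)]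
  have hrep₆ : Rep B 2 E' s₆ := by
    refine ⟨f2, ?_, ?_, ?_, ?_⟩
    · intro l hl
      interval_cases l
      · simp [hE']; omega
      · simp only [hE', one_ne_zero, if_false, if_true, hlen]
        exact ⟨by omega, fun x hx => (hle x hx).trans (by omega)⟩
    · intro l hl
      rw [hJ l hl]
      interval_cases l
      · simp [hE', b3]
      · simp [hE', b5, hlen]
    · intro l hl
      rw [hF l (by omega), hF 2 le_rfl]
      interval_cases l
      · simp [hE', b2, b6]
      · simp [hE', b4, b6, hlen]
    · intro l hl i hi
      rw [hF l (by omega)]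
      interval_cases l
      · simp [hE'] at hi
        rw [b2, zero_add, hmem _ (by omega)]
        interval_cases i <;> simp [hE', b7, a4, h0] <;> rfl
      · simp only [hE', one_ne_zero, if_false, if_true, hlen] at hi ⊢
        rw [b4, hmem _ (by omega), if_neg (by omega), if_neg (by omega)]
        exact hdat i hi
  have hED : EnvD D E' := ⟨⟨rfl, fun _ _ => rfl, fun _ _ _ _ => rfl⟩, rfl, rfl, rfl, rfl⟩
  have hB100 : 100 ≤ B := by omega
  refine WP.seq ((wp_fillCode (K := arrs outE * B) (g := fun L => eval B outE (Function.update E' 2 L))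
    hB100 (by omega) hrep₆ (by rw [hF 2 le_rfl, b6]; omega) f1 (by omega)
    (fun L hL hL' => eval_le hB100 outE 3 _ wf_outE (hrep₆.le.update (by omega) hL'))
    (fun t L ht htF => wp_comp (W := W) hB100 (by omega) outE 3 1 _ t wf_outE ht htF)).mono le_rfl ?_)
  rintro s₇ - ⟨k1, k2, k3⟩
  rw [fill_eq_map (F := D.out B) n (fun j hj => eval_outE (hED.update le_rfl _) hD hL2 hcount hcB
    (by simp) hj)] at k1
  have k4 : s₇.reg (rF 2) = 7 + (n + n * n) := by rw [k2.base 2 le_rfl, hF 2 le_rfl, b6]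
  refine (wp_copyCode (W := W) (n := n) (F := 7 + (n + n * n)) ?_ k4 (by omega) (by omega)).mono le_rfl ?_
  · have := k1.mem 0 (by omega) 0 (by simp [hE'])
    rw [k2.base 0 (by omega), hF 0 (by omega), b2] at this
    simpa [hE'] using this
  · intro s₈ _ h v hv
    rw [h v hv]
    have := k1.mem 2 (by omega) v (by simpa using hv)
    rw [k4] at this
    simpa [hv] using this

end Ex

/-! ### The instance as data of the algorithm -/

namespace CMCInstance

open Finset

variable (I : CMCInstance)

open Classical in
/-- The weights and the adjacency matrix. -/
noncomputable def data : List ℕ :=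
  List.ofFn I.c ++ (List.ofFn fun u => List.ofFn fun v => if I.G.Adj u v then 1 else 0).flatten

/-- The data of the algorithm for an instance. -/
noncomputable def cutData : CutData :=
  Ex.mkData I.n I.ρ.num.natAbs I.ρ.den I.ζ.num.natAbs I.ζ.den I.data

theorem input_eq (ε : ℚ) : I.input ε = I.params ε ++ I.data := by
  rw [input, data, List.append_assoc]

open Classical in
theorem data_eq : I.data = List.ofFn I.c ++
    List.ofFn fun i : Fin (I.n * I.n) => if I.G.Adj i.divNat i.modNat then 1 else 0 := by
  rw [data, List.ofFn_mul]
  congr 3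
  funext u
  congr 1
  funext v
  have h : ∀ h, (⟨(u : ℕ) * I.n + v, h⟩ : Fin (I.n * I.n)).divNat = u ∧
      (⟨(u : ℕ) * I.n + v, h⟩ : Fin (I.n * I.n)).modNat = v := by
    intro h
    have hv := v.isLt
    refine ⟨Fin.ext ?_, Fin.ext ?_⟩
    · simp only [Fin.coe_divNat]
      rw [mul_comm, Nat.mul_add_div (by omega), Nat.div_eq_of_lt hv, add_zero]
    · simp only [Fin.coe_modNat]
      rw [mul_comm, Nat.mul_add_mod, Nat.mod_eq_of_lt hv]
  rw [(h _).1, (h _).2]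

theorem length_data : I.data.length = I.n + I.n * I.n := by
  rw [data_eq]; simp

theorem data_c (v : Fin I.n) : I.data.getD v 0 = I.c v := by
  rw [data_eq, List.getD_append _ _ _ _ (by simp)]
  simp

open Classical in
theorem data_A (u v : Fin I.n) :
    I.data.getD (I.n + u * I.n + v) 0 = if I.G.Adj u v then 1 else 0 := by
  have hlt : (u : ℕ) * I.n + v < I.n * I.n := by
    calc (u : ℕ) * I.n + v < (u + 1) * I.n := by have := v.isLt; linarith
      _ ≤ _ := Nat.mul_le_mul_right _ u.isLt
  rw [data_eq, List.getD_append_right _ _ _ _ (by simp; omega), List.length_ofFn,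
    show I.n + (u : ℕ) * I.n + v - I.n = u * I.n + v by omega,
    List.getD_eq_getElem _ _ (by simpa using hlt), List.getElem_ofFn]
  have h1 : (⟨(u : ℕ) * I.n + v, hlt⟩ : Fin (I.n * I.n)).divNat = u := by
    refine Fin.ext ?_
    simp only [Fin.coe_divNat]
    rw [mul_comm, Nat.mul_add_div (by have := v.isLt; omega), Nat.div_eq_of_lt v.isLt, add_zero]
  have h2 : (⟨(u : ℕ) * I.n + v, hlt⟩ : Fin (I.n * I.n)).modNat = v := by
    refine Fin.ext ?_
    simp only [Fin.coe_modNat]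
    rw [mul_comm, Nat.mul_add_mod, Nat.mod_eq_of_lt v.isLt]
  rw [h1, h2]

theorem two_le_n : 2 ≤ I.n := by
  have h1 : (1 : ℚ) ≤ (∑ v, I.c v : ℕ) / 2 := I.one_le_ρ.trans I.ρ_le
  have h2 : (2 : ℚ) ≤ (∑ v, I.c v : ℕ) := by linarith
  have h3 : 2 ≤ ∑ v, I.c v := by exact_mod_cast h2
  have h4 : ∑ v, I.c v ≤ I.n * I.n := by
    calc ∑ v, I.c v ≤ ∑ _v : Fin I.n, I.n := sum_le_sum fun v _ => I.c_le v
      _ = _ := by simp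
  by_contra h
  have : I.n * I.n ≤ 1 * 1 := Nat.mul_le_mul (by omega) (by omega)
  omega

theorem le_of_mem_data {x : ℕ} (hx : x ∈ I.data) : x ≤ I.n := by
  classical
  have h2 := I.two_le_n
  rw [data_eq] at hx
  rcases List.mem_append.1 hx with hx | hx
  · obtain ⟨v, rfl⟩ := (List.mem_ofFn' _ _).1 hx
    exact I.c_le v
  · obtain ⟨v, rfl⟩ := (List.mem_ofFn' _ _).1 hx
    dsimp only
    split_ifs <;> omega

theorem cutData_n : I.cutData.n = I.n := rfl

theorem cutData_c (v : Fin I.n) : I.cutData.c v = I.c v := I.data_c v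

open Classical in
theorem cutData_A (u v : Fin I.n) : I.cutData.A u v = if I.G.Adj u v then 1 else 0 := I.data_A u v

theorem small_cutData : I.cutData.Small := by
  classical
  refine ⟨fun v hv => ?_, fun u hu v hv => ?_⟩
  · rw [I.cutData_c ⟨v, hv⟩]; exact I.c_le _
  · rw [I.cutData_A ⟨u, hu⟩ ⟨v, hv⟩]; split_ifs <;> omega

theorem symm_cutData : I.cutData.Symm := by
  classical
  intro u hu v hv
  rw [I.cutData_A ⟨u, hu⟩ ⟨v, hv⟩, I.cutData_A ⟨v, hv⟩ ⟨u, hu⟩]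
  simp only [I.G.adj_comm]

open Classical in
theorem deg_cutData (v : Fin I.n) : I.cutData.deg v = I.G.degree v := by
  rw [CutData.deg, cutData_n, sum_range]
  simp only [cutData_A]
  rw [sum_boole, Nat.cast_id, ← SimpleGraph.card_neighborFinset_eq_degree]
  congr 1
  ext u
  simp

/-- The vertex set with a given indicator function. -/
def setOf (x : ℕ → ℕ) : Finset (Fin I.n) := univ.filter fun v => x v ≠ 0

theorem cost_setOf {x : ℕ → ℕ} (hx : ∀ v, x v ≤ 1) : I.cost (I.setOf x) = I.cutData.cost x := by
  rw [cost, setOf, CutData.cost, cutData_n, sum_range, sum_filter]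
  refine sum_congr rfl fun v _ => ?_
  rw [cutData_c]
  have h := hx v
  have : x v = 0 ∨ x v = 1 := by omega
  rcases this with h | h <;> simp [h]

theorem cutSize_setOf {x : ℕ → ℕ} (hx : ∀ v, x v ≤ 1) :
    I.cutSize (I.setOf x) = I.cutData.cut x := by
  classical
  rw [cutSize, SimpleGraph.interedges_def, card_filter, sum_product, CutData.cut, cutData_n, sum_range,
    setOf, sum_filter]
  refine sum_congr rfl fun u _ => ?_
  rw [sum_range, compl_filter, sum_filter]
  rw [ite_sum_zero]
  refine sum_congr rfl fun v _ => ?_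
  rw [cutData_A]
  have h1 : x u = 0 ∨ x u = 1 := by have := hx u; omega
  have h2 : x v = 0 ∨ x v = 1 := by have := hx v; omega
  rcases h1 with h1 | h1 <;> rcases h2 with h2 | h2 <;> simp [h1, h2]

theorem exists_indicator (S : Finset (Fin I.n)) : ∃ x : ℕ → ℕ, (∀ v, x v ≤ 1) ∧ I.setOf x = S := by
  classical
  refine ⟨fun v => if h : v < I.n then (if ⟨v, h⟩ ∈ S then 1 else 0) else 0, fun v => ?_, ?_⟩
  · dsimp only
    split_ifs <;> omega
  · ext v; simp [setOf]

/-- Costs are integers, so rounding the rational bounds changes nothing, and for costs up to `n * n`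
neither do the caps. -/
theorem feasible_iff {S : Finset (Fin I.n)} {x : ℕ} (hx : I.cost S = x) (hle : x ≤ I.n * I.n) :
    I.Feasible S ↔ I.cutData.lo ≤ x ∧ x ≤ I.cutData.hi := by
  have hρ : 0 < I.ρ := by linarith [I.one_le_ρ]
  have hζ := I.ζ_pos
  set a := I.ρ.num.natAbs with ha
  set b := I.ρ.den with hb
  set p := I.ζ.num.natAbs with hp
  set q := I.ζ.den with hq
  have hb0 : 0 < b := I.ρ.den_pos
  have hq0 : 0 < q := I.ζ.den_pos
  have hbq : 0 < b * q := Nat.mul_pos hb0 hq0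
  have hb' : (0 : ℚ) < b := by exact_mod_cast hb0
  have hq' : (0 : ℚ) < q := by exact_mod_cast hq0
  have hρab : I.ρ = a / b := by
    have h1 : ((a : ℤ) : ℚ) = I.ρ.num := by
      rw [ha, Int.natAbs_of_nonneg (Rat.num_nonneg.2 hρ.le)]
    rw [← Int.cast_natCast, h1]; exact (Rat.num_div_den _).symm
  have hζpq : I.ζ = p / q := by
    have h1 : ((p : ℤ) : ℚ) = I.ζ.num := by
      rw [hp, Int.natAbs_of_nonneg (Rat.num_nonneg.2 hζ.le)]
    rw [← Int.cast_natCast, h1]; exact (Rat.num_div_den _).symm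
  have hlo : I.cutData.lo = min ((a * (q - p) + b * q - 1) / (b * q)) (I.n * I.n + 1) := rfl
  have hhi : I.cutData.hi = min (a * (q + p) / (b * q)) (I.n * I.n) := rfl
  have e1 : I.ρ * (1 + I.ζ) = (a * (q + p) : ℕ) / (b * q : ℕ) := by
    rw [hρab, hζpq]; push_cast; field_simp
  have e2 : I.ρ * (1 - I.ζ) = ((a : ℚ) * (q - p)) / (b * q : ℕ) := by
    rw [hρab, hζpq]; push_cast; field_simp
  have hbq' : (0 : ℚ) < (b * q : ℕ) := by exact_mod_cast hbq
  have u1 : ((x : ℚ) ≤ I.ρ * (1 + I.ζ)) ↔ x ≤ I.cutData.hi := by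
    rw [e1, le_div_iff₀ hbq', hhi, le_min_iff, Nat.le_div_iff_mul_le hbq, and_iff_left hle]
    exact_mod_cast Iff.rfl
  have u2 : (I.ρ * (1 - I.ζ) ≤ x) ↔ I.cutData.lo ≤ x := by
    have h1 : I.cutData.lo ≤ x ↔ a * (q - p) ≤ x * (b * q) := by
      rw [hlo, min_le_iff, or_iff_left (by omega), ← Nat.lt_succ_iff, Nat.div_lt_iff_lt_mul hbq,
        Nat.succ_mul]
      omega
    rw [h1, e2, div_le_iff₀ hbq']
    -- For `ζ ≥ 1` the truncated difference `q - p` is `0`, and the rational lower bound is at most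
    -- `0`: both conditions hold trivially.
    rcases le_total p q with h | h
    · rw [← Nat.cast_sub h]; exact_mod_cast Iff.rfl
    · rw [Nat.sub_eq_zero_of_le h]
      have h3 : (q : ℚ) - p ≤ 0 := by
        have : (q : ℚ) ≤ p := by exact_mod_cast h
        linarith
      have h4 : (a : ℚ) * (q - p) ≤ 0 := mul_nonpos_of_nonneg_of_nonpos (by positivity) h3
      have h5 : (0 : ℚ) ≤ (x : ℚ) * (b * q : ℕ) := by positivity
      exact ⟨fun _ => by simp, fun _ => h4.trans h5⟩
  rw [Feasible, hx, u1, u2]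

theorem big_le_bound : I.cutData.big ≤ Ex.bound₂ I.cutData := by
  have h1 : 0 < I.cutData.count := Ex.count_pos (by have := I.two_le_n; rw [cutData_n]; omega)
  have h2 : Ex.bound₁ I.n ≤ Ex.bound₂ I.cutData := Nat.le_mul_of_pos_left _ h1
  obtain ⟨-, h3, -⟩ := Ex.bound₁_ge I.n
  rw [CutData.big, cutData_n]
  nlinarith

open Classical in
theorem sampleSize_cutData (hd : 0 < I.G.minDegree) :
    I.cutData.k = 32 * ((I.n / I.G.minDegree + 1) * (I.n / I.G.minDegree + 1) *
      (I.n / I.G.minDegree + 1)) ∧ 32 * I.cutData.n ^ 3 ≤ I.cutData.k * I.G.minDegree ^ 3 := by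
  have hn := I.two_le_n
  have : Nonempty (Fin I.n) := ⟨⟨0, by omega⟩⟩
  refine CutData.sampleSize_spec (D := I.cutData) (by rw [cutData_n]; omega) hd (fun v hv => ?_) ?_
  · rw [I.deg_cutData ⟨v, hv⟩]; exact I.G.minDegree_le_degree _
  · obtain ⟨v, hv⟩ := I.G.exists_minimal_degree_vertex
    exact ⟨v, v.isLt, by rw [deg_cutData, hv]⟩

/-- The set that the algorithm computes is an approximate solution. -/
theorem isApproxSolution_out {ε : ℚ} (hε : 0 < ε) (hfeas : ∃ S, I.Feasible S)
    (hopt : (I.opt : ℚ) ≤ I.alpha ε * I.n ^ 2) (hd : ∀ v, 0 < I.cutData.deg (v : Fin I.n)) :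
    I.IsApproxSolution ε (I.setOf (I.cutData.out (Ex.bound₂ I.cutData))) := by
  classical
  have hn := I.two_le_n
  have : Nonempty (Fin I.n) := ⟨⟨0, by omega⟩⟩
  have hd0 : 0 < I.G.minDegree := by
    obtain ⟨v, hv⟩ := I.G.exists_minimal_degree_vertex
    rw [hv]; have := hd v; rwa [deg_cutData] at this
  obtain ⟨hkeq, hk⟩ := I.sampleSize_cutData hd0
  obtain ⟨S, hS, hScut⟩ : I.opt ∈ {k | ∃ S, I.Feasible S ∧ I.cutSize S = k} :=
    Nat.sInf_mem (by obtain ⟨S, hS⟩ := hfeas; exact ⟨_, S, hS, rfl⟩)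
  obtain ⟨x, hx, rfl⟩ := I.exists_indicator S
  have hD := I.small_cutData
  rw [I.feasible_iff (I.cost_setOf hx) (Ex.cost_le_of_small hD hx)] at hS
  rw [I.cutSize_setOf hx] at hScut
  obtain ⟨h1, h2, s, hs, hcut⟩ := CutData.out_good hD I.symm_cutData I.big_le_bound hd0
    (by rw [cutData_n]; omega)
    (fun v hv => by rw [I.deg_cutData ⟨v, hv⟩]; exact I.G.minDegree_le_degree _) hx
    (by rw [hkeq]; positivity) hk hS.1 hS.2
  have hy : ∀ v, I.cutData.out (Ex.bound₂ I.cutData) v ≤ 1 := fun v => Ex.cand_le _ v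
  refine ⟨(I.feasible_iff (I.cost_setOf hy) (Ex.cost_le_of_small hD hy)).2 ⟨h1, h2⟩, ?_⟩
  rw [I.cutSize_setOf hy]
  rw [hScut] at hs hcut
  set K : ℚ := (I.opt : ℚ) with hK
  set d : ℚ := (I.G.minDegree : ℚ) with hdd
  have hdpos : 0 < d := by rw [hdd]; exact_mod_cast hd0
  have hn' : (0 : ℚ) < I.n := by exact_mod_cast (show 0 < I.n by omega)
  have hK0 : 0 ≤ K := by positivity
  -- `550 = 22 * 25`, since `(1 / 2 - 3 / 10) ^ 2 = 1 / 25`.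
  have e1 : 550 * K ≤ ε * d ^ 2 := by
    have e2 : I.alpha ε ≤ ε / 22 * (1 / 2 - 3 * (1 / 10)) ^ 2 * (d / I.n) ^ 2 := min_le_left _ _
    have e3 : K ≤ ε / 22 * (1 / 2 - 3 * (1 / 10)) ^ 2 * (d / I.n) ^ 2 * I.n ^ 2 :=
      hopt.trans (mul_le_mul_of_nonneg_right e2 (by positivity))
    have e4 : ε / 22 * (1 / 2 - 3 * (1 / 10)) ^ 2 * (d / I.n) ^ 2 * I.n ^ 2 = ε * d ^ 2 / 550 := by
      field_simp; norm_num
    rw [e4] at e3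
    linarith
  have e5 : (s : ℚ) * d ≤ 16 * K := by rw [hK, hdd]; exact_mod_cast hs
  have e6 : (I.cutData.cut (I.cutData.out (Ex.bound₂ I.cutData)) : ℚ) ≤ K + 2 * s ^ 2 := by
    rw [hK]; exact_mod_cast hcut
  -- After multiplication by `d ^ 2` the left side is at most `512 * K ^ 2`, below `550 * K ^ 2 ≤ ε
  -- * d ^ 2 * K`.
  have e7 : 2 * (s : ℚ) ^ 2 ≤ ε * K := by
    have e8 : ((s : ℚ) * d) ^ 2 ≤ (16 * K) ^ 2 := pow_le_pow_left₀ (by positivity) e5 2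
    have e9 : 550 * K * K ≤ ε * d ^ 2 * K := mul_le_mul_of_nonneg_right e1 hK0
    have e10 : (2 * (s : ℚ) ^ 2) * d ^ 2 ≤ (ε * K) * d ^ 2 := by nlinarith
    exact le_of_mul_le_mul_right e10 (by positivity)
  linarith

end CMCInstance

/-! ### Polynomial bounds -/

namespace Ex

theorem exists_poly_bound {f g : ℕ → ℕ} (hf : ∃ C, ∀ B, f B ≤ C * (B + 1) ^ C)
    (hg : ∃ C, ∀ B, g B ≤ C * (B + 1) ^ C) :
    ∃ C, ∀ B, 200 + f B + 30 * B + B * (g B + 11) ≤ C * (B + 1) ^ C := by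
  obtain ⟨a, ha⟩ := hf
  obtain ⟨b, hb⟩ := hg
  -- With `c + 1 = a + b + 300`, the part `300` covers `200 + 41 * B`, and the exponent `c + 1`
  -- leaves one factor for `B * g B`.
  obtain ⟨c, hc⟩ : ∃ c, c = a + b + 299 := ⟨_, rfl⟩
  refine ⟨c + 1, fun B => ?_⟩
  have h1 : f B ≤ a * (B + 1) ^ (c + 1) :=
    (ha B).trans (Nat.mul_le_mul_left _ (Nat.pow_le_pow_right (by omega) (by omega)))
  have h2 : g B ≤ b * (B + 1) ^ c :=
    (hb B).trans (Nat.mul_le_mul_left _ (Nat.pow_le_pow_right (by omega) (by omega)))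
  have h3 : (B + 1) ^ (c + 1) = (B + 1) ^ c * (B + 1) := pow_succ _ _
  have h4 : 1 ≤ (B + 1) ^ c := Nat.one_le_pow _ _ (by omega)
  have h5 : B + 1 ≤ (B + 1) ^ (c + 1) := by rw [h3]; exact Nat.le_mul_of_pos_left _ h4
  have h6 : B * g B ≤ b * (B + 1) ^ (c + 1) := by
    rw [h3]
    calc B * g B ≤ (B + 1) * (b * (B + 1) ^ c) := Nat.mul_le_mul (by omega) h2
      _ = _ := by ring
  have h7 : B * (g B + 11) = B * g B + 11 * B := by ring
  have h8 : (c + 1) * (B + 1) ^ (c + 1) =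
      a * (B + 1) ^ (c + 1) + b * (B + 1) ^ (c + 1) + 300 * (B + 1) ^ (c + 1) := by rw [hc]; ring
  rw [h8, h7]
  omega

theorem timeBound_le : ∃ C, ∀ B, timeBound B ≤ C * (B + 1) ^ C :=
  exists_poly_bound (cost_le sampleSizeE) (cost_le outE)

theorem wordBound_le : ∃ C, ∀ M B, wordBound M B ≤ 100 * (M + 1) ^ 2 + C * (B + 1) ^ 2 := by
  refine ⟨arrs outE + arrs sampleSizeE + 10, fun M B => ?_⟩
  rw [wordBound]
  generalize arrs outE + arrs sampleSizeE = A
  have : B ≤ (B + 1) ^ 2 := by nlinarith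
  have h2 : (A + 10) * (B + 1) ^ 2 = (A + 10) * (B * B) + 2 * ((A + 10) * B) + (A + 10) := by ring
  nlinarith [Nat.zero_le (A * (B * B)), Nat.zero_le (A * B)]

/-- The bound is `(2 * n) ^ k * 200 * (n + 1) ^ 7`, with `200 ≤ (2 * n) ^ 8` and `n + 1 ≤ 2 * n`.
One more factor `2 * n` absorbs the `+ 1`, and `2 * n ≤ n ^ 2` doubles the exponent. -/
theorem bound₂_succ_le {D : CutData} {κ : ℕ} (hn : 2 ≤ D.n) (hk : D.k ≤ κ) :
    bound₂ D + 1 ≤ D.n ^ (2 * (κ + 16)) := by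
  have h1 : 2 * D.n ≤ D.n ^ 2 := by nlinarith
  have h2 : (2 * D.n) ^ D.k ≤ (2 * D.n) ^ κ := Nat.pow_le_pow_right (by omega) hk
  have h3 : bound₂ D ≤ (2 * D.n) ^ (κ + 15) := by
    rw [bound₂, CutData.count, bound₁, CutData.wmax]
    calc (2 * D.n) ^ D.k * (2 * ((D.n + 1) * (D.n + 1) * (D.n + 1))) *
          (100 * ((D.n + 1) * (D.n + 1) * (D.n + 1) * (D.n + 1)))
        = (2 * D.n) ^ D.k * (200 * (D.n + 1) ^ 7) := by ring
      _ ≤ (2 * D.n) ^ κ * ((2 * D.n) ^ 8 * (2 * D.n) ^ 7) := by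
          refine Nat.mul_le_mul h2 (Nat.mul_le_mul ?_ (Nat.pow_le_pow_left (by omega) 7))
          calc 200 ≤ 4 ^ 8 := by norm_num
            _ ≤ (2 * D.n) ^ 8 := Nat.pow_le_pow_left (by omega) 8
      _ = _ := by ring
  have h4 : 1 ≤ (2 * D.n) ^ (κ + 15) := Nat.one_le_pow _ _ (by omega)
  calc bound₂ D + 1 ≤ (2 * D.n) ^ (κ + 15) * (2 * D.n) := by nlinarith
    _ = (2 * D.n) ^ (κ + 16) := (pow_succ _ _).symm
    _ ≤ (D.n ^ 2) ^ (κ + 16) := Nat.pow_le_pow_left h1 _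
    _ = _ := (pow_mul _ _ _).symm

end Ex

/-! ### The run on an instance, and the theorem. -/

namespace CMCInstance

/-- The algorithm computes the output set for every instance. -/
theorem exists_steps (I : CMCInstance) (ε : ℚ) :
    ∃ t s, t ≤ Ex.timeBound (Ex.bound₂ I.cutData) ∧
      Steps (Ex.wordBound (I.params ε).sum (Ex.bound₂ I.cutData))
        ⟨[Ex.cutProg], ⟨fun _ => 0, fun i => (I.input ε).getD i 0⟩⟩ t ⟨[], s⟩ ∧
      I.output ⟨[], s⟩ = I.setOf (I.cutData.out (Ex.bound₂ I.cutData)) := by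
  have hn := I.two_le_n
  have hM : ∀ x ∈ I.params ε, x ≤ (I.params ε).sum := fun x hx => List.single_le_sum (by simp) x hx
  have hpar : ∀ i, (I.params ε).getD i 0 ≤ (I.params ε).sum := by
    intro i
    by_cases hi : i < (I.params ε).length
    · rw [List.getD_eq_getElem _ _ hi]; exact hM _ (List.getElem_mem hi)
    · rw [List.getD_eq_default _ _ (by omega)]; exact Nat.zero_le _
  have hlen : (I.params ε).length = 7 := rfl
  have hmem : ∀ i < 7, (I.input ε).getD i 0 = (I.params ε).getD i 0 := by
    intro i hi
    rw [input_eq, List.getD_append _ _ _ _ (by rw [hlen]; exact hi)]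
  have hdat : ∀ i, (I.input ε).getD (7 + i) 0 = I.data.getD i 0 := by
    intro i
    rw [input_eq, List.getD_append_right _ _ _ _ (by rw [hlen]; omega), hlen]
    congr 1; omega
  have hnM : I.n ≤ (I.params ε).sum := hpar 0
  have hall : RAMStore.AllLE ⟨fun _ => 0, fun i => (I.input ε).getD i 0⟩
      (Ex.wordBound (I.params ε).sum (Ex.bound₂ I.cutData)) := by
    have hW : (I.params ε).sum ≤ Ex.wordBound (I.params ε).sum (Ex.bound₂ I.cutData) := by
      rw [Ex.wordBound, add_assoc]
      exact le_trans (by nlinarith) (Nat.le_add_right _ _)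
    refine ⟨fun _ => Nat.zero_le _, fun i => le_trans ?_ hW⟩
    change (I.input ε).getD i 0 ≤ _
    rcases lt_or_ge i 7 with h | h
    · rw [hmem i h]; exact hpar i
    · obtain ⟨j, rfl⟩ := Nat.exists_eq_add_of_le h
      rw [hdat]
      by_cases hj : j < I.data.length
      · rw [List.getD_eq_getElem _ _ hj]
        exact (I.le_of_mem_data (List.getElem_mem hj)).trans hnM
      · rw [List.getD_eq_default _ _ (by omega)]; exact Nat.zero_le _
  obtain ⟨t, s, ht, hst, -, hq⟩ := Ex.wp_cutProg (M := (I.params ε).sum) (n := I.n)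
    (a := I.ρ.num.natAbs) (b := I.ρ.den) (p := I.ζ.num.natAbs) (q := I.ζ.den) (data := I.data)
    (s := ⟨fun _ => 0, fun i => (I.input ε).getD i 0⟩) (by omega)
    (hmem 0 (by omega)) (hmem 1 (by omega)) (hmem 2 (by omega)) (hmem 3 (by omega))
    (hmem 4 (by omega)) hnM (hpar 1) (hpar 2) (hpar 3) (hpar 4) I.length_data
    (fun i _ => hdat i) (fun x hx => I.le_of_mem_data hx) I.small_cutData hall
  refine ⟨t, s, ht, hst [], ?_⟩
  ext v
  rw [output, setOf, Finset.mem_filter, Finset.mem_filter]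
  exact and_congr_right fun _ => by rw [hq v v.isLt]; rfl

end CMCInstance

theorem mainTheorem7 :
    ∃ P : RAMProg, ∀ δ c₀ : ℝ, 0 < δ → 0 < c₀ → ∃ C : ℕ,
      ∀ I : CMCInstance, I.Dense δ c₀ → ∀ ε : ℚ, 0 < ε →
        -- the running time is at most `C * n ^ C`, for every outcome of the random choices
        (∀ x ∈ (P.run (I.input ε) (C * I.n ^ C)).support, x.Halted) ∧
        -- all numbers are polynomially bounded (words of logarithmic length)
        (∀ t : ℕ, ∀ x ∈ (P.run (I.input ε) t).support, x.WordsLE (C * (I.params ε).sum ^ C)) ∧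
        -- if `OPT ≤ α n²`, then the output is correct with high probability
        ((∃ S, I.Feasible S) → (I.opt : ℚ) ≤ I.alpha ε * I.n ^ 2 →
          1 - 1 / (I.n : ℝ≥0∞) ≤
            (P.run (I.input ε) (C * I.n ^ C)).toOuterMeasure
              {x | I.IsApproxSolution ε (I.output x)}) := by
  classical
  obtain ⟨a, ha⟩ := Ex.timeBound_le
  obtain ⟨b, hb⟩ := Ex.wordBound_le
  refine ⟨Ex.cutProg, fun δ c₀ hδ _ => ?_⟩
  -- Density bounds `n / minDegree` by `1 / δ`, so `κ` bounds the sample size and `e` is the degree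
  -- of the polynomial in `n` that bounds the cut-off.
  set r := ⌊1 / δ⌋₊ with hr
  set κ := 32 * ((r + 1) * (r + 1) * (r + 1)) with hκ
  set e := 2 * (κ + 16) with he
  refine ⟨a + b + 400 + e * a + e * 2, fun I hI ε hε => ?_⟩
  set C := a + b + 400 + e * a + e * 2 with hC
  have hn := I.two_le_n
  have : Nonempty (Fin I.n) := ⟨⟨0, by omega⟩⟩
  have hn' : (0 : ℝ) < I.n := by exact_mod_cast (show 0 < I.n by omega)
  have hdeg : ∀ v, 0 < I.G.degree v := fun v => by
    have := (mul_pos hδ hn').trans_le (hI.1 v)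
    exact_mod_cast this
  have hk : I.cutData.k ≤ κ := by
    obtain ⟨v, hv⟩ := I.G.exists_minimal_degree_vertex
    have hd0 : 0 < I.G.minDegree := by rw [hv]; exact hdeg v
    have hle : I.n / I.G.minDegree ≤ r := by
      have hd' : (0 : ℝ) < I.G.minDegree := by exact_mod_cast hd0
      refine Nat.le_floor (Nat.cast_div_le.trans ?_)
      rw [div_le_div_iff₀ hd' hδ, one_mul, mul_comm, hv]
      exact hI.1 v
    rw [(I.sampleSize_cutData hd0).1, hκ]
    gcongr
  have hB : Ex.bound₂ I.cutData + 1 ≤ I.n ^ e := Ex.bound₂_succ_le hn hk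
  have htime : Ex.timeBound (Ex.bound₂ I.cutData) ≤ C * I.n ^ C := by
    calc _ ≤ a * (Ex.bound₂ I.cutData + 1) ^ a := ha _
      _ ≤ a * (I.n ^ e) ^ a := Nat.mul_le_mul_left _ (Nat.pow_le_pow_left hB _)
      _ = a * I.n ^ (e * a) := by rw [← pow_mul I.n e a]
      _ ≤ _ := Nat.mul_le_mul (by omega) (Nat.pow_le_pow_right (by omega) (by omega))
  have hword : Ex.wordBound (I.params ε).sum (Ex.bound₂ I.cutData) ≤ C * (I.params ε).sum ^ C := by
    have hnM : I.n ≤ (I.params ε).sum := List.single_le_sum (by simp) _ (by simp [CMCInstance.params])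
    set M := (I.params ε).sum
    have h1 : 100 * (M + 1) ^ 2 ≤ 400 * M ^ C := by
      calc 100 * (M + 1) ^ 2 ≤ 100 * (2 * M) ^ 2 :=
            Nat.mul_le_mul_left _ (Nat.pow_le_pow_left (by omega) _)
        _ = 400 * M ^ 2 := by ring
        _ ≤ _ := Nat.mul_le_mul_left _ (Nat.pow_le_pow_right (by omega) (by omega))
    have h2 : b * (Ex.bound₂ I.cutData + 1) ^ 2 ≤ b * M ^ C := by
      calc b * (Ex.bound₂ I.cutData + 1) ^ 2 ≤ b * (I.n ^ e) ^ 2 :=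
            Nat.mul_le_mul_left _ (Nat.pow_le_pow_left hB _)
        _ = b * I.n ^ (e * 2) := by rw [← pow_mul I.n e 2]
        _ ≤ b * M ^ (e * 2) := Nat.mul_le_mul_left _ (Nat.pow_le_pow_left hnM _)
        _ ≤ _ := Nat.mul_le_mul_left _ (Nat.pow_le_pow_right (by omega) (by omega))
    calc _ ≤ 100 * (M + 1) ^ 2 + b * (Ex.bound₂ I.cutData + 1) ^ 2 := hb _ _
      _ ≤ (400 + b) * M ^ C := by rw [add_mul]; omega
      _ ≤ _ := Nat.mul_le_mul_right _ (by omega)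
  obtain ⟨t, s, ht, hst, hout⟩ := I.exists_steps ε
  obtain ⟨hlate, hall⟩ := RAMProg.run_of_steps hst
  have hrun := hlate (C * I.n ^ C) (ht.trans htime)
  refine ⟨fun x hx => ?_, fun t' x hx => ?_, fun hfeas hopt => ?_⟩
  · rw [hrun, PMF.support_pure, Set.mem_singleton_iff] at hx
    rw [hx]; rfl
  · obtain ⟨y, hy, hw⟩ := hall t'
    rw [hy, PMF.support_pure, Set.mem_singleton_iff] at hx
    subst hx
    exact ⟨fun i => (hw.1 i).trans hword, fun i => (hw.2 i).trans hword⟩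
  -- The event has probability one under the point mass.
  · rw [hrun, PMF.toOuterMeasure_pure_apply, if_pos]
    · exact tsub_le_self
    · rw [Set.mem_ofPred_eq, hout]
      exact I.isApproxSolution_out hε hfeas hopt fun v => by rw [I.deg_cutData]; exact hdeg v
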